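/- Write $\Box=\partial_t^2-\Delta$ on $\mathbb R\times\mathbb R^3$. Let $\dot H^1$ be the space of $f\in L^6(\mathbb R^3)$ with weak gradient in $L^2$. Let $\phi_0\in\dot H^1$, $\phi_1\in L^2(\mathbb R^3)$ be real-valued and let $C,\alpha\ge 1$. Then there is $T_0>0$, depending only on $\phi_0,\phi_1,C,\alpha$, such that the following holds. Let $\rho\in C_c^\infty(\mathbb R^3)$, $\rho\ge0$, $\int\rho=1$, $\rho_n(x)=n^3\rho(nx)$. Let $u,v\in L^\infty([0,\infty);\dot H^1)\cap \dot W^{1,\infty}([0,\infty);L^2)$ be two weak solutions of $\Box u+u^5=0$, $u(0)=\phi_0$, $\partial_tu(0)=\phi_1$, that is, for all $\psi\in C_c^\infty([0,\infty)\times\mathbb R^3)$, $$\int_{[0,\infty)\times\mathbb R^3}\bigl(u\,\Box\psi+u^5\psi\bigr)\,dx\,dt=\int_{\mathbb R^3}\bigl(\phi_1\psi(0,x)-\phi_0\,\partial_t\psi(0,x)\bigr)\,dx ,$$ and likewise for $v$. (For $t\ge0$, $u(t)$, $\nabla u(t)$ and $\partial_tu(t)$ denote the values of the representatives that are continuous in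 time in the sense of distributions.) With $e(u)=\frac12(|\nabla u|^2+(\partial_tu)^2)+\frac16u^6$ and $u_n(t)=u(t)*\rho_n$, assume that $u$, and likewise $v$, satisfies the local energy inequalities $$\int_{B(x_0,t_0-t)}e(u(t,x))\,dx\le C\int_{B(x_0,\alpha(t_0-s))}e(u(s,x))\,dx\qquad(x_0\in\mathbb R^3,\ 0\le s\le t\le t_0),$$ $$\limsup_{n\to\infty}\int_{|y|<t'-t_1}\Bigl(\tfrac12|\nabla w_n(y)|^2+\tfrac16w_n(y)^6\Bigr)dy\le C\int_{B(x_1,\alpha(t'-t_1))}e(u(t',x))\,dx\qquad(x_1\in\mathbb R^3,\ 0\le t_1\le t'),$$ where $w_n(y)=u_n(t_1+|y|,x_1+y)$; the left-hand side of the second one is the flux of $u_n$ through the forward cone with vertex $(t_1,x_1)$. Put $$V_n=u_n^4+4u_n^3v_n+6u_n^2v_n^2+4u_nv_n^3+v_n^4 .$$ Then for every $0<T\le T_0$ and every $F\in C_c^\infty((0,T)\times\mathbb R^3)$ there are a compact set $K\subset[0,T)\times\mathbb R^3$ and a constant $M$ such that for every integer $n\ge1$ the problem $$\Box\phi_n+V_n\phi_n=F\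 \text{ on }[0,T]\times\mathbb R^3,\qquad \phi_n(T)=\partial_t\phi_n(T)=0,$$ has a solution $\phi_n$ that vanishes outside $K$, satisfies $|\phi_n|\le M$ on $[0,T]\times\mathbb R^3$, and is smooth in the following sense: all the derivatives $\partial_x^\beta\partial_t^j\phi_n$ with $\beta$ arbitrary and $j\le3$ exist and are continuous on $[0,T]\times\mathbb R^3$; moreover, for every integer $k\ge 0$, if all $\partial_x^\beta\partial_t^jV_n$ with $j\le k$ exist and are continuous on $[0,T]\times\mathbb R^3$, then so are all $\partial_x^\beta\partial_t^j\phi_n$ with $j\le k+2$. -/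

import Mathlib

open MeasureTheory Filter Set
open scoped ContDiff ENNReal Convolution Laplacian

noncomputable section

/-- Three-dimensional Euclidean space. -/
abbrev E3 : Type := EuclideanSpace ℝ (Fin 3)

/-! ### Function spaces and weak derivatives -/

/-- A test function on `ℝ³`: an element of `C_c^∞(ℝ³)`. -/
def IsTestFunction (ψ : E3 → ℝ) : Prop :=
  ContDiff ℝ ∞ ψ ∧ HasCompactSupport ψ

/-- `g` is the gradient of `f` in the sense of distributions on `ℝ³`, tested in every
direction `e`. -/
def HasWeakGradient (f : E3 → ℝ) (g : E3 → E3) : Prop :=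
  ∀ ψ : E3 → ℝ, IsTestFunction ψ → ∀ e : E3,
    ∫ x, f x * fderiv ℝ ψ x e = - ∫ x, inner ℝ (g x) e * ψ x

/-- The homogeneous Sobolev space `Ḣ¹(ℝ³)`, realized as the space of the functions in `L⁶` whose
weak gradient is in `L²`. -/
def MemHomSobolev (f : E3 → ℝ) : Prop :=
  MemLp f 6 volume ∧ ∃ g : E3 → E3, HasWeakGradient f g ∧ MemLp g 2 volume

/-- `u ∈ L^∞_t(Ḣ¹) ∩ Ẇ^{1,∞}_t(L²)` on `[0,∞) × ℝ³`, with `Du` its spatial gradient and `ut` its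
time derivative. The functions are the representatives that are continuous in time in the sense
of distributions, so that `u t`, `Du t` and `ut t` have a meaning for every `t ≥ 0`. -/
structure IsEnergyClass (u : ℝ → E3 → ℝ) (Du : ℝ → E3 → E3) (ut : ℝ → E3 → ℝ) : Prop where
  measurable_u : AEStronglyMeasurable (fun z : ℝ × E3 => u z.1 z.2)
    (volume.restrict (Ici (0 : ℝ) ×ˢ (univ : Set E3)))
  measurable_Du : AEStronglyMeasurable (fun z : ℝ × E3 => Du z.1 z.2)
    (volume.restrict (Ici (0 : ℝ) ×ˢ (univ : Set E3)))
  measurable_ut : AEStronglyMeasurable (fun z : ℝ × E3 => ut z.1 z.2)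
    (volume.restrict (Ici (0 : ℝ) ×ˢ (univ : Set E3)))
  memLp_u : ∀ t, 0 ≤ t → MemLp (u t) 6 volume
  weakGradient : ∀ t, 0 ≤ t → HasWeakGradient (u t) (Du t)
  memLp_Du : ∀ t, 0 ≤ t → MemLp (Du t) 2 volume
  memLp_ut : ∀ t, 0 ≤ t → MemLp (ut t) 2 volume
  bounded : ∃ M : ℝ, ∀ t, 0 ≤ t →
    eLpNorm (Du t) 2 volume ≤ ENNReal.ofReal M ∧ eLpNorm (ut t) 2 volume ≤ ENNReal.ofReal M
  hasDeriv : ∀ ψ : E3 → ℝ, IsTestFunction ψ → ∀ t, 0 ≤ t →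
    HasDerivWithinAt (fun s => ∫ x, u s x * ψ x) (∫ x, ut t x * ψ x) (Ici 0) t
  continuous_ut : ∀ ψ : E3 → ℝ, IsTestFunction ψ →
    ContinuousOn (fun t => ∫ x, ut t x * ψ x) (Ici 0)

/-! ### The wave operator and weak solutions of the quintic wave equation -/

/-- The wave operator `□ = ∂_t² - Δ`, the time derivatives being taken within the set `S`. -/
def waveOp (S : Set ℝ) (φ : ℝ → E3 → ℝ) (t : ℝ) (x : E3) : ℝ :=
  iteratedDerivWithin 2 (fun s => φ s x) S t - Δ (φ t) x

/-- `u` is a weak solution on `[0,∞) × ℝ³` of `□u + u⁵ = 0` with data `(φ₀, φ₁)`, in the class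
`L^∞_t(Ḣ¹) ∩ Ẇ^{1,∞}_t(L²)`. The test functions, elements of `C_c^∞([0,∞) × ℝ³)`, are the
restrictions of elements of `C_c^∞(ℝ × ℝ³)`. -/
structure IsWeakSolution (φ₀ φ₁ : E3 → ℝ)
    (u : ℝ → E3 → ℝ) (Du : ℝ → E3 → E3) (ut : ℝ → E3 → ℝ) : Prop where
  energyClass : IsEnergyClass u Du ut
  initial_u : u 0 =ᵐ[volume] φ₀
  initial_ut : ut 0 =ᵐ[volume] φ₁
  weak_eq : ∀ ψ : ℝ → E3 → ℝ, ContDiff ℝ ∞ (fun z : ℝ × E3 => ψ z.1 z.2) →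
    HasCompactSupport (fun z : ℝ × E3 => ψ z.1 z.2) →
    ∫ z in Ici (0 : ℝ) ×ˢ (univ : Set E3),
        (u z.1 z.2 * waveOp univ ψ z.1 z.2 + u z.1 z.2 ^ 5 * ψ z.1 z.2) =
      ∫ x, (φ₁ x * ψ 0 x - φ₀ x * deriv (fun s => ψ s x) 0)

/-! ### Mollification -/

/-- A nonnegative function in `C_c^∞(ℝ³)` of integral one. -/
structure IsMollifier (ρ : E3 → ℝ) : Prop where
  contDiff : ContDiff ℝ ∞ ρ
  hasCompactSupport : HasCompactSupport ρ
  nonneg : ∀ x, 0 ≤ ρ x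
  integral_eq_one : ∫ x, ρ x = 1

/-- The regularization in space `u_n(t) = u(t) * ρ_n`, with `ρ_n(x) = n³ ρ(n x)`. -/
def mollify (ρ : E3 → ℝ) (n : ℕ) (u : ℝ → E3 → ℝ) (t : ℝ) (x : E3) : ℝ :=
  ((u t) ⋆[ContinuousLinearMap.mul ℝ ℝ, volume] (fun y => (n : ℝ) ^ 3 * ρ ((n : ℝ) • y))) x

/-- The regularized potential
`V_n = u_n⁴ + 4 u_n³ v_n + 6 u_n² v_n² + 4 u_n v_n³ + v_n⁴`. -/
def potential (ρ : E3 → ℝ) (n : ℕ) (u v : ℝ → E3 → ℝ) (t : ℝ) (x : E3) : ℝ :=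
  mollify ρ n u t x ^ 4 + 4 * mollify ρ n u t x ^ 3 * mollify ρ n v t x
    + 6 * mollify ρ n u t x ^ 2 * mollify ρ n v t x ^ 2
    + 4 * mollify ρ n u t x * mollify ρ n v t x ^ 3 + mollify ρ n v t x ^ 4

/-! ### Local energy conditions -/

/-- The local energy `∫_{B(x₀,r)} e(u(t,x)) dx`, where
`e(u) = (|∇u|² + (∂_t u)²) / 2 + u⁶ / 6`. -/
def localEnergy (u : ℝ → E3 → ℝ) (Du : ℝ → E3 → E3) (ut : ℝ → E3 → ℝ)
    (t : ℝ) (x₀ : E3) (r : ℝ) : ℝ≥0∞ :=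
  ∫⁻ x in Metric.ball x₀ r,
    ENNReal.ofReal ((‖Du t x‖ ^ 2 + ut t x ^ 2) / 2 + u t x ^ 6 / 6)

/-- The flux of `f` through the forward cone `{(τ,x) : |x - x₁| = τ - t₁, t₁ ≤ τ ≤ t'}`. The cone
is parametrized by `y ↦ (t₁ + |y|, x₁ + y)` with `|y| < t' - t₁`; then `dy` is the surface measure
of the cone divided by `√2`, and the gradient of `y ↦ f (t₁ + |y|, x₁ + y)` collects the
derivatives of `f` tangential to the cone. -/
def coneFlux (f : ℝ → E3 → ℝ) (t₁ : ℝ) (x₁ : E3) (t' : ℝ) : ℝ≥0∞ :=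
  ∫⁻ y in Metric.ball (0 : E3) (t' - t₁),
    ENNReal.ofReal (‖fderiv ℝ (fun y' : E3 => f (t₁ + ‖y'‖) (x₁ + y')) y‖ ^ 2 / 2
      + f (t₁ + ‖y‖) (x₁ + y) ^ 6 / 6)

/-- The two local energy inequalities, with constants `C` and `α` uniform with respect to the
vertex of the cone; the flux of the nonsmooth function `u` is understood as the upper limit of
the fluxes of its regularizations in space. -/
structure LocalEnergyConditions (C α : ℝ) (ρ : E3 → ℝ)
    (u : ℝ → E3 → ℝ) (Du : ℝ → E3 → E3) (ut : ℝ → E3 → ℝ) : Prop where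
  backward : ∀ (x₀ : E3) (s t t₀ : ℝ), 0 ≤ s → s ≤ t → t ≤ t₀ →
    localEnergy u Du ut t x₀ (t₀ - t) ≤
      ENNReal.ofReal C * localEnergy u Du ut s x₀ (α * (t₀ - s))
  forward : ∀ (x₁ : E3) (t₁ t' : ℝ), 0 ≤ t₁ → t₁ ≤ t' →
    limsup (fun n : ℕ => coneFlux (mollify ρ n u) t₁ x₁ t') atTop ≤
      ENNReal.ofReal C * localEnergy u Du ut t' x₁ (α * (t' - t₁))

/-! ### The dual problem -/

/-- `F ∈ C_c^∞((0,T) × ℝ³)`. -/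
def IsSource (T : ℝ) (F : ℝ → E3 → ℝ) : Prop :=
  ContDiff ℝ ∞ (fun z : ℝ × E3 => F z.1 z.2) ∧
  HasCompactSupport (fun z : ℝ × E3 => F z.1 z.2) ∧
  tsupport (fun z : ℝ × E3 => F z.1 z.2) ⊆ Ioo 0 T ×ˢ univ

/-- All the derivatives `∂_x^β ∂_t^j f` with `j ≤ k` and `β` arbitrary exist and are continuous
on `[0,T] × ℝ³` (one-sided time derivatives at `t = 0` and `t = T`). -/
def IsSmoothTimeOrder (k : ℕ) (T : ℝ) (f : ℝ → E3 → ℝ) : Prop :=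
  (∀ x, ContDiffOn ℝ k (fun t => f t x) (Icc 0 T)) ∧
  ∀ j : ℕ, j ≤ k →
    (∀ t ∈ Icc 0 T,
      ContDiff ℝ ∞ (fun x => iteratedDerivWithin j (fun s => f s x) (Icc 0 T) t)) ∧
    ∀ m : ℕ, ContinuousOn
      (fun z : ℝ × E3 => iteratedFDeriv ℝ m
        (fun x => iteratedDerivWithin j (fun s => f s x) (Icc 0 T) z.1) z.2)
      (Icc 0 T ×ˢ univ)

/-- `φ` solves `□φ + V φ = F` on `[0,T] × ℝ³` with `φ(T) = ∂_t φ(T) = 0`. -/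
structure SolvesDual (T : ℝ) (V F φ : ℝ → E3 → ℝ) : Prop where
  equation : ∀ t ∈ Icc 0 T, ∀ x, waveOp (Icc 0 T) φ t x + V t x * φ t x = F t x
  final : ∀ x, φ T x = 0
  final_deriv : ∀ x, derivWithin (fun s => φ s x) (Icc 0 T) T = 0

end

/-! For fixed `n` the dual problem is linear with a potential smooth in space and `C¹` in time. It
is equivalent to the integral equation `φ = retarded T (F - V φ)`, where `retarded` is Kirchhoff's
formula run backwards from time `T`. A Neumann series solves it: a weight exponential in time makes
the series geometric in every `C^m` norm in space, and finite speed of propagation keeps all terms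
in one backward cone (`exists_dual_solution`). Kirchhoff's formula rests on Darboux's identity,
which follows from the rotation invariance of the sphere measure. Time regularity comes from `∂_t²φ
= F - V φ + Δφ`: the right side costs only space derivatives, so `φ` gains two time orders over `V`;
as `u_n` and `v_n` are `C¹` in time, three orders are always available.

The real point is the bound `M`, uniform in `n`. Kirchhoff's kernel is positive, so the supremum `S`
of `|φ|` satisfies `S ≤ T² sup |F| + (S / 4π) sup ∫ V / |y|`, the integrals being over forward light
cones truncated at time `T` (`conePotential`). If these are at most `2π`, then `S ≤ 2 T² sup |F|`
(`abs_dual_solution_le`). Since `V_n = (u_n + v_n)⁴ ≤ 8 (u_n⁴ + v_n⁴)`, it suffices that the cone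
integrals of `u_n⁴ / |y|` and `v_n⁴ / |y|` are at most `π / 8`.

A Hardy-type inequality on each light ray, integrated over the sphere, bounds the cone integral of
`u_n⁴ / |y|` by the flux of `u_n` through a cone of twice the height, plus a small absolute constant
(`conePotential_pow_four_le`). In the upper limit the flux is at most `C²` times the energy of the
data in a ball of radius comparable to `T`, by the forward and then the backward energy inequality.
That energy is uniformly small for small radii by absolute continuity of the integral, which fixes
`T₀` from the data, `C` and `α` alone.

The flux hypothesis is an upper limit at each vertex, so it gives smallness only for `n` large
depending on the vertex. Fatou's lemma transfers the bound to `liminf u_m⁴`, at every vertex. This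
function equals `u⁴` almost everywhere on each time slice, so Jensen's inequality dominates `u_n⁴`
by its average against `ρ_n`. By Tonelli the cone integral of `u_n⁴ / |y|` is then at most an
average over vertices of quantities already bounded, for every `n ≥ 1` (`conePotential_mollify_le`).
-/

/-! ### Families of smooth functions depending continuously on a parameter -/

section JointSmooth

variable {X Y F G H : Type} [TopologicalSpace X] [TopologicalSpace Y]
  [NormedAddCommGroup F] [NormedSpace ℝ F] [NormedAddCommGroup G] [NormedSpace ℝ G]
  [NormedAddCommGroup H] [NormedSpace ℝ H]

/-- The functions `f t` are `C^m`, with derivatives that are jointly continuous in `(t, x)`. -/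
def JointContDiff (m : ℕ) (f : X → E3 → F) : Prop :=
  (∀ t, ContDiff ℝ m (f t)) ∧
    ∀ j ≤ m, Continuous fun z : X × E3 => iteratedFDeriv ℝ j (f z.1) z.2

/-- The functions `f t` are smooth, with derivatives that are jointly continuous in `(t, x)`. -/
def JointSmooth (f : X → E3 → F) : Prop := ∀ m, JointContDiff m f

theorem jointContDiff_zero_iff {f : X → E3 → F} :
    JointContDiff 0 f ↔ Continuous fun z : X × E3 => f z.1 z.2 := by
  have key : (Continuous fun z : X × E3 => iteratedFDeriv ℝ 0 (f z.1) z.2) ↔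
      Continuous fun z : X × E3 => f z.1 z.2 := by
    simp only [iteratedFDeriv_zero_eq_comp]
    exact (continuousMultilinearCurryFin0 ℝ E3 F).symm.comp_continuous_iff
  constructor
  · intro h
    exact key.1 (h.2 0 le_rfl)
  · intro h
    refine ⟨fun t => ?_, fun j hj => ?_⟩
    · exact contDiff_zero.2 (h.comp (Continuous.prodMk_right t))
    · obtain rfl : j = 0 := by omega
      exact key.2 h

theorem continuous_iteratedFDeriv_succ_iff {f : X → E3 → F} {j : ℕ} :
    (Continuous fun z : X × E3 => iteratedFDeriv ℝ (j + 1) (f z.1) z.2) ↔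
      Continuous fun z : X × E3 => iteratedFDeriv ℝ j (fderiv ℝ (f z.1)) z.2 := by
  simp only [iteratedFDeriv_succ_eq_comp_right]
  exact (continuousMultilinearCurryRightEquiv' ℝ j E3 F).symm.comp_continuous_iff

/-- This recursion replaces iterated derivatives by a first derivative with values in a larger
space, so later inductions must generalize over the target space. -/
theorem jointContDiff_succ_iff {f : X → E3 → F} {m : ℕ} :
    JointContDiff (m + 1) f ↔ (Continuous fun z : X × E3 => f z.1 z.2) ∧
      (∀ t, Differentiable ℝ (f t)) ∧ JointContDiff m fun t => fderiv ℝ (f t) := by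
  constructor
  · intro h
    have h1 := fun t => contDiff_succ_iff_fderiv.1
      (show ContDiff ℝ ((m : WithTop ℕ∞) + 1) (f t) by exact_mod_cast h.1 t)
    refine ⟨jointContDiff_zero_iff.1 ⟨fun t => (h.1 t).of_le (by simp), fun j hj => ?_⟩,
      fun t => (h1 t).1, fun t => (h1 t).2.2, fun j hj => ?_⟩
    · exact h.2 j (by omega)
    · exact continuous_iteratedFDeriv_succ_iff.1 (h.2 (j + 1) (by omega))
  · rintro ⟨h0, h1, h2⟩
    refine ⟨fun t => ?_, fun j hj => ?_⟩
    · have := contDiff_succ_iff_fderiv.2 ⟨h1 t, by simp, h2.1 t⟩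
      exact_mod_cast this
    · rcases j with _ | j
      · exact (jointContDiff_zero_iff.2 h0).2 0 le_rfl
      · exact continuous_iteratedFDeriv_succ_iff.2 (h2.2 j (by omega))

theorem JointContDiff.of_le {f : X → E3 → F} {m n : ℕ} (h : JointContDiff n f) (hmn : m ≤ n) :
    JointContDiff m f :=
  ⟨fun t => (h.1 t).of_le (by exact_mod_cast hmn), fun j hj => h.2 j (hj.trans hmn)⟩

theorem JointContDiff.continuous {f : X → E3 → F} {m : ℕ} (h : JointContDiff m f) :
    Continuous fun z : X × E3 => f z.1 z.2 :=
  jointContDiff_zero_iff.1 (h.of_le (Nat.zero_le m))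

theorem JointSmooth.continuous {f : X → E3 → F} (h : JointSmooth f) :
    Continuous fun z : X × E3 => f z.1 z.2 :=
  (h 0).continuous

theorem JointSmooth.contDiff {f : X → E3 → F} (h : JointSmooth f) (t : X) :
    ContDiff ℝ ∞ (f t) :=
  contDiff_infty.2 fun m => (h m).1 t

theorem JointSmooth.differentiable {f : X → E3 → F} (h : JointSmooth f) (t : X) :
    Differentiable ℝ (f t) :=
  (h.contDiff t).differentiable (by simp)

theorem jointSmooth_iff {f : X → E3 → F} :
    JointSmooth f ↔ (∀ t, ContDiff ℝ ∞ (f t)) ∧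
      ∀ m : ℕ, Continuous fun z : X × E3 => iteratedFDeriv ℝ m (f z.1) z.2 :=
  ⟨fun h => ⟨h.contDiff, fun m => (h m).2 m le_rfl⟩,
    fun h m => ⟨fun t => (h.1 t).of_le (by exact_mod_cast le_top), fun j _ => h.2 j⟩⟩

theorem JointSmooth.fderiv {f : X → E3 → F} (h : JointSmooth f) :
    JointSmooth fun t => fderiv ℝ (f t) :=
  fun m => (jointContDiff_succ_iff.1 (h (m + 1))).2.2

/-- Coinduction: a property of families that is stable under taking spatial derivatives and
implies continuity and differentiability implies joint smoothness. -/
theorem JointSmooth.of_invariant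
    (P : ∀ (F : Type) [NormedAddCommGroup F] [NormedSpace ℝ F], (X → E3 → F) → Prop)
    (hP : ∀ (F : Type) [NormedAddCommGroup F] [NormedSpace ℝ F] (f : X → E3 → F), P F f →
      (Continuous fun z : X × E3 => f z.1 z.2) ∧ (∀ t, Differentiable ℝ (f t)) ∧
        P (E3 →L[ℝ] F) fun t => _root_.fderiv ℝ (f t))
    {f : X → E3 → F} (hf : P F f) : JointSmooth f := by
  intro m
  induction m generalizing F with
  | zero => exact jointContDiff_zero_iff.2 (hP F f hf).1
  | succ m ih =>
    obtain ⟨h0, h1, h2⟩ := hP F f hf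
    exact jointContDiff_succ_iff.2 ⟨h0, h1, ih h2⟩

theorem JointSmooth.comp_param {f : X → E3 → F} (h : JointSmooth f) {τ : Y → X}
    (hτ : Continuous τ) : JointSmooth fun t => f (τ t) :=
  fun m => ⟨fun t => (h m).1 (τ t), fun j hj =>
    ((h m).2 j hj).comp ((hτ.comp continuous_fst).prodMk continuous_snd)⟩

theorem JointSmooth.add {f g : X → E3 → F} (hf : JointSmooth f) (hg : JointSmooth g) :
    JointSmooth fun t x => f t x + g t x := by
  rw [jointSmooth_iff] at *
  refine ⟨fun t => (hf.1 t).add (hg.1 t), fun m => ?_⟩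
  have : ∀ z : X × E3, iteratedFDeriv ℝ m (fun x => f z.1 x + g z.1 x) z.2 =
      iteratedFDeriv ℝ m (f z.1) z.2 + iteratedFDeriv ℝ m (g z.1) z.2 := fun z =>
    iteratedFDeriv_add_apply (((hf.1 z.1).of_le (by exact_mod_cast le_top)).contDiffAt)
      (((hg.1 z.1).of_le (by exact_mod_cast le_top)).contDiffAt)
  simp only [this]
  exact (hf.2 m).add (hg.2 m)

theorem JointSmooth.clm_comp {f : X → E3 → F} (hf : JointSmooth f) (A : F →L[ℝ] G) :
    JointSmooth fun t x => A (f t x) := by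
  rw [jointSmooth_iff] at *
  refine ⟨fun t => A.contDiff.comp (hf.1 t), fun m => ?_⟩
  have : ∀ z : X × E3, iteratedFDeriv ℝ m (fun x => A (f z.1 x)) z.2 =
      A.compContinuousMultilinearMap (iteratedFDeriv ℝ m (f z.1) z.2) := fun z =>
    A.iteratedFDeriv_comp_left (hf.1 z.1).contDiffAt (by exact_mod_cast le_top)
  simp only [this]
  exact (ContinuousLinearMap.compContinuousMultilinearMapL ℝ (fun _ : Fin m => E3) F G
    A).continuous.comp (hf.2 m)

theorem JointSmooth.neg {f : X → E3 → F} (hf : JointSmooth f) :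
    JointSmooth fun t x => - f t x :=
  hf.clm_comp (-ContinuousLinearMap.id ℝ F)

theorem JointSmooth.sub {f g : X → E3 → F} (hf : JointSmooth f) (hg : JointSmooth g) :
    JointSmooth fun t x => f t x - g t x := by
  simpa only [sub_eq_add_neg] using hf.add hg.neg

theorem JointContDiff.add {f g : X → E3 → F} {m : ℕ} (hf : JointContDiff m f)
    (hg : JointContDiff m g) : JointContDiff m fun t x => f t x + g t x := by
  refine ⟨fun t => (hf.1 t).add (hg.1 t), fun j hj => ?_⟩
  have : ∀ z : X × E3, iteratedFDeriv ℝ j (fun x => f z.1 x + g z.1 x) z.2 =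
      iteratedFDeriv ℝ j (f z.1) z.2 + iteratedFDeriv ℝ j (g z.1) z.2 := fun z =>
    iteratedFDeriv_add_apply (((hf.1 z.1).of_le (by exact_mod_cast hj)).contDiffAt)
      (((hg.1 z.1).of_le (by exact_mod_cast hj)).contDiffAt)
  simp only [this]
  exact (hf.2 j hj).add (hg.2 j hj)

theorem JointContDiff.bilinear {m : ℕ} (B : F →L[ℝ] G →L[ℝ] H) {f : X → E3 → F} {g : X → E3 → G}
    (hf : JointContDiff m f) (hg : JointContDiff m g) :
    JointContDiff m fun t x => B (f t x) (g t x) := by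
  induction m generalizing F G H with
  | zero =>
    rw [jointContDiff_zero_iff] at *
    exact B.continuous₂.comp (hf.prodMk hg)
  | succ m ih =>
    have hf' := jointContDiff_succ_iff.1 hf
    have hg' := jointContDiff_succ_iff.1 hg
    refine jointContDiff_succ_iff.2 ⟨B.continuous₂.comp (hf'.1.prodMk hg'.1), fun t x =>
      (B.hasFDerivAt_of_bilinear (hf'.2.1 t x).hasFDerivAt
        (hg'.2.1 t x).hasFDerivAt).differentiableAt, ?_⟩
    -- The two terms of the Leibniz rule are again bilinear expressions, with values in a space of
    -- linear maps; hence the induction over all `F`, `G`, `H`.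
    have : (fun t => fderiv ℝ fun x => B (f t x) (g t x)) = fun t x =>
        B.precompR E3 (f t x) (fderiv ℝ (g t) x) + B.precompL E3 (fderiv ℝ (f t) x) (g t x) := by
      funext t x
      exact (B.hasFDerivAt_of_bilinear (hf'.2.1 t x).hasFDerivAt
        (hg'.2.1 t x).hasFDerivAt).fderiv
    rw [this]
    exact (ih _ (hf.of_le (Nat.le_succ m)) hg'.2.2).add
      (ih _ hf'.2.2 (hg.of_le (Nat.le_succ m)))

theorem JointSmooth.bilinear (B : F →L[ℝ] G →L[ℝ] H) {f : X → E3 → F} {g : X → E3 → G}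
    (hf : JointSmooth f) (hg : JointSmooth g) : JointSmooth fun t x => B (f t x) (g t x) :=
  fun m => (hf m).bilinear B (hg m)

theorem JointSmooth.mul {f g : X → E3 → ℝ} (hf : JointSmooth f) (hg : JointSmooth g) :
    JointSmooth fun t x => f t x * g t x :=
  hf.bilinear (ContinuousLinearMap.mul ℝ ℝ) hg

end JointSmooth

/-! ### Integrals depending on parameters -/

section ParametricIntegral

variable {Y F : Type} [TopologicalSpace Y] [SecondCountableTopology Y] [MeasurableSpace Y]
  [OpensMeasurableSpace Y] [NormedAddCommGroup F] [NormedSpace ℝ F]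

theorem hasFDerivAt_setIntegral_of_continuous {μ : Measure Y} [IsFiniteMeasureOnCompacts μ]
    {s : Set Y} (hs : IsCompact s) (hsm : MeasurableSet s) {f : E3 → Y → F}
    {f' : E3 → Y → E3 →L[ℝ] F}
    (hf : Continuous fun z : E3 × Y => f z.1 z.2) (hf' : Continuous fun z : E3 × Y => f' z.1 z.2)
    (hd : ∀ x y, HasFDerivAt (fun x => f x y) (f' x y) x) (x₀ : E3) :
    HasFDerivAt (fun x => ∫ y in s, f x y ∂μ) (∫ y in s, f' x₀ y ∂μ) x₀ := by
  have hK : IsCompact (Metric.closedBall x₀ 1 ×ˢ s) := (isCompact_closedBall x₀ 1).prod hs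
  obtain ⟨B, hB⟩ := hK.exists_bound_of_continuousOn hf'.continuousOn
  have hfin : IsFiniteMeasure (μ.restrict s) :=
    ⟨by rw [Measure.restrict_apply_univ]; exact hs.measure_lt_top⟩
  refine hasFDerivAt_integral_of_dominated_of_fderiv_le (bound := fun _ => B)
    (Metric.closedBall_mem_nhds x₀ one_pos) (Eventually.of_forall fun x => ?_) ?_ ?_ ?_
    (integrable_const B) ?_
  · exact (hf.comp (Continuous.prodMk_right x)).aestronglyMeasurable
  · exact (hf.comp (Continuous.prodMk_right x₀)).continuousOn.integrableOn_compact' hs hsm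
  · exact (hf'.comp (Continuous.prodMk_right x₀)).aestronglyMeasurable
  · filter_upwards [ae_restrict_mem hsm] with y hy x hx
    exact hB (x, y) ⟨hx, hy⟩
  · exact Eventually.of_forall fun y x _ => hd x y

end ParametricIntegral

/-! ### Finite order of smoothness in time -/

/-- Composition with the retraction `projIcc` extends functions from the closed slab, so one-sided
notions at the end times become ordinary continuity on a subtype. -/
theorem continuousOn_Icc_prod_iff {A : Type} [TopologicalSpace A] {T : ℝ} (hT : 0 ≤ T)
    {h : ℝ × E3 → A} :
    ContinuousOn h (Icc 0 T ×ˢ univ) ↔ Continuous fun z : Icc 0 T × E3 => h (z.1, z.2) := by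
  constructor
  · intro hc
    exact hc.comp_continuous (by fun_prop) fun z => ⟨z.1.2, mem_univ _⟩
  · intro hc
    have := hc.comp (f := fun z : ℝ × E3 => (projIcc 0 T hT z.1, z.2))
      ((continuous_projIcc.comp continuous_fst).prodMk continuous_snd)
    refine this.continuousOn.congr fun z hz => ?_
    simp only [Function.comp_apply, projIcc_of_mem hT hz.1, Prod.mk.eta]

section TimeSmooth

variable {F G H : Type} [NormedAddCommGroup F] [NormedSpace ℝ F] [NormedAddCommGroup G]
  [NormedSpace ℝ G] [NormedAddCommGroup H] [NormedSpace ℝ H]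

/-- A recursive form of `IsSmoothTimeOrder`, for functions with values in a normed space. -/
def TimeSmooth (T : ℝ) : ℕ → (ℝ → E3 → F) → Prop
  | 0, f => JointSmooth fun t : Icc 0 T => f t
  | k + 1, f => JointSmooth (fun t : Icc 0 T => f t) ∧ ∃ f' : ℝ → E3 → F, TimeSmooth T k f' ∧
      ∀ t ∈ Icc 0 T, ∀ x, HasDerivWithinAt (fun s => f s x) (f' t x) (Icc 0 T) t

variable {T : ℝ} {k : ℕ}

theorem TimeSmooth.jointSmooth {f : ℝ → E3 → F} (h : TimeSmooth T k f) :
    JointSmooth fun t : Icc 0 T => f t := by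
  cases k with
  | zero => exact h
  | succ k => exact h.1

theorem TimeSmooth.of_succ {f : ℝ → E3 → F} (h : TimeSmooth T (k + 1) f) : TimeSmooth T k f := by
  induction k generalizing f with
  | zero => exact h.1
  | succ k ih =>
    obtain ⟨h0, f', h1, h2⟩ := h
    exact ⟨h0, f', ih h1, h2⟩

theorem TimeSmooth.of_le {f : ℝ → E3 → F} {j : ℕ} (h : TimeSmooth T k f) (hj : j ≤ k) :
    TimeSmooth T j f := by
  induction k, hj using Nat.le_induction with
  | base => exact h
  | succ n _ ih => exact ih h.of_succ

theorem TimeSmooth.congr {f g : ℝ → E3 → F} (h : TimeSmooth T k f)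
    (hfg : ∀ t ∈ Icc 0 T, f t = g t) : TimeSmooth T k g := by
  have h0 : (fun t : Icc 0 T => g t) = fun t : Icc 0 T => f t :=
    funext fun t => (hfg t t.2).symm
  cases k with
  | zero => exact (congrArg JointSmooth h0).mpr h
  | succ k =>
    obtain ⟨h1, f', h2, h3⟩ := h
    refine ⟨h0 ▸ h1, f', h2, fun t ht x => (h3 t ht x).congr (fun s hs => ?_) ?_⟩
    · rw [hfg s hs]
    · rw [hfg t ht]

theorem TimeSmooth.add {f g : ℝ → E3 → F} (hf : TimeSmooth T k f) (hg : TimeSmooth T k g) :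
    TimeSmooth T k fun t x => f t x + g t x := by
  induction k generalizing f g with
  | zero => exact JointSmooth.add hf hg
  | succ k ih =>
    obtain ⟨hf0, f', hf1, hf2⟩ := hf
    obtain ⟨hg0, g', hg1, hg2⟩ := hg
    exact ⟨hf0.add hg0, _, ih hf1 hg1, fun t ht x => (hf2 t ht x).add (hg2 t ht x)⟩

theorem TimeSmooth.clm_comp {f : ℝ → E3 → F} (hf : TimeSmooth T k f) (A : F →L[ℝ] G) :
    TimeSmooth T k fun t x => A (f t x) := by
  induction k generalizing f with
  | zero => exact JointSmooth.clm_comp hf A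
  | succ k ih =>
    obtain ⟨hf0, f', hf1, hf2⟩ := hf
    exact ⟨hf0.clm_comp A, _, ih hf1, fun t ht x =>
      A.hasFDerivAt.comp_hasDerivWithinAt t (hf2 t ht x)⟩

theorem TimeSmooth.neg {f : ℝ → E3 → F} (hf : TimeSmooth T k f) :
    TimeSmooth T k fun t x => - f t x :=
  hf.clm_comp (-ContinuousLinearMap.id ℝ F)

theorem TimeSmooth.sub {f g : ℝ → E3 → F} (hf : TimeSmooth T k f) (hg : TimeSmooth T k g) :
    TimeSmooth T k fun t x => f t x - g t x := by
  simpa only [sub_eq_add_neg] using hf.add hg.neg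

theorem TimeSmooth.mul {f g : ℝ → E3 → ℝ} (hf : TimeSmooth T k f) (hg : TimeSmooth T k g) :
    TimeSmooth T k fun t x => f t x * g t x := by
  induction k generalizing f g with
  | zero => exact JointSmooth.mul hf hg
  | succ k ih =>
    have hf' := hf.of_succ
    have hg' := hg.of_succ
    obtain ⟨hf0, f', hf1, hf2⟩ := hf
    obtain ⟨hg0, g', hg1, hg2⟩ := hg
    exact ⟨hf0.mul hg0, _, (ih hf1 hg').add (ih hf' hg1), fun t ht x =>
      (hf2 t ht x).mul (hg2 t ht x)⟩

/-- Time derivatives commute with the spatial derivative. -/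
theorem hasDerivWithinAt_fderiv [CompleteSpace F] (hT : 0 ≤ T) {f f' : ℝ → E3 → F}
    (hf : JointSmooth fun t : Icc 0 T => f t) (hf' : JointSmooth fun t : Icc 0 T => f' t)
    (hd : ∀ t ∈ Icc 0 T, ∀ x, HasDerivWithinAt (fun s => f s x) (f' t x) (Icc 0 T) t)
    {t : ℝ} (ht : t ∈ Icc 0 T) (x : E3) :
    HasDerivWithinAt (fun s => fderiv ℝ (f s) x) (fderiv ℝ (f' t) x) (Icc 0 T) t := by
  have hg : JointSmooth fun t : ℝ => f' (projIcc 0 T hT t) :=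
    hf'.comp_param (τ := projIcc 0 T hT) continuous_projIcc
  have hproj : ∀ s ∈ Icc 0 T, (projIcc 0 T hT s : ℝ) = s := fun s hs => by
    rw [projIcc_of_mem hT hs]
  have hgc : ∀ x, Continuous fun s : ℝ => f' (projIcc 0 T hT s) x := fun x =>
    hg.continuous.comp (Continuous.prodMk_left x)
  have hgc' : Continuous fun s : ℝ => fderiv ℝ (f' (projIcc 0 T hT s)) x :=
    hg.fderiv.continuous.comp (Continuous.prodMk_left x)
  -- No symmetry of mixed derivatives is assumed: `f` is written as the time integral of `f'`, the
  -- integral is differentiated in `x`, and the fundamental theorem of calculus returns the time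
  -- derivative.
  have hint : ∀ s ∈ Icc 0 T, ∀ y, f s y = f 0 y + ∫ τ in (0 : ℝ)..s, f' (projIcc 0 T hT τ) y := by
    intro s hs y
    rw [intervalIntegral.integral_eq_sub_of_hasDerivAt_of_le hs.1 (f := fun s => f s y)
      (f' := fun τ => f' (projIcc 0 T hT τ) y)]
    · abel
    · exact fun r hr => ((hd r ⟨hr.1, hr.2.trans hs.2⟩ y).continuousWithinAt).mono
        (Icc_subset_Icc_right hs.2)
    · intro r hr
      have hrT : r ∈ Ioo 0 T := ⟨hr.1, hr.2.trans_le hs.2⟩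
      rw [hproj r ⟨hrT.1.le, hrT.2.le⟩]
      exact (hd r ⟨hrT.1.le, hrT.2.le⟩ y).hasDerivAt (Icc_mem_nhds hrT.1 hrT.2)
    · exact (hgc y).intervalIntegrable _ _
  have hfd : ∀ s ∈ Icc 0 T, fderiv ℝ (f s) x =
      fderiv ℝ (f 0) x + ∫ τ in (0 : ℝ)..s, fderiv ℝ (f' (projIcc 0 T hT τ)) x := by
    intro s hs
    have h0 : HasFDerivAt (f 0) (fderiv ℝ (f 0) x) x :=
      (hf.differentiable ⟨0, le_rfl, hT⟩ x).hasFDerivAt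
    have h1 := hasFDerivAt_setIntegral_of_continuous (μ := volume) (isCompact_Icc (a := (0 : ℝ))
      (b := s)) measurableSet_Icc (f := fun x τ => f' (projIcc 0 T hT τ) x)
      (hg.continuous.comp continuous_swap) (hg.fderiv.continuous.comp continuous_swap)
      (fun x τ => (hg.differentiable τ x).hasFDerivAt) x
    simp only [integral_Icc_eq_integral_Ioc, ← intervalIntegral.integral_of_le hs.1] at h1
    exact ((h0.add h1).congr_of_eventuallyEq (Eventually.of_forall (hint s hs))).fderiv
  have h2 := ((intervalIntegral.integral_hasDerivAt_right (hgc'.intervalIntegrable 0 t)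
    (hgc'.stronglyMeasurableAtFilter _ _) hgc'.continuousAt).const_add
      (fderiv ℝ (f 0) x)).hasDerivWithinAt (s := Icc 0 T)
  rw [hproj t ht] at h2
  exact h2.congr hfd (hfd t ht)

theorem TimeSmooth.fderiv [CompleteSpace F] (hT : 0 ≤ T) {f : ℝ → E3 → F}
    (hf : TimeSmooth T k f) : TimeSmooth T k fun t => fderiv ℝ (f t) := by
  induction k generalizing f with
  | zero => exact JointSmooth.fderiv hf
  | succ k ih =>
    obtain ⟨hf0, f', hf1, hf2⟩ := hf
    exact ⟨hf0.fderiv, _, ih hf1, fun t ht x =>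
      hasDerivWithinAt_fderiv hT hf0 hf1.jointSmooth hf2 ht x⟩

theorem isSmoothTimeOrder_succ_iff (hT : 0 < T) {f : ℝ → E3 → ℝ} :
    IsSmoothTimeOrder (k + 1) T f ↔ IsSmoothTimeOrder 0 T f ∧
      (∀ x, DifferentiableOn ℝ (fun t => f t x) (Icc 0 T)) ∧
      IsSmoothTimeOrder k T fun t x => derivWithin (fun s => f s x) (Icc 0 T) t := by
  have hu : UniqueDiffOn ℝ (Icc 0 T) := uniqueDiffOn_Icc hT
  have hcd : ∀ x, ContDiffOn ℝ (k + 1 : ℕ) (fun t => f t x) (Icc 0 T) ↔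
      DifferentiableOn ℝ (fun t => f t x) (Icc 0 T) ∧
        ContDiffOn ℝ k (derivWithin (fun s => f s x) (Icc 0 T)) (Icc 0 T) := fun x => by
    have := contDiffOn_succ_iff_derivWithin (f := fun t => f t x) (n := (k : WithTop ℕ∞)) hu
    rw [Nat.cast_add, Nat.cast_one, this]
    simp
  constructor
  · rintro ⟨h1, h2⟩
    refine ⟨⟨fun x => (h1 x).of_le (by simp), fun j hj => h2 j (by omega)⟩,
      fun x => ((hcd x).1 (h1 x)).1, fun x => ((hcd x).1 (h1 x)).2, fun j hj => ?_⟩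
    have := h2 (j + 1) (by omega)
    simpa only [iteratedDerivWithin_succ'] using this
  · rintro ⟨h0, h1, h2⟩
    refine ⟨fun x => (hcd x).2 ⟨h1 x, h2.1 x⟩, fun j hj => ?_⟩
    rcases j with _ | j
    · exact h0.2 0 le_rfl
    · simpa only [iteratedDerivWithin_succ'] using h2.2 j (by omega)

theorem isSmoothTimeOrder_zero_iff (hT : 0 < T) {f : ℝ → E3 → ℝ} :
    IsSmoothTimeOrder 0 T f ↔ TimeSmooth T 0 f := by
  constructor
  · rintro ⟨-, h⟩
    obtain ⟨h1, h2⟩ := h 0 le_rfl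
    simp only [iteratedDerivWithin_zero] at h1 h2
    exact jointSmooth_iff.2 ⟨fun t => h1 t t.2, fun m =>
      (continuousOn_Icc_prod_iff hT.le
        (h := fun z : ℝ × E3 => iteratedFDeriv ℝ m (f z.1) z.2)).1 (h2 m)⟩
  · intro h
    have h' := jointSmooth_iff.1 h
    refine ⟨fun x => ?_, fun j hj => ?_⟩
    · have := (continuousOn_Icc_prod_iff hT.le (h := fun z : ℝ × E3 => f z.1 z.2)).2 h.continuous
      exact contDiffOn_zero.2 (this.comp (Continuous.prodMk_left x).continuousOn
        fun t ht => ⟨ht, mem_univ _⟩)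
    · obtain rfl : j = 0 := by omega
      simp only [iteratedDerivWithin_zero]
      exact ⟨fun t ht => h'.1 ⟨t, ht⟩, fun m => (continuousOn_Icc_prod_iff hT.le
        (h := fun z : ℝ × E3 => iteratedFDeriv ℝ m (f z.1) z.2)).2 (h'.2 m)⟩

/-- The bridge between the iterated one-sided derivatives of the statement and the recursive form,
in which products, Laplacians and bootstrapping are inductions on `k`. -/
theorem isSmoothTimeOrder_iff (hT : 0 < T) {f : ℝ → E3 → ℝ} :
    IsSmoothTimeOrder k T f ↔ TimeSmooth T k f := by
  induction k generalizing f with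
  | zero => exact isSmoothTimeOrder_zero_iff hT
  | succ k ih =>
    rw [isSmoothTimeOrder_succ_iff hT, isSmoothTimeOrder_zero_iff hT, ih]
    constructor
    · rintro ⟨h0, h1, h2⟩
      exact ⟨h0, _, h2, fun t ht x => (h1 x t ht).hasDerivWithinAt⟩
    · rintro ⟨h0, f', h1, h2⟩
      refine ⟨h0, fun x t ht => (h2 t ht x).differentiableWithinAt, h1.congr fun t ht => ?_⟩
      funext x
      exact ((h2 t ht x).derivWithin (uniqueDiffOn_Icc hT t ht)).symm

end TimeSmooth

/-! ### The surface measure of the unit sphere -/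

section Sphere

/-- The unit sphere of `ℝ³`. -/
abbrev S2 : Type := Metric.sphere (0 : E3) 1

/-- The surface measure of the unit sphere of `ℝ³`. -/
noncomputable abbrev sphereMeasure : Measure S2 := (volume : Measure E3).toSphere

theorem sphereMeasure_univ : sphereMeasure univ = ENNReal.ofReal (4 * Real.pi) := by
  rw [Measure.toSphere_apply_univ, EuclideanSpace.volume_ball_fin_three, finrank_euclideanSpace,
    Fintype.card_fin, ENNReal.ofReal_one, one_pow, one_mul,
    show ((3 : ℕ) : ℝ≥0∞) = ENNReal.ofReal 3 by simp, ← ENNReal.ofReal_mul (by norm_num)]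
  congr 1
  ring

theorem sphereMeasure_real_univ : sphereMeasure.real univ = 4 * Real.pi := by
  rw [measureReal_def, sphereMeasure_univ, ENNReal.toReal_ofReal (by positivity)]

/-- The action of a linear isometry on the unit sphere. -/
noncomputable def sphereMap (Q : E3 ≃ₗᵢ[ℝ] E3) (w : S2) : S2 :=
  ⟨Q w, by simp⟩

-- `toSphere` measures a set by the volume of the cone over it; a linear isometry commutes with
-- forming cones and preserves volume.
open scoped Pointwise in
theorem measurePreserving_sphereMap (Q : E3 ≃ₗᵢ[ℝ] E3) :
    MeasurePreserving (sphereMap Q) sphereMeasure sphereMeasure := by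
  have hm : Measurable (sphereMap Q) :=
    (Continuous.subtype_mk (Q.continuous.comp continuous_subtype_val) _).measurable
  refine ⟨hm, Measure.ext fun s hs => ?_⟩
  rw [Measure.map_apply hm hs, Measure.toSphere_apply' _ (hm hs), Measure.toSphere_apply' _ hs]
  congr 1
  have : Ioo (0 : ℝ) 1 • (Subtype.val '' (sphereMap Q ⁻¹' s)) =
      Q.toHomeomorph.toMeasurableEquiv ⁻¹' (Ioo (0 : ℝ) 1 • (Subtype.val '' s)) := by
    ext y
    simp only [Set.mem_smul, mem_image, mem_preimage, Subtype.exists, exists_and_right, exists_eq_right]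
    constructor
    · rintro ⟨r, hr, z, ⟨hz, hzs⟩, rfl⟩
      exact ⟨r, hr, Q z, ⟨by simpa using hz, hzs⟩, by simp⟩
    · rintro ⟨r, hr, z, ⟨hz, hzs⟩, h⟩
      have hz' : Q.symm z ∈ Metric.sphere (0 : E3) 1 := by simpa using hz
      refine ⟨r, hr, Q.symm z, ⟨hz', ?_⟩, ?_⟩
      · simpa [sphereMap] using hzs
      · apply Q.injective
        rw [map_smul, Q.apply_symm_apply]
        exact h
  rw [this]
  exact MeasurePreserving.measure_preimage_equiv (f := Q.toHomeomorph.toMeasurableEquiv)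
    Q.measurePreserving _

/-- The rotation by the angle `θ` in the plane of the coordinates `i` and `j`. -/
noncomputable def planeRotation (i j : Fin 3) (θ : ℝ) : E3 →ₗ[ℝ] E3 where
  toFun y := y + ((Real.cos θ - 1) * y i - Real.sin θ * y j) • EuclideanSpace.single i 1 +
    (Real.sin θ * y i + (Real.cos θ - 1) * y j) • EuclideanSpace.single j 1
  map_add' y z := by
    ext k
    simp only [PiLp.add_apply, PiLp.smul_apply, smul_eq_mul]
    ring
  map_smul' c y := by
    ext k
    simp only [PiLp.add_apply, PiLp.smul_apply, smul_eq_mul, RingHom.id_apply]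
    ring

theorem planeRotation_apply (i j : Fin 3) (θ : ℝ) (y : E3) : planeRotation i j θ y =
    y + ((Real.cos θ - 1) * y i - Real.sin θ * y j) • EuclideanSpace.single i 1 +
      (Real.sin θ * y i + (Real.cos θ - 1) * y j) • EuclideanSpace.single j 1 := rfl

theorem norm_planeRotation {i j : Fin 3} (hij : i ≠ j) (θ : ℝ) (y : E3) :
    ‖planeRotation i j θ y‖ = ‖y‖ := by
  have hcs := Real.sin_sq_add_cos_sq θ
  rw [EuclideanSpace.norm_eq, EuclideanSpace.norm_eq]
  congr 1
  simp only [Real.norm_eq_abs, sq_abs, planeRotation_apply,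
    Fin.sum_univ_three, PiLp.add_apply, PiLp.smul_apply, smul_eq_mul]
  fin_cases i <;> fin_cases j <;> simp at hij ⊢ <;>
    first
    | linear_combination (y 0 ^ 2 + y 1 ^ 2) * hcs
    | linear_combination (y 0 ^ 2 + y 2 ^ 2) * hcs
    | linear_combination (y 1 ^ 2 + y 2 ^ 2) * hcs

theorem integral_planeRotation {i j : Fin 3} (hij : i ≠ j) (θ : ℝ) (f : E3 → ℝ) :
    ∫ w : S2, f (planeRotation i j θ w) ∂sphereMeasure = ∫ w : S2, f w ∂sphereMeasure := by
  obtain ⟨Q, hQ⟩ : ∃ Q : E3 ≃ₗᵢ[ℝ] E3, ∀ y, Q y = planeRotation i j θ y :=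
    ⟨LinearIsometry.toLinearIsometryEquiv ⟨planeRotation i j θ, norm_planeRotation hij θ⟩ rfl,
      fun _ => rfl⟩
  have hc : Continuous (sphereMap Q) :=
    Continuous.subtype_mk (Q.continuous.comp continuous_subtype_val) _
  have hinj : Function.Injective (sphereMap Q) := fun a b hab =>
    Subtype.ext (Q.injective (congrArg Subtype.val hab))
  have := (measurePreserving_sphereMap Q).integral_comp
    (hc.isClosedEmbedding hinj).measurableEmbedding fun w : S2 => f w
  simpa only [sphereMap, hQ] using this

theorem hasDerivAt_integral_sphere {F : Type} [NormedAddCommGroup F] [NormedSpace ℝ F]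
    {f f' : ℝ → S2 → F}
    (hf : Continuous fun z : ℝ × S2 => f z.1 z.2) (hf' : Continuous fun z : ℝ × S2 => f' z.1 z.2)
    (hd : ∀ r w, HasDerivAt (fun r => f r w) (f' r w) r) (r₀ : ℝ) :
    HasDerivAt (fun r => ∫ w, f r w ∂sphereMeasure) (∫ w, f' r₀ w ∂sphereMeasure) r₀ := by
  have hK : IsCompact (Metric.closedBall r₀ 1 ×ˢ (univ : Set S2)) :=
    (isCompact_closedBall r₀ 1).prod isCompact_univ
  obtain ⟨B, hB⟩ := hK.exists_bound_of_continuousOn hf'.continuousOn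
  refine (hasDerivAt_integral_of_dominated_loc_of_deriv_le (bound := fun _ => B)
    (Metric.closedBall_mem_nhds r₀ one_pos) (Eventually.of_forall fun r => ?_) ?_ ?_ ?_
    (integrable_const B) ?_).2
  · exact (hf.comp (Continuous.prodMk_right r)).aestronglyMeasurable
  · exact integrableOn_univ.1
      ((hf.comp (Continuous.prodMk_right r₀)).continuousOn.integrableOn_compact isCompact_univ)
  · exact (hf'.comp (Continuous.prodMk_right r₀)).aestronglyMeasurable
  · exact Eventually.of_forall fun w r hr => hB (r, w) ⟨hr, mem_univ w⟩
  · exact Eventually.of_forall fun w r _ => hd r w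

theorem continuous_planeRotation (i j : Fin 3) :
    Continuous fun z : ℝ × E3 => planeRotation i j z.1 z.2 := by
  simp only [planeRotation_apply]
  fun_prop

theorem hasDerivAt_planeRotation {i j : Fin 3} (hij : i ≠ j) (θ : ℝ) (y : E3) :
    HasDerivAt (fun θ => planeRotation i j θ y) (planeRotation i j θ
      (y i • EuclideanSpace.single j 1 - y j • EuclideanSpace.single i 1)) θ := by
  have h1 : HasDerivAt (fun θ => (Real.cos θ - 1) * y i - Real.sin θ * y j)
      (-Real.sin θ * y i - Real.cos θ * y j) θ :=
    (((Real.hasDerivAt_cos θ).sub_const 1).mul_const (y i)).sub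
      ((Real.hasDerivAt_sin θ).mul_const (y j))
  have h2 : HasDerivAt (fun θ => Real.sin θ * y i + (Real.cos θ - 1) * y j)
      (Real.cos θ * y i + -Real.sin θ * y j) θ :=
    ((Real.hasDerivAt_sin θ).mul_const (y i)).add
      (((Real.hasDerivAt_cos θ).sub_const 1).mul_const (y j))
  have := ((h1.smul_const (EuclideanSpace.single i (1 : ℝ) : E3)).const_add y).add
    (h2.smul_const (EuclideanSpace.single j (1 : ℝ) : E3))
  simp only [planeRotation_apply]
  refine this.congr_deriv ?_
  ext k
  simp only [PiLp.add_apply, PiLp.smul_apply,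
    PiLp.sub_apply, smul_eq_mul, PiLp.single_apply, if_neg hij, if_neg hij.symm, if_true]
  ring

/-- The derivative along a one-parameter group that preserves the integral over the sphere has
integral zero. -/
theorem integral_sphere_generator {R : ℝ → E3 → E3} {J : E3 → E3} {f : E3 → ℝ}
    (hR : Continuous fun z : ℝ × E3 => R z.1 z.2) (hJ : Continuous J) (hR0 : ∀ y, R 0 y = y)
    (hd : ∀ θ y, HasDerivAt (fun θ => R θ y) (R θ (J y)) θ)
    (hinv : ∀ θ, ∫ w : S2, f (R θ w) ∂sphereMeasure = ∫ w : S2, f w ∂sphereMeasure)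
    (hf : ContDiff ℝ 1 f) : ∫ w : S2, fderiv ℝ f w (J w) ∂sphereMeasure = 0 := by
  have hfc : Continuous (fderiv ℝ f) := hf.continuous_fderiv one_ne_zero
  have hv : Continuous fun z : ℝ × S2 => (z.1, (z.2 : E3)) :=
    continuous_fst.prodMk (continuous_subtype_val.comp continuous_snd)
  have hv' : Continuous fun z : ℝ × S2 => (z.1, J z.2) :=
    continuous_fst.prodMk (hJ.comp (continuous_subtype_val.comp continuous_snd))
  have h := hasDerivAt_integral_sphere (f := fun θ w => f (R θ w))
    (f' := fun θ w => fderiv ℝ f (R θ w) (R θ (J w)))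
    (hf.continuous.comp (hR.comp hv)) ((hfc.comp (hR.comp hv)).clm_apply (hR.comp hv'))
    (fun θ w => ((hf.differentiable one_ne_zero _).hasFDerivAt).comp_hasDerivAt θ (hd θ w)) 0
  rw [funext hinv] at h
  simpa only [hR0] using h.unique (hasDerivAt_const _ _)

/-- The integral over the sphere of an angular derivative vanishes. -/
theorem integral_sphere_angular_derivative {i j : Fin 3} (hij : i ≠ j) {f : E3 → ℝ}
    (hf : ContDiff ℝ 1 f) :
    ∫ w : S2, fderiv ℝ f w ((w : E3) i • EuclideanSpace.single j 1 -
      (w : E3) j • EuclideanSpace.single i 1) ∂sphereMeasure = 0 :=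
  integral_sphere_generator (R := fun θ y => planeRotation i j θ y)
    (J := fun y => y i • EuclideanSpace.single j 1 - y j • EuclideanSpace.single i 1)
    (continuous_planeRotation i j) (by fun_prop) (fun y => by simp [planeRotation_apply])
    (hasDerivAt_planeRotation hij) (fun θ => integral_planeRotation hij θ f) hf

theorem laplacian_eq_sum_fderiv (f : E3 → ℝ) (y : E3) :
    Δ f y = ∑ i, fderiv ℝ (fderiv ℝ f) y (EuclideanSpace.single i 1)
      (EuclideanSpace.single i 1) := by
  rw [InnerProductSpace.laplacian_eq_iteratedFDeriv_orthonormalBasis f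
    (EuclideanSpace.basisFun (Fin 3) ℝ)]
  simp [iteratedFDeriv_two_apply]

/-- Darboux's identity on the unit sphere. -/
theorem integral_sphere_darboux {f : E3 → ℝ} (hf : ContDiff ℝ 2 f) :
    ∫ w : S2, Δ f w ∂sphereMeasure = ∫ w : S2, (2 * fderiv ℝ f w w +
      fderiv ℝ (fderiv ℝ f) w w w) ∂sphereMeasure := by
  have hf1 : ContDiff ℝ 1 (fderiv ℝ f) := hf.fderiv_right (by norm_num)
  have hfc : Continuous (fderiv ℝ f) := hf1.continuous
  have hfc2 : Continuous (fderiv ℝ (fderiv ℝ f)) := hf1.continuous_fderiv one_ne_zero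
  have hv : Continuous fun w : S2 => (w : E3) := continuous_subtype_val
  let J : Fin 3 → Fin 3 → E3 →L[ℝ] E3 := fun i j =>
    (EuclideanSpace.proj i : E3 →L[ℝ] ℝ).smulRight (EuclideanSpace.single j (1 : ℝ)) -
      (EuclideanSpace.proj j : E3 →L[ℝ] ℝ).smulRight (EuclideanSpace.single i (1 : ℝ))
  have hJ : ∀ i j y, J i j y =
      y i • EuclideanSpace.single j 1 - y j • EuclideanSpace.single i 1 := fun i j y => rfl
  -- The vanishing of the integral of an angular derivative is applied to `J f`, itself an angular
  -- derivative; this gives integral zero for the squares of the three rotation fields, whose sum is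
  -- the spherical Laplacian.
  have hang : ∀ i j, i ≠ j → ∫ w : S2, (fderiv ℝ (fderiv ℝ f) w (J i j w) (J i j w) +
      fderiv ℝ f w (J i j (J i j w))) ∂sphereMeasure = 0 := by
    intro i j hij
    have hg : ContDiff ℝ 1 fun y => fderiv ℝ f y (J i j y) :=
      hf1.clm_apply (J i j).contDiff
    have := integral_sphere_angular_derivative hij hg
    rw [← this]
    refine integral_congr_ae (Eventually.of_forall fun w => ?_)
    have hd := ((hf1.differentiable one_ne_zero w).hasFDerivAt.clm_apply
      ((J i j).hasFDerivAt (x := (w : E3)))).fderiv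
    simp only [← hJ, hd]
    simp [add_comm]
  have hint : ∀ i j, Integrable (fun w : S2 => fderiv ℝ (fderiv ℝ f) w (J i j w) (J i j w) +
      fderiv ℝ f w (J i j (J i j w))) sphereMeasure := fun i j =>
    integrableOn_univ.1 (Continuous.continuousOn (by fun_prop) |>.integrableOn_compact
      isCompact_univ)
  have hi1 : Integrable (fun w : S2 => Δ f w) sphereMeasure := by
    simp only [laplacian_eq_sum_fderiv]
    exact integrableOn_univ.1 (Continuous.continuousOn (by fun_prop) |>.integrableOn_compact
      isCompact_univ)
  have hi2 : Integrable (fun w : S2 => 2 * fderiv ℝ f w w + fderiv ℝ (fderiv ℝ f) w w w)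
      sphereMeasure :=
    integrableOn_univ.1 (Continuous.continuousOn (by fun_prop) |>.integrableOn_compact
      isCompact_univ)
  rw [← sub_eq_zero, ← integral_sub hi1 hi2]
  have hsum := integral_add (hint 0 1) ((hint 0 2).add (hint 1 2))
  rw [integral_add' (hint 0 2) (hint 1 2), hang 0 1 (by decide), hang 0 2 (by decide),
    hang 1 2 (by decide)] at hsum
  rw [add_zero, add_zero] at hsum
  rw [← hsum]
  refine integral_congr_ae (Eventually.of_forall fun w => ?_)
  have hw : (w : E3) 0 ^ 2 + (w : E3) 1 ^ 2 + (w : E3) 2 ^ 2 = 1 := by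
    have h1 : ‖(w : E3)‖ = 1 := by simp
    have h2 := EuclideanSpace.norm_sq_eq (w : E3)
    rw [h1, Fin.sum_univ_three] at h2
    simpa using h2.symm
  have hwe : (w : E3) = (w : E3) 0 • EuclideanSpace.single 0 1 +
      (w : E3) 1 • EuclideanSpace.single 1 1 + (w : E3) 2 • EuclideanSpace.single 2 1 := by
    ext k
    fin_cases k <;> simp
  have hJJ : ∀ i j, i ≠ j → J i j (J i j w) =
      -((w : E3) i • EuclideanSpace.single i 1 + (w : E3) j • EuclideanSpace.single j 1) := by
    intro i j hij
    simp only [hJ, PiLp.sub_apply, PiLp.smul_apply, PiLp.single_apply, smul_eq_mul, if_neg hij,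
      if_neg hij.symm, if_true]
    module
  simp only [Pi.add_apply]
  rw [laplacian_eq_sum_fderiv, Fin.sum_univ_three, hJJ 0 1 (by decide), hJJ 0 2 (by decide),
    hJJ 1 2 (by decide), hJ, hJ, hJ]
  generalize fderiv ℝ (fderiv ℝ f) (w : E3) = B
  generalize fderiv ℝ f (w : E3) = D
  generalize (w : E3) 0 = a at *
  generalize (w : E3) 1 = b at *
  generalize (w : E3) 2 = c at *
  rw [hwe]
  simp only [map_add, map_sub, map_neg, map_smul, add_apply,
    sub_apply, smul_apply, smul_eq_mul]
  -- In coordinates the two sides differ by the trace of the Hessian times `1 - |w|²`, which is zero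
  -- on the sphere.
  linear_combination (-(B (EuclideanSpace.single 0 1) (EuclideanSpace.single 0 1) +
    B (EuclideanSpace.single 1 1) (EuclideanSpace.single 1 1) +
    B (EuclideanSpace.single 2 1) (EuclideanSpace.single 2 1))) * hw

end Sphere

/-! ### Integrals over light cones and Kirchhoff's formula -/

section Cone

variable {F G : Type} [NormedAddCommGroup F] [NormedSpace ℝ F] [NormedAddCommGroup G]
  [NormedSpace ℝ G]

/-- The integral of `g`, with the operator weight `A`, over the forward light cone of height `T`
with vertex `(t, x)`. -/
noncomputable def coneIntegral (T : ℝ) (A : ℝ × S2 → F →L[ℝ] G) (g : ℝ → E3 → F) (t : ℝ)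
    (x : E3) : G :=
  ∫ y in Icc 0 T ×ˢ (univ : Set S2), A y (g (t + y.1) (x + y.1 • (y.2 : E3)))
    ∂((volume : Measure ℝ).prod sphereMeasure)

theorem continuous_cone_integrand {A : ℝ × S2 → F →L[ℝ] G} (hA : Continuous A) {g : ℝ → E3 → F}
    (hg : Continuous fun z : ℝ × E3 => g z.1 z.2) :
    Continuous fun z : (ℝ × E3) × (ℝ × S2) =>
      A z.2 (g (z.1.1 + z.2.1) (z.1.2 + z.2.1 • (z.2.2 : E3))) := by
  have : Continuous fun z : (ℝ × E3) × (ℝ × S2) =>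
      (z.1.1 + z.2.1, z.1.2 + z.2.1 • (z.2.2 : E3)) := by fun_prop
  exact (hA.comp continuous_snd).clm_apply (hg.comp this)

theorem continuous_coneIntegral (T : ℝ) {A : ℝ × S2 → F →L[ℝ] G} (hA : Continuous A)
    {g : ℝ → E3 → F} (hg : Continuous fun z : ℝ × E3 => g z.1 z.2) :
    Continuous fun z : ℝ × E3 => coneIntegral T A g z.1 z.2 :=
  continuous_parametric_integral_of_continuous
    (f := fun (z : ℝ × E3) (y : ℝ × S2) => A y (g (z.1 + y.1) (z.2 + y.1 • (y.2 : E3))))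
    (continuous_cone_integrand hA hg) (isCompact_Icc.prod isCompact_univ)

theorem hasFDerivAt_coneIntegral (T : ℝ) {A : ℝ × S2 → F →L[ℝ] G} (hA : Continuous A)
    {g : ℝ → E3 → F} (hg : JointSmooth g) (t : ℝ) (x : E3) :
    HasFDerivAt (coneIntegral T A g t) (coneIntegral T
      (fun y => ContinuousLinearMap.compL ℝ E3 F G (A y)) (fun t => fderiv ℝ (g t)) t x) x := by
  have hA' : Continuous fun y => ContinuousLinearMap.compL ℝ E3 F G (A y) :=
    (ContinuousLinearMap.compL ℝ E3 F G).continuous.comp hA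
  have hz : Continuous fun z : E3 × (ℝ × S2) => ((t, z.1), z.2) := by fun_prop
  refine hasFDerivAt_setIntegral_of_continuous (μ := (volume : Measure ℝ).prod sphereMeasure)
    (isCompact_Icc.prod isCompact_univ) (measurableSet_Icc.prod MeasurableSet.univ)
    (f := fun x y => A y (g (t + y.1) (x + y.1 • (y.2 : E3))))
    (f' := fun x y => ContinuousLinearMap.compL ℝ E3 F G (A y)
      (fderiv ℝ (g (t + y.1)) (x + y.1 • (y.2 : E3))))
    ((continuous_cone_integrand hA hg.continuous).comp hz)
    ((continuous_cone_integrand hA' (g := fun t => fderiv ℝ (g t)) hg.fderiv.continuous).comp hz)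
    (fun x y => ?_) x
  have h1 := (hg.differentiable (t + y.1) (x + y.1 • (y.2 : E3))).hasFDerivAt
  have h2 := h1.comp x ((hasFDerivAt_id x).add_const (y.1 • (y.2 : E3)))
  exact (A y).hasFDerivAt.comp x h2

/-- The domain of integration does not depend on `(t, x)`, and a space derivative of a cone integral
is a cone integral of the derivative with a new operator weight. Cone integrals with arbitrary
weights therefore form an invariant class; this is why weights are allowed. -/
theorem JointSmooth.coneIntegral (T : ℝ) {A : ℝ × S2 → F →L[ℝ] G} (hA : Continuous A)
    {g : ℝ → E3 → F} (hg : JointSmooth g) : JointSmooth (coneIntegral T A g) := by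
  refine JointSmooth.of_invariant (fun G' _ _ f => ∃ (F' : Type) (_ : NormedAddCommGroup F')
    (_ : NormedSpace ℝ F') (A : ℝ × S2 → F' →L[ℝ] G') (g : ℝ → E3 → F'), Continuous A ∧
      JointSmooth g ∧ f = _root_.coneIntegral T A g) ?_ ⟨F, _, _, A, g, hA, hg, rfl⟩
  rintro G' _ _ f ⟨F', _, _, A, g, hA, hg, rfl⟩
  refine ⟨continuous_coneIntegral T hA hg.continuous, fun t x =>
    (hasFDerivAt_coneIntegral T hA hg t x).differentiableAt, _, _, _, _, _,
    (ContinuousLinearMap.compL ℝ E3 F' G').continuous.comp hA, hg.fderiv, ?_⟩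
  funext t x
  exact (hasFDerivAt_coneIntegral T hA hg t x).fderiv

theorem continuous_integral_sphere {X : Type} [TopologicalSpace X] [FirstCountableTopology X]
    [LocallyCompactSpace X] {f : X → S2 → F} (hf : Continuous fun z : X × S2 => f z.1 z.2) :
    Continuous fun x => ∫ w, f x w ∂sphereMeasure := by
  simpa only [setIntegral_univ] using continuous_parametric_integral_of_continuous
    (μ := sphereMeasure) hf isCompact_univ

/-- The cone of fixed height `T` reaches beyond time `T`, where `g` vanishes. The form with moving
lower limit `t` and absolute time `s` needs no time derivative of `g` when differentiated in `t`. -/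
theorem coneIntegral_eq_intervalIntegral {T : ℝ} {A : ℝ × S2 → F →L[ℝ] G} (hA : Continuous A)
    {g : ℝ → E3 → F} (hg : Continuous fun z : ℝ × E3 => g z.1 z.2) (hgT : ∀ s, T ≤ s → g s = 0)
    {t : ℝ} (ht : t ∈ Icc 0 T) (x : E3) :
    coneIntegral T A g t x = ∫ s in t..T, ∫ w : S2, A (s - t, w) (g s (x + (s - t) • (w : E3)))
      ∂sphereMeasure := by
  have hT : 0 ≤ T := ht.1.trans ht.2
  have hc : Continuous fun y : ℝ × S2 => A y (g (t + y.1) (x + y.1 • (y.2 : E3))) :=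
    (continuous_cone_integrand hA hg).comp (Continuous.prodMk_right (t, x))
  have hI : Continuous fun s => ∫ w : S2, A (s - t, w) (g s (x + (s - t) • (w : E3)))
      ∂sphereMeasure := by
    apply continuous_integral_sphere
      (f := fun s (w : S2) => A (s - t, w) (g s (x + (s - t) • (w : E3))))
    have : Continuous fun z : ℝ × S2 => (z.1 - t, z.2) := by fun_prop
    have h := hc.comp this
    simpa only [Function.comp_def, add_sub_cancel] using h
  rw [coneIntegral, setIntegral_prod _ (hc.continuousOn.integrableOn_compact
    (isCompact_Icc.prod isCompact_univ)), integral_Icc_eq_integral_Ioc,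
    ← intervalIntegral.integral_of_le hT]
  have h1 := intervalIntegral.integral_comp_add_left (a := 0) (b := T)
    (fun s => ∫ w : S2, A (s - t, w) (g s (x + (s - t) • (w : E3))) ∂sphereMeasure) t
  simp only [add_sub_cancel_left, add_zero] at h1
  simp only [setIntegral_univ]
  rw [h1, ← intervalIntegral.integral_add_adjacent_intervals (hI.intervalIntegrable t T)
    (hI.intervalIntegrable T (t + T)), add_eq_left]
  refine (intervalIntegral.integral_congr fun s hs => ?_).trans intervalIntegral.integral_zero
  rw [uIcc_of_le (by linarith [ht.1])] at hs
  simp [hgT s hs.1]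

/-- Leibniz' rule for a moving lower limit. -/
theorem hasDerivAt_integral_moving {K K' : ℝ → ℝ → ℝ} (T : ℝ)
    (hK : Continuous fun z : ℝ × ℝ => K z.1 z.2) (hK' : Continuous fun z : ℝ × ℝ => K' z.1 z.2)
    (hd : ∀ r s, HasDerivAt (fun r => K r s) (K' r s) r) (t : ℝ) :
    HasDerivAt (fun t => ∫ s in t..T, K (s - t) s)
      (-K 0 t - ∫ s in t..T, K' (s - t) s) t := by
  -- The two occurrences of `t` are separated; the function of two variables has continuous partial
  -- derivatives and is then restricted to the diagonal.
  let f : ℝ → ℝ → ℝ := fun a b => ∫ s in a..T, K (s - b) s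
  let f₁ : ℝ → ℝ → ℝ →L[ℝ] ℝ := fun a b => ContinuousLinearMap.toSpanSingleton ℝ (-K (a - b) a)
  let f₂ : ℝ → ℝ → ℝ →L[ℝ] ℝ := fun a b => ContinuousLinearMap.toSpanSingleton ℝ
    (∫ s in a..T, -K' (s - b) s)
  have hKb : ∀ b, Continuous fun s => K (s - b) s := fun b =>
    hK.comp ((continuous_id.sub continuous_const).prodMk continuous_id)
  have h1 : ∀ v : ℝ × ℝ, HasFDerivAt (fun a => f a v.2) (Function.uncurry f₁ v) v.1 := fun v =>
    (intervalIntegral.integral_hasDerivAt_left ((hKb v.2).intervalIntegrable v.1 T)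
      ((hKb v.2).stronglyMeasurableAtFilter _ _) (hKb v.2).continuousAt).hasFDerivAt
  have hK2 : Continuous fun z : ℝ × ℝ => -K' (z.2 - z.1) z.2 :=
    (hK'.comp ((continuous_snd.sub continuous_fst).prodMk continuous_snd)).neg
  have h2 : ∀ v : ℝ × ℝ, HasFDerivAt (fun b => f v.1 b) (Function.uncurry f₂ v) v.2 := by
    intro v
    have hcomp : IsCompact (Metric.closedBall v.2 1 ×ˢ uIcc v.1 T) :=
      (isCompact_closedBall _ _).prod isCompact_uIcc
    obtain ⟨B, hB⟩ := hcomp.exists_bound_of_continuousOn hK2.continuousOn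
    refine (intervalIntegral.hasDerivAt_integral_of_dominated_loc_of_deriv_le
      (bound := fun _ => B) (F' := fun b s => -K' (s - b) s)
      (Metric.closedBall_mem_nhds v.2 one_pos)
      (Eventually.of_forall fun b => ((hKb b).aestronglyMeasurable))
      ((hKb v.2).intervalIntegrable _ _)
      ((hK2.comp (Continuous.prodMk_right v.2)).aestronglyMeasurable) ?_
      intervalIntegrable_const ?_).2.hasFDerivAt
    · exact Eventually.of_forall fun s hs b hb => hB (b, s) ⟨hb, uIoc_subset_uIcc hs⟩
    · refine Eventually.of_forall fun s _ b _ => ?_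
      have := (hd (s - b) s).comp b ((hasDerivAt_id b).const_sub s)
      simpa [Function.comp_def] using this
  have hc1 : Continuous (Function.uncurry f₁) := by
    refine (ContinuousLinearMap.toSpanSingletonCLE (𝕜 := ℝ) (E := ℝ)).continuous.comp ?_
    exact (hK.comp ((continuous_fst.sub continuous_snd).prodMk continuous_fst)).neg
  have hc2 : Continuous (Function.uncurry f₂) := by
    refine (ContinuousLinearMap.toSpanSingletonCLE (𝕜 := ℝ) (E := ℝ)).continuous.comp ?_
    have := intervalIntegral.continuous_parametric_intervalIntegral_of_continuous (μ := volume)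
      (a₀ := T) (X := ℝ × ℝ) (f := fun v s => -K' (s - v.2) s) (s := fun v => v.1)
      (hK2.comp ((continuous_snd.comp continuous_fst).prodMk continuous_snd)) continuous_fst
    refine this.neg.congr fun v => ?_
    exact (intervalIntegral.integral_symm T v.1).symm
  have h := (hasStrictFDerivAt_uncurry_coprod (u := (t, t)) (f := f) (f₁ := f₁) (f₂ := f₂)
    (Eventually.of_forall h1) (Eventually.of_forall h2) hc1.continuousAt hc2.continuousAt).hasFDerivAt
  have h' := HasFDerivAt.comp_hasDerivAt (f := fun a : ℝ => (a, a)) t h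
    ((hasDerivAt_id t).prodMk (hasDerivAt_id t))
  refine h'.congr_deriv ?_
  simp [f₁, f₂, Function.HasUncurry.uncurry, sub_eq_add_neg]

end Cone

/-! ### Kirchhoff's formula for the backward Duhamel integral. -/

section Kirchhoff

variable {F G : Type} [NormedAddCommGroup F] [NormedSpace ℝ F] [NormedAddCommGroup G]
  [NormedSpace ℝ G]

/-- The backward-in-time Duhamel integral: for `g` vanishing after time `T`, the solution of
`□φ = g` with zero data at time `T`, given by Kirchhoff's formula. -/
noncomputable def retarded (T : ℝ) (g : ℝ → E3 → F) : ℝ → E3 → F :=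
  coneIntegral T (fun y => (y.1 / (4 * Real.pi)) • ContinuousLinearMap.id ℝ F) g

/-- The weight of the time derivative of the Duhamel integral. -/
noncomputable def retardedDerivWeight (y : ℝ × S2) : ℝ × (E3 →L[ℝ] ℝ) →L[ℝ] ℝ :=
  (1 / (4 * Real.pi)) • ContinuousLinearMap.fst ℝ ℝ (E3 →L[ℝ] ℝ) +
    (y.1 / (4 * Real.pi)) • (ContinuousLinearMap.apply ℝ ℝ (y.2 : E3)).comp
      (ContinuousLinearMap.snd ℝ ℝ (E3 →L[ℝ] ℝ))

/-- The time derivative of the Duhamel integral. -/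
noncomputable def retardedDeriv (T : ℝ) (g : ℝ → E3 → ℝ) (t : ℝ) (x : E3) : ℝ :=
  -coneIntegral T retardedDerivWeight (fun t x => (g t x, fderiv ℝ (g t) x)) t x

theorem continuous_retarded_weight : Continuous fun y : ℝ × S2 =>
    (y.1 / (4 * Real.pi)) • ContinuousLinearMap.id ℝ F :=
  (continuous_fst.div_const _).smul continuous_const

theorem JointSmooth.retarded (T : ℝ) {g : ℝ → E3 → F} (hg : JointSmooth g) :
    JointSmooth (retarded T g) :=
  hg.coneIntegral T continuous_retarded_weight

theorem continuous_clm_add {X : Type} [TopologicalSpace X] {a b : X → F →L[ℝ] G}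
    (ha : Continuous a) (hb : Continuous b) : Continuous fun x => a x + b x :=
  ha.add hb

theorem continuous_retardedDerivWeight : Continuous retardedDerivWeight := by
  have h : Continuous fun y : ℝ × S2 => (ContinuousLinearMap.apply ℝ ℝ (y.2 : E3)).comp
      (ContinuousLinearMap.snd ℝ ℝ (E3 →L[ℝ] ℝ)) :=
    ((ContinuousLinearMap.apply ℝ ℝ).continuous.comp
      (continuous_subtype_val.comp continuous_snd)).clm_comp continuous_const
  exact continuous_clm_add continuous_const ((continuous_fst.div_const _).smul h)

theorem JointSmooth.jet {X : Type} [TopologicalSpace X] {g : X → E3 → ℝ} (hg : JointSmooth g) :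
    JointSmooth fun t x => (g t x, _root_.fderiv ℝ (g t) x) := by
  simpa using (hg.clm_comp (ContinuousLinearMap.inl ℝ ℝ (E3 →L[ℝ] ℝ))).add
    (hg.fderiv.clm_comp (ContinuousLinearMap.inr ℝ ℝ (E3 →L[ℝ] ℝ)))

theorem JointSmooth.retardedDeriv (T : ℝ) {g : ℝ → E3 → ℝ} (hg : JointSmooth g) :
    JointSmooth (retardedDeriv T g) :=
  (hg.jet.coneIntegral T continuous_retardedDerivWeight).neg

theorem fderiv_retarded (T : ℝ) {g : ℝ → E3 → F} (hg : JointSmooth g) (t : ℝ) :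
    fderiv ℝ (retarded T g t) = retarded T (fun t => fderiv ℝ (g t)) t := by
  funext x
  rw [retarded, (hasFDerivAt_coneIntegral T continuous_retarded_weight hg t x).fderiv, retarded]
  congr 1

theorem retarded_add (T : ℝ) {g h : ℝ → E3 → F} (hg : Continuous fun z : ℝ × E3 => g z.1 z.2)
    (hh : Continuous fun z : ℝ × E3 => h z.1 z.2) (t : ℝ) (x : E3) :
    retarded T (fun t x => g t x + h t x) t x = retarded T g t x + retarded T h t x := by
  have hi : ∀ {g : ℝ → E3 → F}, (Continuous fun z : ℝ × E3 => g z.1 z.2) →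
      IntegrableOn (fun y : ℝ × S2 => ((y.1 / (4 * Real.pi)) • ContinuousLinearMap.id ℝ F)
        (g (t + y.1) (x + y.1 • (y.2 : E3)))) (Icc 0 T ×ˢ (univ : Set S2))
        ((volume : Measure ℝ).prod sphereMeasure) := fun hg =>
    ((continuous_cone_integrand continuous_retarded_weight hg).comp
      (Continuous.prodMk_right (t, x))).continuousOn.integrableOn_compact
      (isCompact_Icc.prod isCompact_univ)
  simp only [retarded, coneIntegral]
  rw [← integral_add (hi hg) (hi hh)]
  simp only [map_add]

theorem retarded_clm_comp [CompleteSpace F] [CompleteSpace G] (T : ℝ) {g : ℝ → E3 → F}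
    (hg : Continuous fun z : ℝ × E3 => g z.1 z.2) (A : F →L[ℝ] G) (t : ℝ) (x : E3) :
    retarded T (fun t x => A (g t x)) t x = A (retarded T g t x) := by
  have hi : IntegrableOn (fun y : ℝ × S2 => ((y.1 / (4 * Real.pi)) • ContinuousLinearMap.id ℝ F)
        (g (t + y.1) (x + y.1 • (y.2 : E3)))) (Icc 0 T ×ˢ (univ : Set S2))
        ((volume : Measure ℝ).prod sphereMeasure) :=
    ((continuous_cone_integrand continuous_retarded_weight hg).comp
      (Continuous.prodMk_right (t, x))).continuousOn.integrableOn_compact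
      (isCompact_Icc.prod isCompact_univ)
  simp only [retarded, coneIntegral]
  rw [← A.integral_comp_comm hi]
  simp

/-- The Laplacian at a point as a linear functional of the second derivative. -/
noncomputable def traceCLM : (E3 →L[ℝ] E3 →L[ℝ] ℝ) →L[ℝ] ℝ :=
  ∑ i : Fin 3, (ContinuousLinearMap.apply ℝ ℝ (EuclideanSpace.single i (1 : ℝ) : E3)).comp
    (ContinuousLinearMap.apply ℝ (E3 →L[ℝ] ℝ) (EuclideanSpace.single i (1 : ℝ) : E3))

theorem laplacian_eq_traceCLM (f : E3 → ℝ) (y : E3) :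
    Δ f y = traceCLM (fderiv ℝ (fderiv ℝ f) y) := by
  rw [laplacian_eq_sum_fderiv]
  simp [traceCLM]

theorem JointSmooth.laplacian {X : Type} [TopologicalSpace X] {f : X → E3 → ℝ}
    (hf : JointSmooth f) : JointSmooth fun t => Δ (f t) := by
  simpa only [← laplacian_eq_traceCLM] using hf.fderiv.fderiv.clm_comp traceCLM

theorem TimeSmooth.laplacian {T : ℝ} (hT : 0 ≤ T) {k : ℕ} {f : ℝ → E3 → ℝ}
    (hf : TimeSmooth T k f) : TimeSmooth T k fun t => Δ (f t) := by
  simpa only [← laplacian_eq_traceCLM] using ((hf.fderiv hT).fderiv hT).clm_comp traceCLM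

theorem laplacian_retarded (T : ℝ) {g : ℝ → E3 → ℝ} (hg : JointSmooth g) (t : ℝ) (x : E3) :
    Δ (retarded T g t) x = retarded T (fun t => Δ (g t)) t x := by
  rw [laplacian_eq_traceCLM, fderiv_retarded T hg,
    fderiv_retarded T hg.fderiv (g := fun t => fderiv ℝ (g t)),
    ← retarded_clm_comp T (g := fun t => fderiv ℝ (fderiv ℝ (g t))) hg.fderiv.fderiv.continuous]
  congr 1
  funext t x
  exact (laplacian_eq_traceCLM _ _).symm

/-- The spherical means in Kirchhoff's formula. -/
noncomputable def kirchhoffKernel (g : ℝ → E3 → ℝ) (x : E3) (r s : ℝ) : ℝ :=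
  ∫ w : S2, r / (4 * Real.pi) * g s (x + r • (w : E3)) ∂sphereMeasure

/-- The radial derivative of `kirchhoffKernel`. -/
noncomputable def kirchhoffKernel₁ (g : ℝ → E3 → ℝ) (x : E3) (r s : ℝ) : ℝ :=
  ∫ w : S2, (1 / (4 * Real.pi) * g s (x + r • (w : E3)) +
    r / (4 * Real.pi) * fderiv ℝ (g s) (x + r • (w : E3)) w) ∂sphereMeasure

/-- The second radial derivative of `kirchhoffKernel`. -/
noncomputable def kirchhoffKernel₂ (g : ℝ → E3 → ℝ) (x : E3) (r s : ℝ) : ℝ :=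
  ∫ w : S2, (1 / (4 * Real.pi) * (2 * fderiv ℝ (g s) (x + r • (w : E3)) w) +
    r / (4 * Real.pi) * fderiv ℝ (fderiv ℝ (g s)) (x + r • (w : E3)) w w) ∂sphereMeasure

section Kernels

variable {g : ℝ → E3 → ℝ} {T : ℝ}

theorem JointSmooth.continuous_sphere_comp {h : ℝ → E3 → F} (hh : JointSmooth h) (x : E3) :
    Continuous fun z : (ℝ × ℝ) × S2 => h z.1.2 (x + z.1.1 • (z.2 : E3)) := by
  have : Continuous fun z : (ℝ × ℝ) × S2 => (z.1.2, x + z.1.1 • (z.2 : E3)) := by fun_prop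
  exact hh.continuous.comp this

theorem JointSmooth.continuous_sphere_comp' {h : ℝ → E3 → F} (hh : JointSmooth h) (x : E3)
    (s : ℝ) : Continuous fun z : ℝ × S2 => h s (x + z.1 • (z.2 : E3)) := by
  have : Continuous fun z : ℝ × S2 => (s, x + z.1 • (z.2 : E3)) := by fun_prop
  exact hh.continuous.comp this

theorem continuous_kirchhoffKernel (hg : JointSmooth g) (x : E3) :
    Continuous fun z : ℝ × ℝ => kirchhoffKernel g x z.1 z.2 := by
  apply continuous_integral_sphere
    (f := fun (z : ℝ × ℝ) (w : S2) => z.1 / (4 * Real.pi) * g z.2 (x + z.1 • (w : E3)))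
  exact (continuous_fst.fst.div_const _).mul (hg.continuous_sphere_comp x)

theorem continuous_kirchhoffKernel₁ (hg : JointSmooth g) (x : E3) :
    Continuous fun z : ℝ × ℝ => kirchhoffKernel₁ g x z.1 z.2 := by
  apply continuous_integral_sphere (f := fun (z : ℝ × ℝ) (w : S2) =>
    1 / (4 * Real.pi) * g z.2 (x + z.1 • (w : E3)) +
    z.1 / (4 * Real.pi) * fderiv ℝ (g z.2) (x + z.1 • (w : E3)) w)
  exact ((hg.continuous_sphere_comp x).const_mul _).add ((continuous_fst.fst.div_const _).mul
    ((hg.fderiv.continuous_sphere_comp x).clm_apply (continuous_subtype_val.comp continuous_snd)))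

theorem continuous_kirchhoffKernel₂ (hg : JointSmooth g) (x : E3) :
    Continuous fun z : ℝ × ℝ => kirchhoffKernel₂ g x z.1 z.2 := by
  apply continuous_integral_sphere (f := fun (z : ℝ × ℝ) (w : S2) =>
    1 / (4 * Real.pi) * (2 * fderiv ℝ (g z.2) (x + z.1 • (w : E3)) w) +
    z.1 / (4 * Real.pi) * fderiv ℝ (fderiv ℝ (g z.2)) (x + z.1 • (w : E3)) w w)
  have hv : Continuous fun z : (ℝ × ℝ) × S2 => (z.2 : E3) :=
    continuous_subtype_val.comp continuous_snd
  exact ((((hg.fderiv.continuous_sphere_comp x).clm_apply hv).const_mul _).const_mul _).add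
    ((continuous_fst.fst.div_const _).mul
      (((hg.fderiv.fderiv.continuous_sphere_comp x).clm_apply hv).clm_apply hv))

theorem hasDerivAt_kirchhoffKernel (hg : JointSmooth g) (x : E3) (r s : ℝ) :
    HasDerivAt (fun r => kirchhoffKernel g x r s) (kirchhoffKernel₁ g x r s) r := by
  have h0 := hg.continuous_sphere_comp' x s
  have h1 := hg.fderiv.continuous_sphere_comp' x s
  refine hasDerivAt_integral_sphere
    (f := fun r (w : S2) => r / (4 * Real.pi) * g s (x + r • (w : E3)))
    (f' := fun r (w : S2) => 1 / (4 * Real.pi) * g s (x + r • (w : E3)) +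
      r / (4 * Real.pi) * fderiv ℝ (g s) (x + r • (w : E3)) w)
    ((continuous_fst.div_const _).mul h0) ((h0.const_mul _).add ((continuous_fst.div_const _).mul
      (h1.clm_apply (continuous_subtype_val.comp continuous_snd)))) ?_ r
  intro r w
  have h2 : HasDerivAt (fun r : ℝ => x + r • (w : E3)) (w : E3) r := by
    simpa using ((hasDerivAt_id r).smul_const (w : E3)).const_add x
  exact ((hasDerivAt_id r).div_const _).mul
    ((hg.differentiable s _).hasFDerivAt.comp_hasDerivAt r h2)

theorem hasDerivAt_kirchhoffKernel₁ (hg : JointSmooth g) (x : E3) (r s : ℝ) :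
    HasDerivAt (fun r => kirchhoffKernel₁ g x r s) (kirchhoffKernel₂ g x r s) r := by
  have h0 := hg.continuous_sphere_comp' x s
  have h1 := hg.fderiv.continuous_sphere_comp' x s
  have h2 := hg.fderiv.fderiv.continuous_sphere_comp' x s
  refine hasDerivAt_integral_sphere
    (f := fun r (w : S2) => 1 / (4 * Real.pi) * g s (x + r • (w : E3)) +
      r / (4 * Real.pi) * fderiv ℝ (g s) (x + r • (w : E3)) w)
    (f' := fun r (w : S2) => 1 / (4 * Real.pi) * (2 * fderiv ℝ (g s) (x + r • (w : E3)) w) +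
      r / (4 * Real.pi) * fderiv ℝ (fderiv ℝ (g s)) (x + r • (w : E3)) w w)
    ((h0.const_mul _).add ((continuous_fst.div_const _).mul
      (h1.clm_apply (continuous_subtype_val.comp continuous_snd))))
    ((((h1.clm_apply (continuous_subtype_val.comp continuous_snd)).const_mul _).const_mul _).add
      ((continuous_fst.div_const _).mul ((h2.clm_apply
        (continuous_subtype_val.comp continuous_snd)).clm_apply
          (continuous_subtype_val.comp continuous_snd)))) ?_ r
  intro r w
  have h3 : HasDerivAt (fun r : ℝ => x + r • (w : E3)) (w : E3) r := by
    simpa using ((hasDerivAt_id r).smul_const (w : E3)).const_add x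
  have h4 := ((hg.differentiable s _).hasFDerivAt.comp_hasDerivAt r h3).const_mul
    (1 / (4 * Real.pi))
  have h5 := ((hg.fderiv.differentiable s _).hasFDerivAt.comp_hasDerivAt r h3).clm_apply
    (hasDerivAt_const r (w : E3))
  refine (h4.add (((hasDerivAt_id r).div_const (4 * Real.pi)).mul h5)).congr_deriv ?_
  simp only [Function.comp_apply, id_eq, map_zero, add_zero]
  ring

/-- Darboux's identity for `y ↦ g s (x + r • y)`. The chain rule brings factors `r` and `r²`, so
dividing by `4πr` gives the second radial derivative of `r` times the spherical mean; hence `0 < r`.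
-/
theorem kirchhoffKernel₂_eq (hg : JointSmooth g) (x : E3) {r : ℝ} (hr : 0 < r) (s : ℝ) :
    kirchhoffKernel₂ g x r s =
      ∫ w : S2, r / (4 * Real.pi) * Δ (g s) (x + r • (w : E3)) ∂sphereMeasure := by
  have hcd : ContDiff ℝ 2 fun y : E3 => g s (x + r • y) :=
    (((hg 2).1 s).of_le le_rfl).comp (contDiff_const.add (contDiff_id.const_smul r))
  have hd : ∀ y : E3, HasFDerivAt (fun y : E3 => x + r • y) (r • ContinuousLinearMap.id ℝ E3) y :=
    fun y => ((hasFDerivAt_id y).const_smul r).const_add x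
  have h1 : fderiv ℝ (fun y : E3 => g s (x + r • y)) = fun y => r • fderiv ℝ (g s) (x + r • y) := by
    funext y
    refine ((hg.differentiable s _).hasFDerivAt.comp y (hd y)).fderiv.trans ?_
    ext
    simp
  have h2 : fderiv ℝ (fderiv ℝ fun y : E3 => g s (x + r • y)) =
      fun y => (r * r) • fderiv ℝ (fderiv ℝ (g s)) (x + r • y) := by
    funext y
    rw [h1]
    refine (((hg.fderiv.differentiable s _).hasFDerivAt.comp y (hd y)).const_smul r).fderiv.trans ?_
    ext
    simp [mul_assoc]
  have h3 := integral_sphere_darboux hcd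
  simp only [laplacian_eq_traceCLM, h2] at h3
  simp only [h1, map_smul, smul_apply, smul_eq_mul] at h3
  have h4 : kirchhoffKernel₂ g x r s = ∫ w : S2, 1 / (4 * Real.pi * r) *
      (2 * (r * fderiv ℝ (g s) (x + r • (w : E3)) w) +
        r * r * fderiv ℝ (fderiv ℝ (g s)) (x + r • (w : E3)) w w) ∂sphereMeasure := by
    rw [kirchhoffKernel₂]
    congr 1
    funext w
    field_simp
  rw [h4, integral_const_mul, ← h3, ← integral_const_mul]
  congr 1
  funext w
  rw [laplacian_eq_traceCLM]
  field_simp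

theorem retarded_eq (hg : JointSmooth g) (x : E3)
    (hgT : ∀ s, T ≤ s → g s = 0) {t : ℝ} (ht : t ∈ Icc 0 T) :
    retarded T g t x = ∫ s in t..T, kirchhoffKernel g x (s - t) s := by
  rw [retarded, coneIntegral_eq_intervalIntegral continuous_retarded_weight hg.continuous hgT ht]
  simp [kirchhoffKernel]

theorem retardedDeriv_eq (hg : JointSmooth g) (x : E3)
    (hgT : ∀ s, T ≤ s → g s = 0) {t : ℝ} (ht : t ∈ Icc 0 T) :
    retardedDeriv T g t x = -∫ s in t..T, kirchhoffKernel₁ g x (s - t) s := by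
  rw [retardedDeriv, coneIntegral_eq_intervalIntegral continuous_retardedDerivWeight
    hg.jet.continuous (fun s hs => ?_) ht]
  · simp [kirchhoffKernel₁, retardedDerivWeight]
  · funext y
    simp [hgT s hs]

theorem hasDerivWithinAt_retarded (hg : JointSmooth g) (x : E3)
    (hgT : ∀ s, T ≤ s → g s = 0) {t : ℝ} (ht : t ∈ Icc 0 T) :
    HasDerivWithinAt (fun s => retarded T g s x) (retardedDeriv T g t x) (Icc 0 T) t := by
  have h := hasDerivAt_integral_moving T (continuous_kirchhoffKernel hg x)
    (continuous_kirchhoffKernel₁ hg x) (hasDerivAt_kirchhoffKernel hg x) t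
  have h0 : kirchhoffKernel g x 0 t = 0 := by simp [kirchhoffKernel]
  rw [h0, neg_zero, zero_sub, ← retardedDeriv_eq hg x hgT ht] at h
  exact h.hasDerivWithinAt.congr (fun s hs => retarded_eq hg x hgT hs) (retarded_eq hg x hgT ht)

theorem hasDerivWithinAt_retardedDeriv (hg : JointSmooth g) (x : E3)
    (hgT : ∀ s, T ≤ s → g s = 0) {t : ℝ} (ht : t ∈ Icc 0 T) :
    HasDerivWithinAt (fun s => retardedDeriv T g s x) (g t x + Δ (retarded T g t) x)
      (Icc 0 T) t := by
  have h := (hasDerivAt_integral_moving T (continuous_kirchhoffKernel₁ hg x)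
    (continuous_kirchhoffKernel₂ hg x) (hasDerivAt_kirchhoffKernel₁ hg x) t).neg
  -- The boundary term of Leibniz' rule is the source: at radius zero only the average of `g t x`
  -- over a sphere of area `4π` remains.
  have h0 : kirchhoffKernel₁ g x 0 t = g t x := by
    simp only [kirchhoffKernel₁, zero_smul, add_zero, zero_div, zero_mul]
    rw [integral_const, sphereMeasure_real_univ, smul_eq_mul]
    field_simp
  have h1 : ∫ s in t..T, kirchhoffKernel₂ g x (s - t) s = Δ (retarded T g t) x := by
    have hΔT : ∀ s, T ≤ s → Δ (g s) = 0 := fun s hs => by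
      rw [hgT s hs]
      exact InnerProductSpace.laplacian_const
    rw [laplacian_retarded T hg, retarded_eq hg.laplacian x hΔT ht,
      intervalIntegral.integral_of_le ht.2, intervalIntegral.integral_of_le ht.2]
    refine setIntegral_congr_fun measurableSet_Ioc fun s hs => ?_
    exact kirchhoffKernel₂_eq hg x (sub_pos.2 hs.1) s
  rw [h0, h1] at h
  refine (h.hasDerivWithinAt.congr (fun s hs => retardedDeriv_eq hg x hgT hs)
    (retardedDeriv_eq hg x hgT ht)).congr_deriv ?_
  ring

end Kernels

end Kirchhoff

/-! ### The dual problem with a smooth potential -/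

section Picard

variable {F : Type} [NormedAddCommGroup F] [NormedSpace ℝ F]

theorem integral_exp_neg_le {l T : ℝ} (hl : 0 < l) (hT : 0 ≤ T) :
    ∫ r in Icc 0 T, Real.exp (-(l * r)) ≤ 1 / l := by
  rw [integral_Icc_eq_integral_Ioc, ← intervalIntegral.integral_of_le hT]
  have hd : ∀ r ∈ uIcc 0 T, HasDerivAt (fun r => -(1 / l) * Real.exp (-(l * r)))
      (Real.exp (-(l * r))) r := by
    intro r _
    have h1 : HasDerivAt (fun r => -(l * r)) (-l) r := by
      simpa using (hasDerivAt_id r).const_mul (-l)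
    refine (h1.exp.const_mul (-(1 / l))).congr_deriv ?_
    field_simp
  rw [intervalIntegral.integral_eq_sub_of_hasDerivAt hd
    (Continuous.intervalIntegrable (by fun_prop) _ _)]
  have : 0 < 1 / l * Real.exp (-(l * T)) := by positivity
  simp only [mul_zero, neg_zero, Real.exp_zero]
  linarith

/-- The retarded integral looks only at later times, where the weight `exp (-(l s))` is smaller; the
gain `T / l` becomes as small as desired for large `l`, without restricting `T`. -/
theorem norm_retarded_le {T l c : ℝ} (hT : 0 ≤ T) (hl : 0 < l) {g : ℝ → E3 → F}
    (hg : ∀ s, 0 ≤ s → ∀ x, ‖g s x‖ ≤ c * Real.exp (-(l * s))) {t : ℝ} (ht : 0 ≤ t) (x : E3) :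
    ‖retarded T g t x‖ ≤ T / l * (c * Real.exp (-(l * t))) := by
  have hc : 0 ≤ c := by
    have := (norm_nonneg _).trans (hg 0 le_rfl 0)
    simpa using this
  let bound : ℝ × S2 → ℝ := fun y => Real.exp (-(l * y.1)) *
    (T / (4 * Real.pi) * (c * Real.exp (-(l * t))))
  have hb : Continuous bound := by fun_prop
  have h1 : ‖retarded T g t x‖ ≤ ∫ y in Icc 0 T ×ˢ (univ : Set S2), bound y
      ∂((volume : Measure ℝ).prod sphereMeasure) := by
    refine norm_integral_le_of_norm_le
      (hb.continuousOn.integrableOn_compact (isCompact_Icc.prod isCompact_univ)) ?_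
    filter_upwards [ae_restrict_mem (measurableSet_Icc.prod MeasurableSet.univ)] with y hy
    have hy0 : 0 ≤ y.1 := hy.1.1
    have hyT : y.1 ≤ T := hy.1.2
    have h2 := hg (t + y.1) (by linarith) (x + y.1 • (y.2 : E3))
    rw [show -(l * (t + y.1)) = -(l * y.1) + -(l * t) by ring, Real.exp_add] at h2
    simp only [smul_apply, ContinuousLinearMap.id_apply, norm_smul, Real.norm_eq_abs]
    rw [abs_of_nonneg (by positivity)]
    calc y.1 / (4 * Real.pi) * ‖g (t + y.1) (x + y.1 • (y.2 : E3))‖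
        ≤ T / (4 * Real.pi) * (c * (Real.exp (-(l * y.1)) * Real.exp (-(l * t)))) := by gcongr
      _ = bound y := by simp only [bound]; ring
  refine h1.trans ?_
  have h3 := setIntegral_prod_mul (μ := (volume : Measure ℝ)) (ν := sphereMeasure)
    (fun r => Real.exp (-(l * r))) (fun _ : S2 => T / (4 * Real.pi) * (c * Real.exp (-(l * t))))
    (Icc 0 T) univ
  rw [h3, setIntegral_univ, integral_const, sphereMeasure_real_univ, smul_eq_mul]
  calc (∫ r in Icc 0 T, Real.exp (-(l * r))) *
        (4 * Real.pi * (T / (4 * Real.pi) * (c * Real.exp (-(l * t)))))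
      ≤ 1 / l * (4 * Real.pi * (T / (4 * Real.pi) * (c * Real.exp (-(l * t))))) := by
        gcongr
        exact integral_exp_neg_le hl hT
    _ = T / l * (c * Real.exp (-(l * t))) := by field_simp

theorem norm_iteratedFDeriv_retarded_le {T l c : ℝ} (hT : 0 ≤ T) (hl : 0 < l) {m : ℕ}
    {g : ℝ → E3 → F} (hgs : JointSmooth g)
    (hg : ∀ s, 0 ≤ s → ∀ x, ‖iteratedFDeriv ℝ m (g s) x‖ ≤ c * Real.exp (-(l * s))) {t : ℝ}
    (ht : 0 ≤ t) (x : E3) :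
    ‖iteratedFDeriv ℝ m (retarded T g t) x‖ ≤ T / l * (c * Real.exp (-(l * t))) := by
  induction m generalizing F with
  | zero =>
    simp only [norm_iteratedFDeriv_zero] at hg ⊢
    exact norm_retarded_le hT hl hg ht x
  | succ m ih =>
    rw [← norm_iteratedFDeriv_fderiv, fderiv_retarded T hgs]
    refine ih (g := fun t => fderiv ℝ (g t)) hgs.fderiv fun s hs x => ?_
    rw [norm_iteratedFDeriv_fderiv]
    exact hg s hs x

/-- `g` vanishes after the time `b` and outside the backward cone `‖x‖ ≤ R - s`. -/
def VanishesOutside (b R : ℝ) (g : ℝ → E3 → F) : Prop :=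
  ∀ s x, (b ≤ s ∨ R - s < ‖x‖) → g s x = 0

/-- A point at height `r` on the forward cone over `x` is at distance exactly `r` from `x`, so cones
with vertex outside the region never enter it. -/
theorem VanishesOutside.retarded {b R : ℝ} {g : ℝ → E3 → F} (hg : VanishesOutside b R g) (T : ℝ) :
    VanishesOutside b R (retarded T g) := by
  intro t x htx
  rw [_root_.retarded, coneIntegral]
  refine setIntegral_eq_zero_of_forall_eq_zero fun y hy => ?_
  have hy0 : 0 ≤ y.1 := hy.1.1
  rw [hg, map_zero]
  rcases htx with h | h
  · exact Or.inl (by linarith)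
  · right
    have h1 : ‖y.1 • (y.2 : E3)‖ = y.1 := by
      rw [norm_smul, Real.norm_eq_abs, abs_of_nonneg hy0]
      simp
    have h2 := norm_sub_le (x + y.1 • (y.2 : E3)) (y.1 • (y.2 : E3))
    rw [add_sub_cancel_right, h1] at h2
    linarith

theorem VanishesOutside.eq_zero {b R : ℝ} {g : ℝ → E3 → ℝ} (hg : VanishesOutside b R g) {s : ℝ}
    (hs : b ≤ s) : g s = 0 :=
  funext fun x => hg s x (Or.inl hs)

theorem JointSmooth.exists_bound {f : ℝ → E3 → F} (hf : JointSmooth f) {R a b : ℝ}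
    (hR : ∀ t ∈ Icc a b, ∀ x, R < ‖x‖ → f t x = 0) (m : ℕ) :
    ∃ A, 0 ≤ A ∧ ∀ t ∈ Icc a b, ∀ x, ∀ j ≤ m, ‖iteratedFDeriv ℝ j (f t) x‖ ≤ A := by
  have hone : ∀ j, ∃ A, 0 ≤ A ∧ ∀ t ∈ Icc a b, ∀ x, ‖iteratedFDeriv ℝ j (f t) x‖ ≤ A := by
    intro j
    obtain ⟨A, hA⟩ := ((isCompact_Icc (a := a) (b := b)).prod
      (isCompact_closedBall (0 : E3) R)).exists_bound_of_continuousOn ((hf j).2 j le_rfl).continuousOn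
    refine ⟨max A 0, le_max_right _ _, fun t ht x => ?_⟩
    by_cases hx : ‖x‖ ≤ R
    · exact (hA (t, x) ⟨ht, by simpa using hx⟩).trans (le_max_left _ _)
    · have h1 : f t =ᶠ[nhds x] fun _ => 0 := by
        filter_upwards [(isOpen_lt continuous_const continuous_norm).mem_nhds
          (not_le.1 hx : R < ‖x‖)] with y hy
        exact hR t ht y hy
      rw [(h1.iteratedFDeriv ℝ j).eq_of_nhds, iteratedFDeriv_fun_zero]
      simp
  choose A hA0 hA using hone
  refine ⟨∑ j ∈ Finset.range (m + 1), A j, Finset.sum_nonneg fun j _ => hA0 j,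
    fun t ht x j hj => (hA j t ht x).trans ?_⟩
  exact Finset.single_le_sum (f := A) (fun j _ => hA0 j) (Finset.mem_range.2 (by omega))

theorem norm_iteratedFDeriv_mul_le_of_le {f g : E3 → ℝ} (hf : ContDiff ℝ ∞ f)
    (hg : ContDiff ℝ ∞ g) {m : ℕ} {A B : ℝ} (x : E3)
    (hA : ∀ j ≤ m, ‖iteratedFDeriv ℝ j f x‖ ≤ A) (hB : ∀ j ≤ m, ‖iteratedFDeriv ℝ j g x‖ ≤ B) {j : ℕ}
    (hj : j ≤ m) : ‖iteratedFDeriv ℝ j (fun y => f y * g y) x‖ ≤ 2 ^ m * A * B := by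
  have hA0 : 0 ≤ A := (norm_nonneg _).trans (hA 0 (Nat.zero_le m))
  have hB0 : 0 ≤ B := (norm_nonneg _).trans (hB 0 (Nat.zero_le m))
  calc ‖iteratedFDeriv ℝ j (fun y => f y * g y) x‖
      ≤ ∑ i ∈ Finset.range (j + 1), (j.choose i : ℝ) * ‖iteratedFDeriv ℝ i f x‖ *
          ‖iteratedFDeriv ℝ (j - i) g x‖ :=
        norm_iteratedFDeriv_mul_le hf hg x (by exact_mod_cast le_top)
    _ ≤ ∑ i ∈ Finset.range (j + 1), (j.choose i : ℝ) * A * B := by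
        refine Finset.sum_le_sum fun i hi => ?_
        have hi' : i ≤ j := by simpa [Nat.lt_succ_iff] using hi
        have h1 := hA i (hi'.trans hj)
        have h2 := hB (j - i) ((Nat.sub_le j i).trans hj)
        gcongr
    _ = 2 ^ j * A * B := by
        rw [← Finset.sum_mul, ← Finset.sum_mul]
        have := Nat.sum_range_choose j
        rw [show (∑ i ∈ Finset.range (j + 1), (j.choose i : ℝ)) = 2 ^ j by exact_mod_cast this]
    _ ≤ 2 ^ m * A * B := by
        gcongr
        norm_num

/-- The iterates of the Neumann series for `□φ + Vφ = f`. -/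
noncomputable def picardTerm (T : ℝ) (V f : ℝ → E3 → ℝ) : ℕ → ℝ → E3 → ℝ
  | 0 => retarded T f
  | k + 1 => retarded T fun t x => -(V t x * picardTerm T V f k t x)

variable {T b R : ℝ} {V f : ℝ → E3 → ℝ}

theorem jointSmooth_picardTerm (hV : JointSmooth V) (hf : JointSmooth f) (k : ℕ) :
    JointSmooth (picardTerm T V f k) := by
  induction k with
  | zero => exact hf.retarded T
  | succ k ih => exact (hV.mul ih).neg.retarded T

theorem vanishesOutside_picardTerm (hf : VanishesOutside b R f) (k : ℕ) :
    VanishesOutside b R (picardTerm T V f k) := by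
  induction k with
  | zero => exact hf.retarded T
  | succ k ih =>
    refine VanishesOutside.retarded (fun s x h => ?_) T
    rw [ih s x h]
    simp

theorem exists_bound_picardTerm (hT : 0 ≤ T) (hV : JointSmooth V) (hf : JointSmooth f)
    (hVb : ∀ m : ℕ, ∃ A, ∀ t, 0 ≤ t → ∀ x, ∀ j ≤ m, ‖iteratedFDeriv ℝ j (V t) x‖ ≤ A)
    (hbT : b ≤ T) (hfs : VanishesOutside b R f) (m : ℕ) :
    ∃ B : ℝ, ∀ k t, 0 ≤ t → ∀ x, ∀ j ≤ m,
      ‖iteratedFDeriv ℝ j (picardTerm T V f k t) x‖ ≤ B * (1 / 2) ^ k := by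
  obtain ⟨A, hA⟩ := hVb m
  have hA0 : 0 ≤ A := (norm_nonneg _).trans (hA 0 le_rfl 0 0 (Nat.zero_le m))
  -- Chosen so that the gain `T / l` beats the Leibniz constant `2 ^ m * A` by a factor of two; the
  -- added one keeps `l` positive.
  let l : ℝ := 2 * T * (2 ^ m * A) + 1
  have hl : 0 < l := by positivity
  have hlA : T / l * (2 ^ m * A) ≤ 1 / 2 := by
    rw [div_mul_eq_mul_div, div_le_iff₀ hl]
    simp only [l]
    linarith
  obtain ⟨A', hA'0, hA'⟩ := hf.exists_bound (R := R) (a := 0) (b := T) (m := m)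
    fun t ht x hx => hfs t x (Or.inr (by linarith [ht.1]))
  let B : ℝ := T / l * (A' * Real.exp (l * T))
  have hB0 : 0 ≤ B := by positivity
  have key : ∀ k t, 0 ≤ t → ∀ x, ∀ j ≤ m, ‖iteratedFDeriv ℝ j (picardTerm T V f k t) x‖ ≤
      B * (1 / 2) ^ k * Real.exp (-(l * t)) := by
    intro k
    induction k with
    | zero =>
      intro t ht x j hj
      -- On `[0, T]` the factor `exp (l T)` compensates the weight, so a constant bound on the
      -- source becomes a weighted one.
      have := norm_iteratedFDeriv_retarded_le (c := A' * Real.exp (l * T)) hT hl (m := j) hf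
        (fun s hs x => ?_) ht x
      · simpa [picardTerm, B, mul_assoc] using this
      · by_cases hsT : s ≤ T
        · refine (hA' s ⟨hs, hsT⟩ x j hj).trans ?_
          rw [mul_assoc, ← Real.exp_add]
          refine le_mul_of_one_le_right hA'0 (Real.one_le_exp ?_)
          nlinarith
        · rw [hfs.eq_zero (by linarith), show (0 : E3 → ℝ) = fun _ => 0 from rfl,
            iteratedFDeriv_fun_zero]
          simp only [Pi.zero_apply, norm_zero]
          positivity
    | succ k ih =>
      intro t ht x j hj
      have := norm_iteratedFDeriv_retarded_le (c := 2 ^ m * A * (B * (1 / 2) ^ k)) hT hl (m := j)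
        (hV.mul (jointSmooth_picardTerm (T := T) hV hf k)).neg (fun s hs x => ?_) ht x
      · refine this.trans ?_
        calc T / l * (2 ^ m * A * (B * (1 / 2) ^ k) * Real.exp (-(l * t)))
            = T / l * (2 ^ m * A) * (B * (1 / 2) ^ k * Real.exp (-(l * t))) := by ring
          _ ≤ 1 / 2 * (B * (1 / 2) ^ k * Real.exp (-(l * t))) := by gcongr
          _ = B * (1 / 2) ^ (k + 1) * Real.exp (-(l * t)) := by ring
      · have h1 := norm_iteratedFDeriv_mul_le_of_le (hV.contDiff s)
          ((jointSmooth_picardTerm (T := T) hV hf k).contDiff s) x (hA s hs x) (ih s hs x) hj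
        have h2 : iteratedFDeriv ℝ j (fun x => -(V s x * picardTerm T V f k s x)) x =
            -iteratedFDeriv ℝ j (fun x => V s x * picardTerm T V f k s x) x :=
          iteratedFDeriv_neg_apply
        rw [h2, norm_neg]
        refine h1.trans_eq ?_
        ring
  refine ⟨B, fun k t ht x j hj => (key k t ht x j hj).trans ?_⟩
  refine mul_le_of_le_one_right (by positivity) (Real.exp_le_one_iff.2 ?_)
  have : 0 ≤ l * t := by positivity
  linarith

end Picard

/-! ### Convergence of the Neumann series. -/

section Neumann

variable {T b R : ℝ} {V f : ℝ → E3 → ℝ}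

/-- The sum of the Neumann series for `□φ + Vφ = f`. -/
noncomputable def picardSum (T : ℝ) (V f : ℝ → E3 → ℝ) (t : ℝ) (x : E3) : ℝ :=
  ∑' k, picardTerm T V f k (max t 0) x

theorem jointSmooth_picardSum (hV : JointSmooth V) (hf : JointSmooth f)
    (hB : ∀ m : ℕ, ∃ B : ℝ, ∀ k t, 0 ≤ t → ∀ x, ∀ j ≤ m,
      ‖iteratedFDeriv ℝ j (picardTerm T V f k t) x‖ ≤ B * (1 / 2) ^ k) :
    JointSmooth (picardSum T V f) := by
  choose B hB using hB
  have hsum : ∀ m, Summable fun k => B m * (1 / 2 : ℝ) ^ k := fun m =>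
    (summable_geometric_two).mul_left (B m)
  have hs := jointSmooth_picardTerm (T := T) hV hf
  rw [jointSmooth_iff]
  refine ⟨fun t => ?_, fun m => ?_⟩
  · exact contDiff_tsum (N := ⊤) (fun k => (hs k).contDiff (max t 0)) (fun m _ => hsum m)
      fun m k x _ => hB m k _ (le_max_right _ _) x m le_rfl
  · have h1 : ∀ z : ℝ × E3, iteratedFDeriv ℝ m (picardSum T V f z.1) z.2 =
        ∑' k, iteratedFDeriv ℝ m (picardTerm T V f k (max z.1 0)) z.2 := fun z =>
      iteratedFDeriv_tsum_apply (N := ⊤) (fun k => (hs k).contDiff (max z.1 0))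
        (fun m _ => hsum m) (fun m k x _ => hB m k _ (le_max_right _ _) x m le_rfl)
        (by exact_mod_cast le_top) z.2
    simp only [h1]
    refine continuous_tsum (fun k => ?_) (hsum m) fun k z =>
      hB m k _ (le_max_right _ _) z.2 m le_rfl
    exact ((hs k m).2 m le_rfl).comp (by fun_prop : Continuous fun z : ℝ × E3 => (max z.1 0, z.2))

theorem vanishesOutside_picardSum (hf : VanishesOutside b R f) :
    VanishesOutside b R (picardSum T V f) := by
  intro t x h
  have h' : b ≤ max t 0 ∨ R - max t 0 < ‖x‖ := by
    rcases le_total 0 t with ht | ht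
    · rwa [max_eq_left ht]
    · rw [max_eq_right ht]
      rcases h with h | h
      · exact Or.inl (by linarith)
      · exact Or.inr (by linarith)
  simp only [picardSum, vanishesOutside_picardTerm (T := T) (V := V) hf _ _ x h', tsum_zero]

theorem picardSum_eq (hV : JointSmooth V) (hf : JointSmooth f)
    (hVb : ∃ A, ∀ t, 0 ≤ t → ∀ x, |V t x| ≤ A)
    (hB : ∃ B : ℝ, ∀ k t, 0 ≤ t → ∀ x, |picardTerm T V f k t x| ≤ B * (1 / 2) ^ k)
    (hs : JointSmooth (picardSum T V f)) {t : ℝ} (ht : 0 ≤ t) (x : E3) :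
    picardSum T V f t x = retarded T (fun t x => f t x - V t x * picardSum T V f t x) t x := by
  obtain ⟨A, hA⟩ := hVb
  obtain ⟨B, hB⟩ := hB
  have hA0 : 0 ≤ A := (abs_nonneg _).trans (hA 0 le_rfl 0)
  have hB0 : 0 ≤ B := by simpa using (abs_nonneg _).trans (hB 0 0 le_rfl 0)
  have hsum : ∀ s, 0 ≤ s → ∀ y, HasSum (fun k => picardTerm T V f k s y) (picardSum T V f s y) := by
    intro s hs y
    rw [picardSum, max_eq_left hs]
    exact (Summable.of_norm_bounded (summable_geometric_two.mul_left B) fun k =>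
      hB k s hs y).hasSum
  have hfin : IsFiniteMeasure (((volume : Measure ℝ).prod sphereMeasure).restrict
      (Icc 0 T ×ˢ (univ : Set S2))) := ⟨by
    rw [Measure.restrict_apply_univ]
    exact (isCompact_Icc.prod isCompact_univ).measure_lt_top⟩
  -- Summation commutes with the cone integral by dominated convergence, the terms being bounded by
  -- a geometric series; the series shifted by one is therefore `retarded` of `-V` times the sum.
  have h1 : HasSum (fun k => picardTerm T V f (k + 1) t x)
      (retarded T (fun t x => -(V t x * picardSum T V f t x)) t x) := by
    refine hasSum_integral_of_dominated_convergence
      (bound := fun k _ => |T| / (4 * Real.pi) * (A * B) * (1 / 2) ^ k) (fun k => ?_) (fun k => ?_)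
      ?_ ?_ ?_
    · exact ((continuous_cone_integrand continuous_retarded_weight
        (g := fun t x => -(V t x * picardTerm T V f k t x))
          ((hV.mul (jointSmooth_picardTerm (T := T) hV hf k)).neg.continuous)).comp
        (Continuous.prodMk_right (t, x))).aestronglyMeasurable
    · filter_upwards [ae_restrict_mem (measurableSet_Icc.prod MeasurableSet.univ)] with y hy
      have hy0 : 0 ≤ y.1 := hy.1.1
      have hyT : y.1 ≤ |T| := hy.1.2.trans (le_abs_self T)
      simp only [smul_apply, ContinuousLinearMap.id_apply, norm_smul, Real.norm_eq_abs, abs_neg,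
        abs_mul]
      rw [abs_of_nonneg (by positivity), mul_assoc, mul_assoc A B]
      have h2 := hA (t + y.1) (by linarith) (x + y.1 • (y.2 : E3))
      have h3 := hB k (t + y.1) (by linarith) (x + y.1 • (y.2 : E3))
      gcongr
    · exact Eventually.of_forall fun y => summable_geometric_two.mul_left _
    · exact integrable_const _
    · filter_upwards [ae_restrict_mem (measurableSet_Icc.prod MeasurableSet.univ)] with y hy
      have hy0 : 0 ≤ y.1 := hy.1.1
      exact (((hsum (t + y.1) (by linarith) (x + y.1 • (y.2 : E3))).mul_left _).neg).mul_left _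
  have h0 : picardTerm T V f 0 = retarded T f := rfl
  have h2 := (hsum t ht x).unique ((hasSum_nat_add_iff' 1).1 (by
    simpa only [Finset.sum_range_one, h0, add_sub_cancel_left] using h1) :
    HasSum (fun k => picardTerm T V f k t x) (retarded T f t x +
      retarded T (fun t x => -(V t x * picardSum T V f t x)) t x))
  rw [h2, ← retarded_add T hf.continuous (hV.mul hs).neg.continuous]
  simp only [sub_eq_add_neg]

end Neumann

/-! ### Solution and regularity of the dual problem. -/

section Dual

theorem jointSmooth_of_contDiff {F : Type} [NormedAddCommGroup F] [NormedSpace ℝ F]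
    {f : ℝ → E3 → F} (hf : ContDiff ℝ ∞ fun z : ℝ × E3 => f z.1 z.2) : JointSmooth f := by
  refine JointSmooth.of_invariant
    (fun G _ _ f => ContDiff ℝ ∞ fun z : ℝ × E3 => f z.1 z.2) (fun G _ _ f hf => ?_) hf
  have hd : ∀ t x, HasFDerivAt (f t) ((fderiv ℝ (fun z : ℝ × E3 => f z.1 z.2) (t, x)).comp
      (ContinuousLinearMap.inr ℝ ℝ E3)) x := fun t x =>
    ((hf.differentiable (by simp) (t, x)).hasFDerivAt).comp x (hasFDerivAt_prodMk_right t x)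
  refine ⟨hf.continuous, fun t x => (hd t x).differentiableAt, ?_⟩
  simp only [fun t x => (hd t x).fderiv]
  exact (hf.fderiv_right (m := ∞) (by simp)).clm_comp contDiff_const

/-- Smoothness in time of a solution is governed by that of its second time derivative. -/
theorem TimeSmooth.of_second_deriv {T : ℝ} {k : ℕ} {φ φ' φ'' : ℝ → E3 → ℝ}
    (h0 : JointSmooth fun t : Icc 0 T => φ t) (h1 : JointSmooth fun t : Icc 0 T => φ' t)
    (hd : ∀ t ∈ Icc 0 T, ∀ x, HasDerivWithinAt (fun s => φ s x) (φ' t x) (Icc 0 T) t)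
    (hd' : ∀ t ∈ Icc 0 T, ∀ x, HasDerivWithinAt (fun s => φ' s x) (φ'' t x) (Icc 0 T) t)
    (h2 : TimeSmooth T k φ'') : TimeSmooth T (k + 2) φ :=
  ⟨h0, φ', ⟨h1, φ'', h2, hd'⟩, hd⟩

theorem timeSmooth_of_contDiff (T : ℝ) (k : ℕ) {f : ℝ → E3 → ℝ}
    (hf : ContDiff ℝ ∞ fun z : ℝ × E3 => f z.1 z.2) : TimeSmooth T k f := by
  have hs : ∀ {f : ℝ → E3 → ℝ}, (ContDiff ℝ ∞ fun z : ℝ × E3 => f z.1 z.2) →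
      JointSmooth fun t : Icc 0 T => f t := fun hf =>
    (jointSmooth_of_contDiff hf).comp_param continuous_subtype_val
  induction k generalizing f with
  | zero => exact hs hf
  | succ k ih =>
    refine ⟨hs hf, fun t x => fderiv ℝ (fun z : ℝ × E3 => f z.1 z.2) (t, x) (1, 0), ih ?_, ?_⟩
    · exact (hf.fderiv_right (m := ∞) (by simp)).clm_apply contDiff_const
    · intro t _ x
      have h1 : HasDerivAt (fun s : ℝ => (s, x)) (1, 0) t :=
        (hasDerivAt_id t).prodMk (hasDerivAt_const t x)
      exact (((hf.differentiable (by simp) (t, x)).hasFDerivAt).comp_hasDerivAt t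
        h1).hasDerivWithinAt

theorem retarded_congr {T : ℝ} {g h : ℝ → E3 → ℝ} (hgh : ∀ s, 0 ≤ s → g s = h s) {t : ℝ}
    (ht : 0 ≤ t) (x : E3) : retarded T g t x = retarded T h t x := by
  refine setIntegral_congr_fun (measurableSet_Icc.prod MeasurableSet.univ) fun y hy => ?_
  have hy0 : 0 ≤ y.1 := hy.1.1
  simp only [hgh (t + y.1) (by linarith)]

theorem iteratedDerivWithin_two_eq {T : ℝ} (hT : 0 < T) {f f' : ℝ → ℝ} {c t : ℝ}
    (ht : t ∈ Icc 0 T) (h1 : ∀ s ∈ Icc 0 T, HasDerivWithinAt f (f' s) (Icc 0 T) s)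
    (h2 : HasDerivWithinAt f' c (Icc 0 T) t) : iteratedDerivWithin 2 f (Icc 0 T) t = c := by
  have hu : UniqueDiffOn ℝ (Icc 0 T) := uniqueDiffOn_Icc hT
  have h3 : ∀ s ∈ Icc 0 T, derivWithin f (Icc 0 T) s = f' s := fun s hs =>
    (h1 s hs).derivWithin (hu s hs)
  rw [show (2 : ℕ) = 1 + 1 from rfl, iteratedDerivWithin_succ', iteratedDerivWithin_one,
    derivWithin_congr h3 (h3 t ht)]
  exact h2.derivWithin (hu t ht)

/-- Existence, regularity and finite speed of propagation for the dual problem. -/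
theorem exists_dual_solution {T b R : ℝ} (hT : 0 < T) (hbT : b ≤ T)
    {V F : ℝ → E3 → ℝ} (hV : TimeSmooth T 0 V) (hF : ContDiff ℝ ∞ fun z : ℝ × E3 => F z.1 z.2)
    (hFs : VanishesOutside b R F) :
    ∃ φ : ℝ → E3 → ℝ, SolvesDual T V F φ ∧ JointSmooth φ ∧
      (∀ k, TimeSmooth T k V → TimeSmooth T (k + 2) φ) ∧ VanishesOutside b R φ ∧
      (∀ t, 0 ≤ t → ∀ x, φ t x = retarded T (fun t x => F t x -
        V (projIcc 0 T hT.le t) x * φ t x) t x) := by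
  have hFj := jointSmooth_of_contDiff hF
  -- `V` need not be bounded in space. The cutoff equals one on the ball of radius `|R| + 1`, which
  -- contains the support of the solution at all nonnegative times, so it disappears from the final
  -- equation.
  let χ : ContDiffBump (0 : E3) := ⟨|R| + 1, |R| + 2, by positivity, by linarith⟩
  let W : ℝ → E3 → ℝ := fun t x => χ x * V (projIcc 0 T hT.le t) x
  have hχ : JointSmooth fun (_ : ℝ) (x : E3) => χ x :=
    jointSmooth_of_contDiff (χ.contDiff.comp contDiff_snd)
  have hW : JointSmooth W := hχ.mul (JointSmooth.comp_param hV (τ := projIcc 0 T hT.le)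
    continuous_projIcc)
  have hWb : ∀ m : ℕ, ∃ A, ∀ t, 0 ≤ t → ∀ x, ∀ j ≤ m, ‖iteratedFDeriv ℝ j (W t) x‖ ≤ A := by
    intro m
    obtain ⟨A, -, hA⟩ := hW.exists_bound (R := |R| + 2) (a := 0) (b := T) (m := m)
      fun t _ x hx => by
        simp only [W]
        rw [χ.zero_of_le_dist (by simpa using hx.le), zero_mul]
    refine ⟨A, fun t _ x j hj => ?_⟩
    have := hA (projIcc 0 T hT.le t) (projIcc 0 T hT.le t).2 x j hj
    simpa only [W, projIcc_val] using this
  have hB := exists_bound_picardTerm hT.le hW hFj hWb hbT hFs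
  have hΦ := jointSmooth_picardSum (T := T) hW hFj hB
  have hΦv : VanishesOutside b R (picardSum T W F) := vanishesOutside_picardSum hFs
  set Φ := picardSum T W F with hΦdef
  let g : ℝ → E3 → ℝ := fun t x => F t x - W t x * Φ t x
  have hg : JointSmooth g := hFj.sub (hW.mul hΦ)
  have hgv : VanishesOutside b R g := fun s x h => by
    simp only [g, hFs s x h, hΦv s x h]
    simp
  have hgT : ∀ s, T ≤ s → g s = 0 := fun s hs => hgv.eq_zero (hbT.trans hs)
  -- The sum `Φ` is frozen at negative times, so the solution is taken to be the retarded integral,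
  -- to which Kirchhoff's formula applies directly; the two agree for `t ≥ 0`.
  let φ := retarded T g
  have hφv : VanishesOutside b R φ := hgv.retarded T
  have hφΦ : ∀ t, 0 ≤ t → φ t = Φ t := fun t ht => funext fun x => by
    refine (picardSum_eq hW hFj ?_ ?_ hΦ ht x).symm
    · obtain ⟨A, hA⟩ := hWb 0
      exact ⟨A, fun t ht x => by simpa using hA t ht x 0 le_rfl⟩
    · obtain ⟨B, hB⟩ := hB 0
      exact ⟨B, fun k t ht x => by simpa using hB k t ht x 0 le_rfl⟩
  have hgφ : ∀ t, 0 ≤ t → g t = fun x => F t x - V (projIcc 0 T hT.le t) x * φ t x := by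
    intro t ht
    funext x
    simp only [g, W]
    rw [hφΦ t ht]
    by_cases hx : ‖x‖ ≤ R - t
    · rw [χ.one_of_mem_closedBall, one_mul]
      have : ‖x‖ ≤ |R| + 1 := by linarith [le_abs_self R]
      simpa using this
    · rw [hΦv t x (Or.inr (not_le.1 hx))]
      simp
  have hgφ' : ∀ t ∈ Icc 0 T, ∀ x, g t x = F t x - V t x * φ t x := by
    intro t ht x
    rw [hgφ t ht.1, projIcc_of_mem hT.le ht]
  have hd := fun t (ht : t ∈ Icc 0 T) x => hasDerivWithinAt_retarded hg x hgT ht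
  have hd' := fun t (ht : t ∈ Icc 0 T) x => hasDerivWithinAt_retardedDeriv hg x hgT ht
  have hφs : JointSmooth φ := hg.retarded T
  have hφI : TimeSmooth T 0 φ := hφs.comp_param continuous_subtype_val
  refine ⟨φ, ⟨fun t ht x => ?_, fun x => ?_, fun x => ?_⟩, hφs, fun k => ?_, hφv,
    fun t ht x => retarded_congr hgφ ht x⟩
  · rw [waveOp, iteratedDerivWithin_two_eq hT ht (fun s hs => hd s hs x) (hd' t ht x),
      hgφ' t ht x]
    ring
  · exact hφv T x (Or.inl hbT)
  · have hTm : T ∈ Icc 0 T := ⟨hT.le, le_rfl⟩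
    rw [(hd T hTm x).derivWithin (uniqueDiffOn_Icc hT T hTm), retardedDeriv_eq hg x hgT hTm,
      intervalIntegral.integral_same, neg_zero]
  -- The second time derivative `F - V φ + Δφ` has `k` time orders as soon as `V` and `φ` do, the
  -- Laplacian costing none. Each round gives two orders and the next one uses only one of them.
  · have step : ∀ k, TimeSmooth T k V → TimeSmooth T k φ → TimeSmooth T (k + 2) φ := by
      intro k hVk hφk
      have h2 : TimeSmooth T k fun t x => F t x - V t x * φ t x + Δ (φ t) x :=
        ((timeSmooth_of_contDiff T k hF).sub (hVk.mul hφk)).add (hφk.laplacian hT.le)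
      refine TimeSmooth.of_second_deriv hφI ((hg.retardedDeriv T).comp_param
        continuous_subtype_val) hd hd' (h2.congr fun t ht => funext fun x => ?_)
      simp only [hgφ' t ht x, φ]
    induction k with
    | zero => exact fun h => step 0 h hφI
    | succ k ih => exact fun h => step (k + 1) h (ih h.of_succ).of_succ

end Dual

/-! ### A supremum bound from smallness of the potential on light cones. -/

section SupBound

/-- The integral of `f / |y|` over the part of height `r` of the forward light cone with vertex
`(t, x)`, in polar coordinates. -/
noncomputable def conePotential (f : ℝ → E3 → ℝ) (t : ℝ) (x : E3) (r : ℝ) : ℝ≥0∞ :=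
  ∫⁻ s in Ioo 0 r, ∫⁻ w : S2, ENNReal.ofReal (s * f (t + s) (x + s • (w : E3))) ∂sphereMeasure

variable {T b R : ℝ}

theorem abs_retarded_le {B : ℝ} (hT : 0 ≤ T) {F : ℝ → E3 → ℝ} (hF : ∀ t x, |F t x| ≤ B) (t : ℝ)
    (x : E3) : |retarded T F t x| ≤ T ^ 2 * B := by
  have hB : 0 ≤ B := (abs_nonneg _).trans (hF 0 0)
  have hfin : ((volume : Measure ℝ).prod sphereMeasure) (Icc 0 T ×ˢ (univ : Set S2)) < ⊤ :=
    (isCompact_Icc.prod isCompact_univ).measure_lt_top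
  have h := norm_setIntegral_le_of_norm_le_const (C := T / (4 * Real.pi) * B) hfin
    (f := fun y : ℝ × S2 => ((y.1 / (4 * Real.pi)) • ContinuousLinearMap.id ℝ ℝ)
      (F (t + y.1) (x + y.1 • (y.2 : E3)))) fun y hy => ?_
  · refine h.trans_eq ?_
    rw [measureReal_def, Measure.prod_prod, ENNReal.toReal_mul, ← measureReal_def,
      ← measureReal_def, sphereMeasure_real_univ, Real.volume_real_Icc_of_le hT]
    field_simp
    ring
  · have hy0 : 0 ≤ y.1 := hy.1.1
    have hyT : y.1 ≤ T := hy.1.2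
    simp only [smul_apply, ContinuousLinearMap.id_apply, norm_smul, Real.norm_eq_abs]
    rw [abs_of_nonneg (by positivity)]
    have := hF (t + y.1) (x + y.1 • (y.2 : E3))
    gcongr

/-- Kirchhoff's kernel carries `1 / (4π)`, and `(S / 4π) * 2π = S / 2`: this is where the threshold
`2π` comes from. Only heights below `T - t` matter, since `φ` vanishes later. -/
theorem abs_retarded_mul_le {S : ℝ} {V φ : ℝ → E3 → ℝ}
    (hV : Continuous fun z : ℝ × E3 => V z.1 z.2) (hφ : Continuous fun z : ℝ × E3 => φ z.1 z.2)
    (hV0 : ∀ t x, 0 ≤ V t x) {t : ℝ}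
    (hφT : ∀ s, T ≤ s → φ s = 0) (hS : ∀ s ∈ Icc t T, ∀ x, |φ s x| ≤ S) (ht : t ≤ T) (x : E3)
    (hcone : conePotential V t x (T - t) ≤ ENNReal.ofReal (2 * Real.pi)) :
    |retarded T (fun t x => -(V t x * φ t x)) t x| ≤ S / 2 := by
  have hS0 : 0 ≤ S := (abs_nonneg _).trans (hS T ⟨ht, le_rfl⟩ 0)
  have hc : Continuous fun y : ℝ × S2 => ((y.1 / (4 * Real.pi)) • ContinuousLinearMap.id ℝ ℝ)
      (-(V (t + y.1) (x + y.1 • (y.2 : E3)) * φ (t + y.1) (x + y.1 • (y.2 : E3)))) :=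
    (continuous_cone_integrand continuous_retarded_weight
      (g := fun t x => -(V t x * φ t x)) (hV.mul hφ).neg).comp (Continuous.prodMk_right (t, x))
  rw [← ENNReal.ofReal_le_ofReal_iff (by positivity), ← Real.norm_eq_abs, ofReal_norm]
  calc ‖retarded T (fun t x => -(V t x * φ t x)) t x‖ₑ
      ≤ ∫⁻ y in Icc 0 T ×ˢ (univ : Set S2), ‖((y.1 / (4 * Real.pi)) • ContinuousLinearMap.id ℝ ℝ)
          (-(V (t + y.1) (x + y.1 • (y.2 : E3)) * φ (t + y.1) (x + y.1 • (y.2 : E3))))‖ₑ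
        ∂((volume : Measure ℝ).prod sphereMeasure) := enorm_integral_le_lintegral_enorm _
    _ = ∫⁻ r in Icc 0 T, ∫⁻ w : S2, ‖((r / (4 * Real.pi)) • ContinuousLinearMap.id ℝ ℝ)
          (-(V (t + r) (x + r • (w : E3)) * φ (t + r) (x + r • (w : E3))))‖ₑ ∂sphereMeasure := by
        rw [← Measure.prod_restrict, Measure.restrict_univ, lintegral_prod]
        exact hc.enorm.measurable.aemeasurable
    _ ≤ ∫⁻ r in Icc 0 T, (Ioo 0 (T - t)).indicator (fun r => ENNReal.ofReal (S / (4 * Real.pi)) *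
          ∫⁻ w : S2, ENNReal.ofReal (r * V (t + r) (x + r • (w : E3))) ∂sphereMeasure) r := by
        refine setLIntegral_mono' measurableSet_Icc fun r hr => ?_
        by_cases hrm : r ∈ Ioo 0 (T - t)
        · rw [indicator_of_mem hrm, ← lintegral_const_mul' _ _ ENNReal.ofReal_ne_top]
          refine lintegral_mono fun w => ?_
          rw [← ofReal_norm, ← ENNReal.ofReal_mul (by positivity)]
          refine ENNReal.ofReal_le_ofReal ?_
          simp only [smul_apply, ContinuousLinearMap.id_apply, norm_smul, Real.norm_eq_abs,
            abs_neg, abs_mul]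
          have h1 := hS (t + r) ⟨by linarith [hrm.1], by linarith [hrm.2]⟩ (x + r • (w : E3))
          have h2 := hV0 (t + r) (x + r • (w : E3))
          have h3 : 0 ≤ r := hrm.1.le
          rw [abs_of_nonneg h2, abs_of_nonneg (show 0 ≤ r / (4 * Real.pi) by positivity)]
          calc r / (4 * Real.pi) * (V (t + r) (x + r • (w : E3)) * |φ (t + r) (x + r • (w : E3))|)
              ≤ r / (4 * Real.pi) * (V (t + r) (x + r • (w : E3)) * S) := by gcongr
            _ = _ := by ring
        · rw [indicator_of_notMem hrm, nonpos_iff_eq_zero]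
          refine lintegral_eq_zero_of_ae_eq_zero (Eventually.of_forall fun w => ?_)
          rcases hr.1.eq_or_lt with h0 | h0
          · simp [← h0]
          · have : T ≤ t + r := by
              by_contra h
              exact hrm ⟨h0, by linarith⟩
            simp [hφT (t + r) this]
    _ ≤ ∫⁻ r, (Ioo 0 (T - t)).indicator (fun r => ENNReal.ofReal (S / (4 * Real.pi)) *
          ∫⁻ w : S2, ENNReal.ofReal (r * V (t + r) (x + r • (w : E3))) ∂sphereMeasure) r :=
        setLIntegral_le_lintegral _ _
    _ = ENNReal.ofReal (S / (4 * Real.pi)) * conePotential V t x (T - t) := by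
        rw [lintegral_indicator measurableSet_Ioo,
          lintegral_const_mul' _ _ ENNReal.ofReal_ne_top, conePotential]
    _ ≤ ENNReal.ofReal (S / (4 * Real.pi)) * ENNReal.ofReal (2 * Real.pi) := by gcongr
    _ = ENNReal.ofReal (S / 2) := by
        rw [← ENNReal.ofReal_mul (by positivity)]
        congr 1
        field_simp
        norm_num

/-- The maximum principle for solutions of the dual problem with a potential that is small on
light cones. -/
theorem abs_dual_solution_le {B : ℝ} (hT : 0 ≤ T) (hbT : b ≤ T) {V F φ : ℝ → E3 → ℝ}
    (hV : Continuous fun z : ℝ × E3 => V z.1 z.2) (hF : Continuous fun z : ℝ × E3 => F z.1 z.2)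
    (hFB : ∀ t x, |F t x| ≤ B) (hV0 : ∀ t x, 0 ≤ V t x) (hφ : JointSmooth φ)
    (hφv : VanishesOutside b R φ)
    (hφeq : ∀ t, 0 ≤ t → ∀ x, φ t x = retarded T (fun t x => F t x - V t x * φ t x) t x)
    (hcone : ∀ t ∈ Icc 0 T, ∀ x, conePotential V t x (T - t) ≤ ENNReal.ofReal (2 * Real.pi)) :
    ∀ t ∈ Icc 0 T, ∀ x, |φ t x| ≤ 2 * (T ^ 2 * B) := by
  -- This bound may depend on `V` and is not part of the result; it makes the supremum finite, so
  -- that half of it can be absorbed.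
  obtain ⟨A, -, hA⟩ := hφ.exists_bound (R := R) (a := 0) (b := T) (m := 0)
    fun t ht x hx => hφv t x (Or.inr (by linarith [ht.1]))
  let s : Set ℝ := (fun z : ℝ × E3 => |φ z.1 z.2|) '' (Icc 0 T ×ˢ univ)
  have hbdd : BddAbove s := by
    refine ⟨A, ?_⟩
    rintro _ ⟨⟨t, x⟩, ⟨ht, -⟩, rfl⟩
    simpa using hA t ht x 0 le_rfl
  have hne : s.Nonempty := ⟨_, (0, 0), ⟨⟨le_rfl, hT⟩, mem_univ _⟩, rfl⟩
  have hle : ∀ t ∈ Icc 0 T, ∀ x, |φ t x| ≤ sSup s := fun t ht x =>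
    le_csSup hbdd ⟨(t, x), ⟨ht, mem_univ _⟩, rfl⟩
  have hstep : sSup s ≤ T ^ 2 * B + sSup s / 2 := by
    refine csSup_le hne ?_
    rintro _ ⟨⟨t, x⟩, ⟨ht, -⟩, rfl⟩
    simp only
    rw [hφeq t ht.1 x]
    simp only [sub_eq_add_neg]
    rw [retarded_add T hF (hV.mul hφ.continuous).neg]
    refine (abs_add_le _ _).trans (add_le_add (abs_retarded_le hT hFB t x) ?_)
    exact abs_retarded_mul_le hV hφ.continuous hV0 (fun s hs => hφv.eq_zero (hbT.trans hs))
      (fun s hs x => hle s ⟨ht.1.trans hs.1, hs.2⟩ x) ht.2 x (hcone t ht x)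
  intro t ht x
  linarith [hle t ht x]

end SupBound

/-! ### Spatial regularization of weakly continuous families -/

section Mollify

variable {X : Type} [TopologicalSpace X] {F : Type} [NormedAddCommGroup F] [NormedSpace ℝ F]

/-- A family of functions that is bounded in `L¹_loc` and continuous in the sense of
distributions. -/
structure WeaklyContinuous (f : X → E3 → ℝ) : Prop where
  locallyIntegrable : ∀ t, LocallyIntegrable (f t) volume
  bounded : ∀ r : ℝ, ∃ B : ℝ≥0∞, B ≠ ⊤ ∧ ∀ t, ∫⁻ z in Metric.closedBall (0 : E3) r, ‖f t z‖ₑ ≤ B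
  continuous : ∀ ψ : E3 → ℝ, IsTestFunction ψ → Continuous fun t => ∫ z, f t z * ψ z

/-- Convolution in space with a vector-valued test function. -/
noncomputable def spaceConv (f : X → E3 → ℝ) (Ψ : E3 → F) (t : X) (x : E3) : F :=
  ∫ z, f t z • Ψ (x - z)

theorem hasCompactSupport_comp_sub {A : Type} [Zero A] {Ψ : E3 → A} (hΨ : HasCompactSupport Ψ) (x : E3) :
    HasCompactSupport fun z => Ψ (x - z) :=
  hΨ.comp_homeomorph (Homeomorph.subLeft x)

theorem contDiff_comp_sub {Ψ : E3 → F} (hΨ : ContDiff ℝ ∞ Ψ) (x : E3) :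
    ContDiff ℝ ∞ fun z => Ψ (x - z) :=
  hΨ.comp (contDiff_const.sub contDiff_id)

variable {f : X → E3 → ℝ}

theorem WeaklyContinuous.integrable (hf : WeaklyContinuous f) {Ψ : E3 → F} (hΨ : Continuous Ψ)
    (hΨc : HasCompactSupport Ψ) (t : X) (x : E3) : Integrable fun z => f t z • Ψ (x - z) :=
  (hf.locallyIntegrable t).integrable_smul_right_of_hasCompactSupport (by fun_prop)
    (hasCompactSupport_comp_sub hΨc x)

theorem WeaklyContinuous.continuous_spaceConv_left [FiniteDimensional ℝ F]
    (hf : WeaklyContinuous f) {Ψ : E3 → F} (hΨ : ContDiff ℝ ∞ Ψ) (hΨc : HasCompactSupport Ψ)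
    (x : E3) : Continuous fun t => spaceConv f Ψ t x := by
  have : CompleteSpace F := FiniteDimensional.complete ℝ F
  let e := (Module.finBasis ℝ F).equivFunL
  rw [← e.toHomeomorph.comp_continuous_iff, continuous_pi_iff]
  intro i
  let l : F →L[ℝ] ℝ := (ContinuousLinearMap.proj (R := ℝ) (φ := fun _ => ℝ) i).comp (e : F →L[ℝ] _)
  have h1 : ∀ t, l (spaceConv f Ψ t x) = ∫ z, f t z * l (Ψ (x - z)) := by
    intro t
    rw [spaceConv, ← l.integral_comp_comm (hf.integrable hΨ.continuous hΨc t x)]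
    simp
  have h2 := hf.continuous (fun z => l (Ψ (x - z))) ⟨l.contDiff.comp (contDiff_comp_sub hΨ x),
    (hasCompactSupport_comp_sub hΨc x).comp_left (map_zero l)⟩
  simp only [← h1] at h2
  exact h2

/-- Weak continuity handles `t` at fixed `x`; the local `L¹` bound, uniform in `t`, together with
uniform continuity of `Ψ` makes the family equicontinuous in `x`. Joint continuity follows. -/
theorem WeaklyContinuous.continuous_spaceConv [FiniteDimensional ℝ F]
    (hf : WeaklyContinuous f) {Ψ : E3 → F} (hΨ : ContDiff ℝ ∞ Ψ) (hΨc : HasCompactSupport Ψ) :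
    Continuous fun z : X × E3 => spaceConv f Ψ z.1 z.2 := by
  have : CompleteSpace F := FiniteDimensional.complete ℝ F
  rw [continuous_iff_continuousAt]
  rintro ⟨t₀, x₀⟩
  obtain ⟨r, hr⟩ := hΨc.isCompact.isBounded.subset_closedBall (0 : E3)
  obtain ⟨B, hB, hfB⟩ := hf.bounded (‖x₀‖ + 1 + r)
  refine Metric.tendsto_nhds.2 fun ε hε => ?_
  have hη : 0 < ε / (2 * (B.toReal + 1)) := by positivity
  obtain ⟨δ, hδ, hΨδ⟩ := Metric.uniformContinuous_iff.1
    (hΨc.uniformContinuous_of_continuous hΨ.continuous) _ hη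
  have e1 : ∀ᶠ t in nhds t₀, dist (spaceConv f Ψ t x₀) (spaceConv f Ψ t₀ x₀) < ε / 2 :=
    Metric.tendsto_nhds.1 (hf.continuous_spaceConv_left hΨ hΨc x₀).continuousAt _ (by positivity)
  have e2 : ∀ᶠ x in nhds x₀, dist x x₀ < min δ 1 :=
    Metric.ball_mem_nhds x₀ (lt_min hδ one_pos)
  rw [nhds_prod_eq]
  filter_upwards [(e1.prod_inl _).and (e2.prod_inr _)] with z hz
  obtain ⟨t, x⟩ := z
  obtain ⟨h1, h2⟩ := hz
  simp only at h1 h2 ⊢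
  have h3 : dist (spaceConv f Ψ t x) (spaceConv f Ψ t x₀) ≤ ε / 2 := by
    rw [dist_eq_norm, spaceConv, spaceConv, ← integral_sub (hf.integrable hΨ.continuous hΨc t x)
      (hf.integrable hΨ.continuous hΨc t x₀), ← ENNReal.ofReal_le_ofReal_iff (by positivity),
      ofReal_norm]
    have hx1 : ‖x‖ ≤ ‖x₀‖ + 1 := by
      have := norm_le_norm_add_norm_sub' x x₀
      rw [← dist_eq_norm] at this
      linarith [h2.trans_le (min_le_right _ _)]
    have hzero : ∀ y : E3, ‖y‖ ≤ ‖x₀‖ + 1 → ∀ z ∉ Metric.closedBall (0 : E3) (‖x₀‖ + 1 + r),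
        Ψ (y - z) = 0 := by
      intro y hy z hz
      by_contra hne
      have h4 := hr (subset_tsupport _ (Function.mem_support.2 hne))
      rw [mem_closedBall_zero_iff] at h4 hz
      have h5 := norm_sub_norm_le z y
      rw [norm_sub_rev] at h5
      linarith
    calc ‖∫ z, (f t z • Ψ (x - z) - f t z • Ψ (x₀ - z))‖ₑ
        ≤ ∫⁻ z, ‖f t z • Ψ (x - z) - f t z • Ψ (x₀ - z)‖ₑ := enorm_integral_le_lintegral_enorm _
      _ ≤ ∫⁻ z, (Metric.closedBall (0 : E3) (‖x₀‖ + 1 + r)).indicator (fun z =>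
            ENNReal.ofReal (ε / (2 * (B.toReal + 1))) * ‖f t z‖ₑ) z := by
          refine lintegral_mono fun z => ?_
          by_cases hz : z ∈ Metric.closedBall (0 : E3) (‖x₀‖ + 1 + r)
          · rw [indicator_of_mem hz, ← smul_sub, enorm_smul, mul_comm]
            gcongr
            rw [← ofReal_norm, ← dist_eq_norm]
            refine ENNReal.ofReal_le_ofReal (hΨδ ?_).le
            rw [dist_sub_right]
            exact h2.trans_le (min_le_left _ _)
          · rw [hzero x hx1 z hz, hzero x₀ (by linarith) z hz]
            simp
      _ = ENNReal.ofReal (ε / (2 * (B.toReal + 1))) *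
            ∫⁻ z in Metric.closedBall (0 : E3) (‖x₀‖ + 1 + r), ‖f t z‖ₑ := by
          rw [lintegral_indicator Metric.isClosed_closedBall.measurableSet,
            lintegral_const_mul' _ _ ENNReal.ofReal_ne_top]
      _ ≤ ENNReal.ofReal (ε / (2 * (B.toReal + 1))) * ENNReal.ofReal (B.toReal + 1) := by
          gcongr
          refine (hfB t).trans ?_
          rw [ENNReal.le_ofReal_iff_toReal_le hB (by positivity)]
          linarith
      _ = ENNReal.ofReal (ε / 2) := by
          rw [← ENNReal.ofReal_mul hη.le]
          congr 1
          field_simp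
  linarith [dist_triangle (spaceConv f Ψ t x) (spaceConv f Ψ t x₀) (spaceConv f Ψ t₀ x₀)]

theorem WeaklyContinuous.hasFDerivAt_spaceConv (hf : WeaklyContinuous f) {Ψ : E3 → F}
    (hΨ : ContDiff ℝ ∞ Ψ) (hΨc : HasCompactSupport Ψ) (t : X) (x : E3) :
    HasFDerivAt (spaceConv f Ψ t) (spaceConv f (fderiv ℝ Ψ) t x) x :=
  hΨc.hasFDerivAt_convolution_right (ContinuousLinearMap.lsmul ℝ ℝ : ℝ →L[ℝ] F →L[ℝ] F)
    (hf.locallyIntegrable t) (hΨ.of_le (by simp)) x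

/-- Space derivatives fall on the kernel, so convolutions with test functions valued in
finite-dimensional spaces form an invariant class. Finite dimension lets scalar weak continuity be
used coordinatewise. -/
theorem WeaklyContinuous.jointSmooth_spaceConv [FiniteDimensional ℝ F]
    (hf : WeaklyContinuous f) {Ψ : E3 → F} (hΨ : ContDiff ℝ ∞ Ψ) (hΨc : HasCompactSupport Ψ) :
    JointSmooth (spaceConv f Ψ) := by
  refine JointSmooth.of_invariant (fun G _ _ h => FiniteDimensional ℝ G ∧ ∃ Ψ : E3 → G,
    ContDiff ℝ ∞ Ψ ∧ HasCompactSupport Ψ ∧ h = spaceConv f Ψ) ?_ ⟨inferInstance, Ψ, hΨ, hΨc, rfl⟩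
  rintro G _ _ h ⟨hG, Ψ, hΨ, hΨc, rfl⟩
  refine ⟨hf.continuous_spaceConv hΨ hΨc, fun t x =>
    (hf.hasFDerivAt_spaceConv hΨ hΨc t x).differentiableAt, inferInstance, fderiv ℝ Ψ,
    hΨ.fderiv_right (by simp), hΨc.fderiv ℝ, ?_⟩
  funext t x
  exact (hf.hasFDerivAt_spaceConv hΨ hΨc t x).fderiv

/-- The rescaled mollifier. -/
noncomputable def scaledMollifier (ρ : E3 → ℝ) (n : ℕ) (y : E3) : ℝ :=
  (n : ℝ) ^ 3 * ρ ((n : ℝ) • y)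

theorem contDiff_scaledMollifier {ρ : E3 → ℝ} (hρ : IsMollifier ρ) (n : ℕ) :
    ContDiff ℝ ∞ (scaledMollifier ρ n) :=
  contDiff_const.mul (hρ.contDiff.comp (contDiff_id.const_smul (n : ℝ)))

theorem hasCompactSupport_scaledMollifier {ρ : E3 → ℝ} (hρ : IsMollifier ρ) {n : ℕ}
    (hn : 1 ≤ n) : HasCompactSupport (scaledMollifier ρ n) := by
  have hn' : (n : ℝ) ≠ 0 := by positivity
  exact (hρ.hasCompactSupport.comp_smul hn').mul_left

theorem mollify_eq_spaceConv (ρ : E3 → ℝ) (n : ℕ) (u : ℝ → E3 → ℝ) (t : ℝ) (x : E3) :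
    mollify ρ n u t x = spaceConv u (scaledMollifier ρ n) t x := rfl

end Mollify

/-! ### Regularity of mollified energy-class functions. -/

section EnergyClass

variable {u : ℝ → E3 → ℝ} {Du : ℝ → E3 → E3} {ut : ℝ → E3 → ℝ}

theorem lintegral_energy_lt_top {t : ℝ} (hu : MemLp (u t) 6 volume) (hDu : MemLp (Du t) 2 volume)
    (hut : MemLp (ut t) 2 volume) :
    ∫⁻ x, ENNReal.ofReal ((‖Du t x‖ ^ 2 + ut t x ^ 2) / 2 + u t x ^ 6 / 6) < ⊤ := by
  refine Integrable.lintegral_lt_top ?_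
  have h1 : Integrable (fun x => ‖u t x‖ ^ 6) := MemLp.integrable_norm_pow (p := 6) hu (by simp)
  have h2 : Integrable (fun x => ‖Du t x‖ ^ 2) := MemLp.integrable_norm_pow (p := 2) hDu (by simp)
  have h3 : Integrable (fun x => ‖ut t x‖ ^ 2) := MemLp.integrable_norm_pow (p := 2) hut (by simp)
  refine (((h2.add h3).div_const 2).add (h1.div_const 6)).congr
    (Eventually.of_forall fun x => ?_)
  simp only [Pi.add_apply, Real.norm_eq_abs, sq_abs]
  rw [show |u t x| ^ 6 = u t x ^ 6 from Even.pow_abs (by decide) _]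

theorem weaklyContinuous_ut (hE : IsEnergyClass u Du ut) :
    WeaklyContinuous fun t : Ici (0 : ℝ) => ut t := by
  refine ⟨fun t => (hE.memLp_ut t t.2).locallyIntegrable (by norm_num), fun r => ?_,
    fun ψ hψ => continuousOn_iff_continuous_domRestrict.1 (hE.continuous_ut ψ hψ)⟩
  obtain ⟨M, hM⟩ := hE.bounded
  refine ⟨volume (Metric.closedBall (0 : E3) r) + ENNReal.ofReal M ^ 2,
    ENNReal.add_ne_top.2 ⟨measure_closedBall_lt_top.ne, by finiteness⟩, fun t => ?_⟩
  have h1 : ∫⁻ z, ‖ut t z‖ₑ ^ 2 ≤ ENNReal.ofReal M ^ 2 := by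
    have h2 := eLpNorm_nnreal_pow_eq_lintegral (f := ut t) (μ := volume) (p := 2) two_ne_zero
    have h3 := (hM t t.2).2
    simp only [NNReal.coe_ofNat, ENNReal.rpow_ofNat, ENNReal.coe_ofNat] at h2
    rw [← h2]
    gcongr
  calc ∫⁻ z in Metric.closedBall (0 : E3) r, ‖ut t z‖ₑ
      ≤ ∫⁻ z in Metric.closedBall (0 : E3) r, (1 + ‖ut t z‖ₑ ^ 2) := by
        refine lintegral_mono fun z => ?_
        rcases le_total ‖ut t z‖ₑ 1 with h | h
        · exact h.trans le_self_add
        · exact (le_self_pow₀ h two_ne_zero).trans le_add_self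
    _ = volume (Metric.closedBall (0 : E3) r) +
          ∫⁻ z in Metric.closedBall (0 : E3) r, ‖ut t z‖ₑ ^ 2 := by
        rw [lintegral_add_left measurable_const, setLIntegral_one]
    _ ≤ _ := by
        gcongr
        exact (setLIntegral_le_lintegral _ _).trans h1

/-- `IsEnergyClass` bounds `Du` and `ut` uniformly in time, but not `u`. The missing local bound
comes from `|u| ≤ 1 + u⁶` and the backward energy inequality started at time zero. -/
theorem weaklyContinuous_u (hE : IsEnergyClass u Du ut) {C α : ℝ}
    (hb : ∀ (x₀ : E3) (s t t₀ : ℝ), 0 ≤ s → s ≤ t → t ≤ t₀ → localEnergy u Du ut t x₀ (t₀ - t) ≤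
      ENNReal.ofReal C * localEnergy u Du ut s x₀ (α * (t₀ - s))) :
    WeaklyContinuous fun t : Ici (0 : ℝ) => u t := by
  refine ⟨fun t => (hE.memLp_u t t.2).locallyIntegrable (by norm_num), fun r => ?_,
    fun ψ hψ => continuousOn_iff_continuous_domRestrict.1
      fun t ht => (hE.hasDeriv ψ hψ t ht).continuousWithinAt⟩
  have hE0 := lintegral_energy_lt_top (hE.memLp_u 0 le_rfl) (hE.memLp_Du 0 le_rfl)
    (hE.memLp_ut 0 le_rfl)
  set E₀ := ∫⁻ x, ENNReal.ofReal ((‖Du 0 x‖ ^ 2 + ut 0 x ^ 2) / 2 + u 0 x ^ 6 / 6)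
  refine ⟨volume (Metric.closedBall (0 : E3) r) + 6 * (ENNReal.ofReal C * E₀),
    by finiteness [measure_closedBall_lt_top (μ := (volume : Measure E3)) (x := 0) (r := r)],
    fun t => ?_⟩
  have h1 : localEnergy u Du ut t 0 (|r| + 1) ≤ ENNReal.ofReal C * E₀ := by
    have := hb 0 0 t (t + (|r| + 1)) le_rfl t.2 (by linarith [abs_nonneg r])
    rw [add_sub_cancel_left] at this
    refine this.trans ?_
    gcongr
    exact setLIntegral_le_lintegral _ _
  calc ∫⁻ z in Metric.closedBall (0 : E3) r, ‖u t z‖ₑ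
      ≤ ∫⁻ z in Metric.closedBall (0 : E3) r, (1 + 6 *
          ENNReal.ofReal ((‖Du t z‖ ^ 2 + ut t z ^ 2) / 2 + u t z ^ 6 / 6)) := by
        refine lintegral_mono fun z => ?_
        rw [← ofReal_norm, Real.norm_eq_abs, ← ENNReal.ofReal_one,
          show (6 : ℝ≥0∞) = ENNReal.ofReal 6 by simp, ← ENNReal.ofReal_mul (by norm_num),
          ← ENNReal.ofReal_add (by norm_num) (by positivity)]
        refine ENNReal.ofReal_le_ofReal ?_
        have h2 : |u t z| ≤ 1 + u t z ^ 6 := by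
          rw [show u t z ^ 6 = |u t z| ^ 6 from (Even.pow_abs (by decide) _).symm]
          rcases le_total |u t z| 1 with h | h
          · linarith [pow_nonneg (abs_nonneg (u t z)) 6]
          · linarith [le_self_pow₀ h (show 6 ≠ 0 by norm_num)]
        nlinarith [sq_nonneg ‖Du t z‖, sq_nonneg (ut t z)]
    _ = volume (Metric.closedBall (0 : E3) r) + 6 * ∫⁻ z in Metric.closedBall (0 : E3) r,
          ENNReal.ofReal ((‖Du t z‖ ^ 2 + ut t z ^ 2) / 2 + u t z ^ 6 / 6) := by
        rw [lintegral_add_left measurable_const, setLIntegral_one, lintegral_const_mul']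
        simp
    _ ≤ _ := by
        gcongr
        refine le_trans ?_ h1
        refine lintegral_mono_set (Metric.closedBall_subset_ball ?_)
        linarith [le_abs_self r]

theorem jointSmooth_mollify {ρ : E3 → ℝ} (hρ : IsMollifier ρ) {n : ℕ} (hn : 1 ≤ n)
    (hu : WeaklyContinuous fun t : Ici (0 : ℝ) => u t) :
    JointSmooth fun t : Ici (0 : ℝ) => mollify ρ n u t :=
  hu.jointSmooth_spaceConv (contDiff_scaledMollifier hρ n) (hasCompactSupport_scaledMollifier hρ hn)

/-- The distributional time derivative tested against the translated mollifier. Thus `u_n` is `C¹`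
in time, although weak continuity of `ut` gives no second derivative. -/
theorem hasDerivWithinAt_mollify {ρ : E3 → ℝ} (hρ : IsMollifier ρ) {n : ℕ} (hn : 1 ≤ n)
    (hE : IsEnergyClass u Du ut) {t : ℝ} (ht : 0 ≤ t) (x : E3) :
    HasDerivWithinAt (fun s => mollify ρ n u s x) (mollify ρ n ut t x) (Ici 0) t :=
  hE.hasDeriv (fun z => scaledMollifier ρ n (x - z))
    ⟨contDiff_comp_sub (contDiff_scaledMollifier hρ n) x,
      hasCompactSupport_comp_sub (hasCompactSupport_scaledMollifier hρ hn) x⟩ t ht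

theorem timeSmooth_mollify {ρ : E3 → ℝ} (hρ : IsMollifier ρ) {n : ℕ} (hn : 1 ≤ n)
    (hE : IsEnergyClass u Du ut) (hu : WeaklyContinuous fun t : Ici (0 : ℝ) => u t) (T : ℝ) :
    TimeSmooth T 1 (mollify ρ n u) := by
  have hτ : Continuous fun t : Icc 0 T => (⟨t, t.2.1⟩ : Ici (0 : ℝ)) := by fun_prop
  exact ⟨(jointSmooth_mollify hρ hn hu).comp_param hτ, mollify ρ n ut,
    (jointSmooth_mollify hρ hn (weaklyContinuous_ut hE)).comp_param hτ, fun t ht x =>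
      (hasDerivWithinAt_mollify hρ hn hE ht.1 x).mono Icc_subset_Ici_self⟩

end EnergyClass

/-! ### The flux through light cones controls the potential -/

section Polar

theorem lintegral_polar {h : E3 → ℝ≥0∞} (hh : Measurable h) :
    ∫⁻ y, h y = ∫⁻ w : S2, (∫⁻ r in Ioi (0 : ℝ), ENNReal.ofReal (r ^ 2) * h (r • (w : E3)))
      ∂sphereMeasure := by
  have hm : Measurable fun p : S2 × Ioi (0 : ℝ) => h ((p.2 : ℝ) • (p.1 : E3)) :=
    hh.comp (by fun_prop)
  calc ∫⁻ y, h y = ∫⁻ y : ({0}ᶜ : Set E3), h y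
          ∂(volume.comap ((↑) : ({0}ᶜ : Set E3) → E3)) := by
        rw [lintegral_subtype_comap (measurableSet_singleton _).compl, restrict_compl_singleton]
    _ = ∫⁻ p, h ((p.2 : ℝ) • (p.1 : E3)) ∂(sphereMeasure.prod
          (Measure.volumeIoiPow (Module.finrank ℝ E3 - 1))) := by
        rw [← ((volume : Measure E3).measurePreserving_homeomorphUnitSphereProd).lintegral_comp hm]
        refine lintegral_congr fun y => ?_
        have hy : ‖(y : E3)‖ ≠ 0 := norm_ne_zero_iff.2 y.2
        simp [smul_smul, mul_inv_cancel₀ hy]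
    _ = ∫⁻ w : S2, (∫⁻ r, h ((r : ℝ) • (w : E3))
          ∂(Measure.volumeIoiPow (Module.finrank ℝ E3 - 1))) ∂sphereMeasure :=
        lintegral_prod _ hm.aemeasurable
    _ = _ := by
        refine lintegral_congr fun w => ?_
        have hm' : Measurable fun r : Ioi (0 : ℝ) => h ((r : ℝ) • (w : E3)) :=
          hh.comp (by fun_prop)
        rw [Measure.volumeIoiPow, lintegral_withDensity_eq_lintegral_mul _ (by fun_prop) hm']
        simp only [Pi.mul_apply, finrank_euclideanSpace, Fintype.card_fin]
        exact lintegral_subtype_comap measurableSet_Ioi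
          fun r : ℝ => ENNReal.ofReal (r ^ 2) * h (r • (w : E3))

theorem setLIntegral_ball_polar {h : E3 → ℝ≥0∞} (hh : Measurable h) (R : ℝ) :
    ∫⁻ y in Metric.ball 0 R, h y =
      ∫⁻ w : S2, (∫⁻ r in Ioo 0 R, ENNReal.ofReal (r ^ 2) * h (r • (w : E3))) ∂sphereMeasure := by
  rw [← lintegral_indicator measurableSet_ball, lintegral_polar (hh.indicator measurableSet_ball)]
  refine lintegral_congr fun w => ?_
  rw [← lintegral_indicator measurableSet_Ioi, ← lintegral_indicator measurableSet_Ioo]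
  refine lintegral_congr fun r => ?_
  by_cases hr : 0 < r
  · have hn : ‖r • (w : E3)‖ = r := by simp [norm_smul, abs_of_pos hr]
    by_cases hR : r < R
    · rw [indicator_of_mem (show r ∈ Ioi 0 from hr), indicator_of_mem (show r ∈ Ioo 0 R from ⟨hr, hR⟩),
        indicator_of_mem (by simpa [hn] using hR)]
    · rw [indicator_of_mem (show r ∈ Ioi 0 from hr),
        indicator_of_notMem (fun h : r ∈ Ioo 0 R => hR h.2),
        indicator_of_notMem (by simpa [hn] using hR), mul_zero]
  · rw [indicator_of_notMem (show r ∉ Ioi 0 from hr),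
      indicator_of_notMem (fun h : r ∈ Ioo 0 R => hr h.1)]

end Polar

/-! ### The inequality on a single light ray. -/

section Ray

/-- A one-dimensional Hardy-type inequality. -/
theorem integral_mul_pow_four_le {R : ℝ} (hR : 0 < R) {g g' : ℝ → ℝ} (hg : Continuous g)
    (hg' : Continuous g') (hd : ∀ r ∈ Ioo 0 (2 * R), HasDerivAt g (g' r) r) :
    ∫ r in (0 : ℝ)..R, r * g r ^ 4 ≤
      (∫ r in (0 : ℝ)..(2 * R), r ^ 2 * (7 * g r ^ 6 + 2 * g' r ^ 2)) + 1 / 75 := by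
  have hR2 : (0 : ℝ) ≤ 2 * R := by positivity
  let H' : ℝ → ℝ := fun r => r * (1 - r / (2 * R)) * g r ^ 4 - r ^ 2 / (4 * R) * g r ^ 4 +
    2 * r ^ 2 * (1 - r / (2 * R)) * g r ^ 3 * g' r
  -- The primitive `r² / 2 * (1 - r / (2R)) * g⁴` vanishes at both ends. The linear cutoff removes
  -- the boundary term and is at least `1 / 2` on `[0, R]`, hence the doubled interval.
  have h0 : ∫ r in (0 : ℝ)..(2 * R), H' r = 0 := by
    rw [intervalIntegral.integral_eq_sub_of_hasDerivAt_of_le hR2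
      (f := fun r => r ^ 2 / 2 * (1 - r / (2 * R)) * g r ^ 4)]
    · field_simp
      ring
    · exact Continuous.continuousOn (by fun_prop)
    · intro r hr
      have h1 : HasDerivAt (fun r : ℝ => r ^ 2 / 2) r r := by
        simpa using (hasDerivAt_pow 2 r).div_const 2
      have h2 : HasDerivAt (fun r : ℝ => 1 - r / (2 * R)) (-(1 / (2 * R))) r := by
        simpa using ((hasDerivAt_id r).div_const (2 * R)).const_sub 1
      refine ((h1.mul h2).mul ((hd r hr).pow 4)).congr_deriv ?_
      simp only [H', Pi.pow_apply, Pi.mul_apply]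
      field_simp
      push_cast
      ring
    · exact Continuous.intervalIntegrable (by fun_prop) _ _
  have hi : ∀ {f : ℝ → ℝ}, Continuous f → ∀ a b, IntervalIntegrable f volume a b :=
    fun hf a b => hf.intervalIntegrable a b
  have h1 : ∫ r in (0 : ℝ)..R, r * g r ^ 4 ≤
      ∫ r in (0 : ℝ)..(2 * R), 2 * (r * (1 - r / (2 * R)) * g r ^ 4) := by
    have hsplit := intervalIntegral.integral_add_adjacent_intervals (a := 0) (b := R) (c := 2 * R)
      (μ := volume) (f := fun r => 2 * (r * (1 - r / (2 * R)) * g r ^ 4)) (hi (by fun_prop) _ _)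
      (hi (by fun_prop) _ _)
    have h2 : ∫ r in (0 : ℝ)..R, r * g r ^ 4 ≤
        ∫ r in (0 : ℝ)..R, 2 * (r * (1 - r / (2 * R)) * g r ^ 4) := by
      refine intervalIntegral.integral_mono_on hR.le (hi (by fun_prop) _ _) (hi (by fun_prop) _ _)
        fun r hr => ?_
      have h3 : r / (2 * R) ≤ 1 / 2 := by
        rw [div_le_div_iff₀ (by positivity) (by norm_num)]
        linarith [hr.2]
      have h4 : 0 ≤ r * g r ^ 4 := mul_nonneg hr.1 (by positivity)
      nlinarith
    have h5 : 0 ≤ ∫ r in R..(2 * R), 2 * (r * (1 - r / (2 * R)) * g r ^ 4) := by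
      refine intervalIntegral.integral_nonneg (by linarith) fun r hr => ?_
      have h3 : r / (2 * R) ≤ 1 := by
        rw [div_le_one (by positivity)]
        exact hr.2
      have : 0 ≤ r := hR.le.trans hr.1
      have : 0 ≤ 1 - r / (2 * R) := by linarith
      positivity
    linarith
  -- Subtracting `2 H'`, whose integral is zero, leaves `r²` times `g⁴ / (2R) - 4 η g³ g'`, which
  -- Young's inequality handles pointwise.
  have h2 : ∫ r in (0 : ℝ)..(2 * R), (2 * (r * (1 - r / (2 * R)) * g r ^ 4) - 2 * H' r) ≤
      ∫ r in (0 : ℝ)..(2 * R), (r ^ 2 * (7 * g r ^ 6 + 2 * g' r ^ 2) + r ^ 2 / (25 * (2 * R) ^ 3)) := by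
    refine intervalIntegral.integral_mono_on hR2 (hi (by fun_prop) _ _) (hi (by fun_prop) _ _)
      fun r hr => ?_
    have hη0 : 0 ≤ 1 - r / (2 * R) := by
      rw [sub_nonneg, div_le_one (by positivity)]
      exact hr.2
    have hη1 : 1 - r / (2 * R) ≤ 1 := by
      have := div_nonneg hr.1 hR2
      linarith
    set η := 1 - r / (2 * R)
    have e1 : -(4 * η * (g r ^ 3 * g' r)) ≤ 2 * g r ^ 6 + 2 * g' r ^ 2 := by
      have e2 : |g r ^ 3 * g' r| * 2 ≤ g r ^ 6 + g' r ^ 2 := by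
        rw [abs_mul]
        nlinarith [sq_nonneg (|g r ^ 3| - |g' r|), sq_abs (g r ^ 3), sq_abs (g' r)]
      have e3 : η * |g r ^ 3 * g' r| ≤ |g r ^ 3 * g' r| :=
        mul_le_of_le_one_left (abs_nonneg _) hη1
      have e4 : η * -(g r ^ 3 * g' r) ≤ η * |g r ^ 3 * g' r| :=
        mul_le_mul_of_nonneg_left (neg_le_abs _) hη0
      linarith
    -- This is `s² ≤ s³ + 1` for `s = 5 (2R) g²`. The factor `5` makes the remainder small: it
    -- integrates against `r²` to `1 / 75` for every `R`, and `5 + 2` gives the coefficient `7`.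
    have e5 : g r ^ 4 / (2 * R) ≤ 5 * g r ^ 6 + 1 / (25 * (2 * R) ^ 3) := by
      have hs : 0 ≤ 5 * (2 * R) * g r ^ 2 := by positivity
      have e6 : (5 * (2 * R) * g r ^ 2) ^ 2 ≤ (5 * (2 * R) * g r ^ 2) ^ 3 + 1 := by
        set s := 5 * (2 * R) * g r ^ 2
        rcases le_total s 1 with h | h
        · nlinarith [pow_nonneg hs 3, pow_le_one₀ (n := 2) hs h]
        · nlinarith [pow_le_pow_right₀ h (show 2 ≤ 3 by norm_num)]
      have e7 : 0 < 25 * (2 * R) ^ 3 := by positivity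
      rw [← sub_nonneg]
      have : 5 * g r ^ 6 + 1 / (25 * (2 * R) ^ 3) - g r ^ 4 / (2 * R) =
          ((5 * (2 * R) * g r ^ 2) ^ 3 + 1 - (5 * (2 * R) * g r ^ 2) ^ 2) /
            (25 * (2 * R) ^ 3) := by
        field_simp
        ring
      rw [this]
      exact div_nonneg (by linarith) e7.le
    have e8 : 2 * (r * η * g r ^ 4) - 2 * H' r =
        r ^ 2 * (g r ^ 4 / (2 * R) - 4 * η * (g r ^ 3 * g' r)) := by
      have hH : H' r = r * η * g r ^ 4 - r ^ 2 / (4 * R) * g r ^ 4 +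
        2 * r ^ 2 * η * g r ^ 3 * g' r := rfl
      rw [hH]
      ring
    have e9 : r ^ 2 * (7 * g r ^ 6 + 2 * g' r ^ 2) + r ^ 2 / (25 * (2 * R) ^ 3) =
        r ^ 2 * (7 * g r ^ 6 + 2 * g' r ^ 2 + 1 / (25 * (2 * R) ^ 3)) := by ring
    rw [e8, e9]
    refine mul_le_mul_of_nonneg_left ?_ (sq_nonneg r)
    linarith
  rw [intervalIntegral.integral_sub (hi (by fun_prop) _ _) (hi (by fun_prop) _ _),
    intervalIntegral.integral_const_mul 2 H', h0,
    intervalIntegral.integral_add (hi (by fun_prop) _ _) (hi (by fun_prop) _ _),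
    intervalIntegral.integral_div, integral_pow] at h2
  have h3 : ((2 * R) ^ (2 + 1) - 0 ^ (2 + 1)) / ((2 : ℕ) + 1 : ℝ) / (25 * (2 * R) ^ 3) = 1 / 75 := by
    field_simp
    norm_num
    ring
  rw [h3] at h2
  linarith

theorem lintegral_mul_pow_four_le {R : ℝ} (hR : 0 < R) {g g' : ℝ → ℝ} (hg : Continuous g)
    (hg' : Continuous g') (hd : ∀ r ∈ Ioo 0 (2 * R), HasDerivAt g (g' r) r) :
    ∫⁻ r in Ioo 0 R, ENNReal.ofReal (r * g r ^ 4) ≤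
      (∫⁻ r in Ioo 0 (2 * R), ENNReal.ofReal (r ^ 2 * (7 * g r ^ 6 + 2 * g' r ^ 2))) +
        ENNReal.ofReal (1 / 75) := by
  have h := integral_mul_pow_four_le hR hg hg' hd
  have key : ∀ {f : ℝ → ℝ} {a : ℝ}, 0 ≤ a → Continuous f → (∀ r ∈ Ioo 0 a, 0 ≤ f r) →
      ENNReal.ofReal (∫ r in (0 : ℝ)..a, f r) = ∫⁻ r in Ioo 0 a, ENNReal.ofReal (f r) := by
    intro f a ha hf hf0
    rw [intervalIntegral.integral_of_le ha, integral_Ioc_eq_integral_Ioo,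
      ofReal_integral_eq_lintegral_ofReal]
    · exact hf.continuousOn.integrableOn_compact isCompact_Icc |>.mono_set Ioo_subset_Icc_self
    · filter_upwards [ae_restrict_mem measurableSet_Ioo] with r hr using hf0 r hr
  rw [← key hR.le (by fun_prop) fun r hr => mul_nonneg hr.1.le (by positivity),
    ← key (by positivity) (by fun_prop) fun r hr => by positivity,
    ← ENNReal.ofReal_add (intervalIntegral.integral_nonneg (by positivity) fun r hr => by positivity)
      (by norm_num)]
  exact ENNReal.ofReal_le_ofReal h

end Ray

/-! ### From light rays to the flux through a cone. -/

section ConeFlux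

variable {f f' : ℝ → E3 → ℝ}

theorem JointSmooth.clamp {F : Type} [NormedAddCommGroup F] [NormedSpace ℝ F] {f : ℝ → E3 → F}
    (hf : JointSmooth fun t : Ici (0 : ℝ) => f t) : JointSmooth fun t : ℝ => f (max t 0) :=
  hf.comp_param (τ := fun t : ℝ => (⟨max t 0, le_max_right t 0⟩ : Ici (0 : ℝ))) (by fun_prop)

/-- Jointly continuous partial derivatives give the total derivative at positive times, which is
needed to differentiate along the cone, where time and space vary together. -/
theorem hasFDerivAt_uncurry (hf : JointSmooth fun t : Ici (0 : ℝ) => f t)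
    (hf' : JointSmooth fun t : Ici (0 : ℝ) => f' t)
    (hd : ∀ t, 0 ≤ t → ∀ x, HasDerivWithinAt (fun s => f s x) (f' t x) (Ici 0) t) {t : ℝ}
    (ht : 0 < t) (x : E3) :
    HasFDerivAt (fun z : ℝ × E3 => f z.1 z.2)
      ((ContinuousLinearMap.toSpanSingleton ℝ (f' t x)).coprod (fderiv ℝ (f t) x)) (t, x) := by
  have hpos : ∀ᶠ z : ℝ × E3 in nhds (t, x), 0 < z.1 :=
    (isOpen_lt continuous_const continuous_fst).mem_nhds ht
  let f₁ : ℝ → E3 → ℝ →L[ℝ] ℝ := fun t x => ContinuousLinearMap.toSpanSingleton ℝ (f' t x)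
  let f₂ : ℝ → E3 → E3 →L[ℝ] ℝ := fun t x => fderiv ℝ (f t) x
  have c1 : ContinuousAt (Function.uncurry f₁) (t, x) := by
    have : Continuous fun z : ℝ × E3 =>
        ContinuousLinearMap.toSpanSingletonCLE (𝕜 := ℝ) (E := ℝ) (f' (max z.1 0) z.2) :=
      ContinuousLinearEquiv.continuous _ |>.comp hf'.clamp.continuous
    refine this.continuousAt.congr ?_
    filter_upwards [hpos] with z hz
    rw [max_eq_left hz.le]
    rfl
  have c2 : ContinuousAt (Function.uncurry f₂) (t, x) := by
    refine hf.clamp.fderiv.continuous.continuousAt.congr ?_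
    filter_upwards [hpos] with z hz
    rw [max_eq_left hz.le]
    rfl
  refine (hasStrictFDerivAt_uncurry_coprod (u := (t, x)) (f := f) (f₁ := f₁) (f₂ := f₂)
    ?_ ?_ c1 c2).hasFDerivAt
  · filter_upwards [hpos] with z hz
    exact ((hd z.1 hz.le z.2).hasDerivAt (Ici_mem_nhds hz)).hasFDerivAt
  · filter_upwards [hpos] with z hz
    exact (hf.differentiable ⟨z.1, hz.le⟩ z.2).hasFDerivAt

theorem hasDerivAt_ray (hf : JointSmooth fun t : Ici (0 : ℝ) => f t)
    (hf' : JointSmooth fun t : Ici (0 : ℝ) => f' t)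
    (hd : ∀ t, 0 ≤ t → ∀ x, HasDerivWithinAt (fun s => f s x) (f' t x) (Ici 0) t) {t r : ℝ}
    (ht : 0 < t + r) (x w : E3) :
    HasDerivAt (fun r => f (t + r) (x + r • w))
      (f' (t + r) (x + r • w) + fderiv ℝ (f (t + r)) (x + r • w) w) r := by
  have h1 : HasDerivAt (fun r : ℝ => (t + r, x + r • w)) (1, w) r := by
    have h2 : HasDerivAt (fun r : ℝ => x + r • w) w r := by
      simpa using ((hasDerivAt_id r).smul_const w).const_add x
    exact ((hasDerivAt_id r).const_add t).prodMk h2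
  refine (HasFDerivAt.comp_hasDerivAt (f := fun r : ℝ => (t + r, x + r • w)) r
    (hasFDerivAt_uncurry hf hf' hd ht (x + r • w)) h1).congr_deriv ?_
  simp

/-- The derivative along a ray is the differential of the cone parametrization in a unit direction,
hence one of the tangential derivatives in the flux. The vertex is excluded, the norm not being
differentiable there. -/
theorem abs_ray_deriv_le (hf : JointSmooth fun t : Ici (0 : ℝ) => f t)
    (hf' : JointSmooth fun t : Ici (0 : ℝ) => f' t)
    (hd : ∀ t, 0 ≤ t → ∀ x, HasDerivWithinAt (fun s => f s x) (f' t x) (Ici 0) t) {t r : ℝ}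
    (ht : 0 ≤ t) (hr : 0 < r) (x : E3) (w : S2) :
    |f' (t + r) (x + r • (w : E3)) + fderiv ℝ (f (t + r)) (x + r • (w : E3)) w| ≤
      ‖fderiv ℝ (fun y : E3 => f (t + ‖y‖) (x + y)) (r • (w : E3))‖ := by
  have hn : ∀ s : ℝ, 0 < s → ‖s • (w : E3)‖ = s := fun s hs => by
    simp [norm_smul, abs_of_pos hs]
  have hne : r • (w : E3) ≠ 0 := by
    rw [← norm_ne_zero_iff, hn r hr]
    exact hr.ne'
  have hW : DifferentiableAt ℝ (fun y : E3 => f (t + ‖y‖) (x + y)) (r • (w : E3)) := by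
    have h1 : DifferentiableAt ℝ (fun y : E3 => (t + ‖y‖, x + y)) (r • (w : E3)) :=
      ((differentiableAt_id.norm ℝ hne).const_add t).prodMk (differentiableAt_id.const_add x)
    have h2 := (hasFDerivAt_uncurry hf hf' hd (t := t + ‖r • (w : E3)‖)
      (by rw [hn r hr]; linarith) (x + r • (w : E3))).differentiableAt
    exact DifferentiableAt.comp (g := fun z : ℝ × E3 => f z.1 z.2) (r • (w : E3)) h2 h1
  have h3 : HasDerivAt (fun s : ℝ => s • (w : E3)) (w : E3) r := by
    simpa using (hasDerivAt_id r).smul_const (w : E3)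
  have h4 := hW.hasFDerivAt.comp_hasDerivAt r h3
  have h5 := hasDerivAt_ray hf hf' hd (t := t) (r := r) (by linarith) x w
  have h6 : (fun r => f (t + r) (x + r • (w : E3))) =ᶠ[nhds r]
      (fun y : E3 => f (t + ‖y‖) (x + y)) ∘ fun s : ℝ => s • (w : E3) := by
    filter_upwards [Ioi_mem_nhds hr] with s hs
    simp only [Function.comp_apply]
    rw [hn s hs]
  rw [h5.unique (h4.congr_of_eventuallyEq h6), ← Real.norm_eq_abs]
  refine (ContinuousLinearMap.le_opNorm _ _).trans_eq ?_
  simp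

/-- The potential of `f⁴` on a light cone is controlled by the flux of `f`. -/
theorem conePotential_pow_four_le (hf : JointSmooth fun t : Ici (0 : ℝ) => f t)
    (hf' : JointSmooth fun t : Ici (0 : ℝ) => f' t)
    (hd : ∀ t, 0 ≤ t → ∀ x, HasDerivWithinAt (fun s => f s x) (f' t x) (Ici 0) t) {t R : ℝ}
    (ht : 0 ≤ t) (hR : 0 < R) (x : E3) :
    conePotential (fun t x => f t x ^ 4) t x R ≤
      42 * coneFlux f t x (t + 2 * R) + ENNReal.ofReal (4 * Real.pi / 75) := by
  let g : S2 → ℝ → ℝ := fun w r => f (max (t + r) 0) (x + r • (w : E3))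
  let g' : S2 → ℝ → ℝ := fun w r => f' (max (t + r) 0) (x + r • (w : E3)) +
    fderiv ℝ (f (max (t + r) 0)) (x + r • (w : E3)) w
  let e : E3 → ℝ≥0∞ := fun y => ENNReal.ofReal
    (‖fderiv ℝ (fun y' : E3 => f (t + ‖y'‖) (x + y')) y‖ ^ 2 / 2 + f (t + ‖y‖) (x + y) ^ 6 / 6)
  have hz : Continuous fun z : S2 × ℝ => (t + z.2, x + z.2 • (z.1 : E3)) := by fun_prop
  have hgc : Continuous fun z : S2 × ℝ => g z.1 z.2 := hf.clamp.continuous.comp hz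
  have hgc' : Continuous fun z : S2 × ℝ => g' z.1 z.2 :=
    (hf'.clamp.continuous.comp hz).add ((hf.clamp.fderiv.continuous.comp hz).clm_apply
      (continuous_subtype_val.comp continuous_fst))
  have hW : Continuous fun y : E3 => f (t + ‖y‖) (x + y) := by
    have h1 : Continuous fun y : E3 => (t + ‖y‖, x + y) := by fun_prop
    refine (hf.clamp.continuous.comp h1).congr fun y => ?_
    simp only [Function.comp_apply]
    rw [max_eq_left (by positivity)]
  have he : Measurable e := by
    have h1 := measurable_fderiv ℝ (fun y' : E3 => f (t + ‖y'‖) (x + y'))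
    exact (((h1.norm.pow_const 2).div_const 2).add
      ((hW.measurable.pow_const 6).div_const 6)).ennreal_ofReal
  have hray : ∀ w : S2, ∫⁻ r in Ioo 0 R, ENNReal.ofReal (r * g w r ^ 4) ≤
      42 * (∫⁻ r in Ioo 0 (2 * R), ENNReal.ofReal (r ^ 2) * e (r • (w : E3))) +
        ENNReal.ofReal (1 / 75) := by
    intro w
    refine (lintegral_mul_pow_four_le hR (g := g w) (g' := g' w) (hgc.comp (Continuous.prodMk_right w))
      (hgc'.comp (Continuous.prodMk_right w)) fun r hr => ?_).trans ?_
    · have hpos : 0 < t + r := by linarith [hr.1]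
      have h1 := hasDerivAt_ray hf hf' hd hpos x w
      simp only [g']
      rw [max_eq_left hpos.le]
      refine h1.congr_of_eventuallyEq ?_
      filter_upwards [Ioi_mem_nhds hr.1] with s hs
      have hs' : 0 < s := hs
      simp only [g]
      rw [max_eq_left (by linarith)]
    · gcongr
      rw [← lintegral_const_mul' _ _ (by simp)]
      refine setLIntegral_mono' measurableSet_Ioo fun r hr => ?_
      have hn : ‖r • (w : E3)‖ = r := by simp [norm_smul, abs_of_pos hr.1]
      rw [← ENNReal.ofReal_mul (by positivity), show (42 : ℝ≥0∞) = ENNReal.ofReal 42 by simp,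
        ← ENNReal.ofReal_mul (by norm_num)]
      refine ENNReal.ofReal_le_ofReal ?_
      have h1 := abs_ray_deriv_le hf hf' hd ht hr.1 x w
      simp only [g, g', hn]
      rw [max_eq_left (by linarith [hr.1])]
      have h2 := pow_le_pow_left₀ (abs_nonneg _) h1 2
      rw [sq_abs] at h2
      have h3 : (0 : ℝ) ≤ r ^ 2 := by positivity
      have h4 : (0 : ℝ) ≤
        ‖fderiv ℝ (fun y' : E3 => f (t + ‖y'‖) (x + y')) (r • (w : E3))‖ ^ 2 := by positivity
      calc _ ≤ r ^ 2 * (7 * f (t + r) (x + r • (w : E3)) ^ 6 + 2 *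
            ‖fderiv ℝ (fun y' : E3 => f (t + ‖y'‖) (x + y')) (r • (w : E3))‖ ^ 2) := by gcongr
        -- The coefficient `2` is enlarged to `21` so that both terms become `42` times the flux
        -- density: `7 = 42 / 6` and `21 = 42 / 2`.
        _ ≤ r ^ 2 * (7 * f (t + r) (x + r • (w : E3)) ^ 6 + 21 *
            ‖fderiv ℝ (fun y' : E3 => f (t + ‖y'‖) (x + y')) (r • (w : E3))‖ ^ 2) := by
          gcongr
          norm_num
        _ = _ := by ring
  calc conePotential (fun t x => f t x ^ 4) t x R
      = ∫⁻ r in Ioo 0 R, ∫⁻ w : S2, ENNReal.ofReal (r * g w r ^ 4) ∂sphereMeasure := by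
        refine setLIntegral_congr_fun measurableSet_Ioo fun r hr => ?_
        simp only [g]
        rw [max_eq_left (by linarith [hr.1])]
    _ = ∫⁻ w : S2, (∫⁻ r in Ioo 0 R, ENNReal.ofReal (r * g w r ^ 4)) ∂sphereMeasure := by
        refine lintegral_lintegral_swap ?_
        have : Continuous fun z : ℝ × S2 => ENNReal.ofReal (z.1 * g z.2 z.1 ^ 4) :=
          ENNReal.continuous_ofReal.comp
            (continuous_fst.mul ((hgc.comp continuous_swap).pow 4))
        exact this.measurable.aemeasurable
    _ ≤ ∫⁻ w : S2, (42 * (∫⁻ r in Ioo 0 (2 * R), ENNReal.ofReal (r ^ 2) * e (r • (w : E3))) +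
        ENNReal.ofReal (1 / 75)) ∂sphereMeasure := lintegral_mono hray
    _ = 42 * coneFlux f t x (t + 2 * R) + ENNReal.ofReal (4 * Real.pi / 75) := by
        rw [lintegral_add_right _ measurable_const, lintegral_const_mul' _ _ (by simp),
          ← setLIntegral_ball_polar he, lintegral_const, sphereMeasure_univ,
          ← ENNReal.ofReal_mul (by norm_num), coneFlux, add_sub_cancel_left]
        congr 2
        ring

end ConeFlux

/-! ### Almost everywhere convergence of regularizations -/

section Regularization

variable {ρ : E3 → ℝ} {u : ℝ → E3 → ℝ}

theorem scaledMollifier_nonneg (hρ : IsMollifier ρ) (n : ℕ) (x : E3) : 0 ≤ scaledMollifier ρ n x :=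
  mul_nonneg (by positivity) (hρ.nonneg _)

theorem integral_scaledMollifier (hρ : IsMollifier ρ) {n : ℕ} (hn : 1 ≤ n) :
    ∫ x, scaledMollifier ρ n x = 1 := by
  have hn' : (0 : ℝ) < n := by positivity
  simp only [scaledMollifier]
  rw [integral_const_mul, Measure.integral_comp_smul, hρ.integral_eq_one]
  simp only [finrank_euclideanSpace, Fintype.card_fin, smul_eq_mul, mul_one]
  rw [abs_of_pos (by positivity), mul_inv_cancel₀ (by positivity)]

theorem lintegral_scaledMollifier (hρ : IsMollifier ρ) {n : ℕ} (hn : 1 ≤ n) :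
    ∫⁻ x, ENNReal.ofReal (scaledMollifier ρ n x) = 1 := by
  rw [← ofReal_integral_eq_lintegral_ofReal
    ((contDiff_scaledMollifier hρ n).continuous.integrable_of_hasCompactSupport
      (hasCompactSupport_scaledMollifier hρ hn))
    (Eventually.of_forall (scaledMollifier_nonneg hρ n)), integral_scaledMollifier hρ hn,
    ENNReal.ofReal_one]

/-- Convergence at Lebesgue points: `ρ_n` lives in a ball of radius `r / n` and is bounded by a
constant over the volume of that ball. -/
theorem ae_tendsto_mollify (hρ : IsMollifier ρ) {t : ℝ} (hu : LocallyIntegrable (u t) volume) :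
    ∀ᵐ x, Tendsto (fun n => mollify ρ n u t x) atTop (nhds (u t x)) := by
  obtain ⟨r, hr0, hr⟩ := hρ.hasCompactSupport.isCompact.isBounded.subset_closedBall_lt 0 (0 : E3)
  obtain ⟨B, hB⟩ := hρ.hasCompactSupport.exists_bound_of_continuous hρ.contDiff.continuous
  filter_upwards [(Besicovitch.vitaliFamily volume).ae_tendsto_average_norm_sub hu] with x hx
  have hδ : Tendsto (fun n : ℕ => r / n) atTop (nhdsWithin 0 (Ioi 0)) := by
    refine tendsto_nhdsWithin_iff.2 ⟨tendsto_const_div_atTop_nhds_zero_nat r, ?_⟩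
    filter_upwards [eventually_ge_atTop 1] with n hn
    have : (0 : ℝ) < n := by positivity
    exact div_pos hr0 this
  have hmain := tendsto_integral_smul_of_tendsto_average_norm_sub
    (g := fun n y => scaledMollifier ρ n (x - y))
    (B * r ^ 3 * volume.real (Metric.ball (0 : E3) 1))
    ((hx.comp (Besicovitch.tendsto_filterAt volume x)).comp hδ) ?_ ?_ ?_ ?_
  · refine hmain.congr fun n => ?_
    rw [mollify_eq_spaceConv, spaceConv]
    simp only [smul_eq_mul, mul_comm]
  · exact Eventually.of_forall fun n => hu.integrableOn_isCompact (isCompact_closedBall _ _)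
  · refine tendsto_const_nhds.congr' ?_
    filter_upwards [eventually_ge_atTop 1] with n hn
    rw [integral_sub_left_eq_self, integral_scaledMollifier hρ hn]
  · filter_upwards [eventually_ge_atTop 1] with n hn y hy
    have hn' : (0 : ℝ) < n := by positivity
    have h1 : (n : ℝ) • (x - y) ∈ tsupport ρ :=
      subset_tsupport _ (right_ne_zero_of_mul (Function.mem_support.1 hy))
    have h2 := hr h1
    rw [mem_closedBall_zero_iff, norm_smul, Real.norm_of_nonneg hn'.le] at h2
    rw [mem_closedBall_iff_norm', le_div_iff₀ hn', mul_comm]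
    exact h2
  · filter_upwards [eventually_ge_atTop 1] with n hn y
    have hn' : (0 : ℝ) < n := by positivity
    have hv : 0 < volume.real (Metric.ball (0 : E3) 1) :=
      ENNReal.toReal_pos (Metric.measure_ball_pos _ _ one_pos).ne' measure_ball_lt_top.ne
    rw [Measure.addHaar_real_closedBall _ _ (by positivity), scaledMollifier, abs_mul,
      abs_of_pos (by positivity)]
    simp only [finrank_euclideanSpace, Fintype.card_fin]
    calc (n : ℝ) ^ 3 * |ρ ((n : ℝ) • (x - y))| ≤ (n : ℝ) ^ 3 * B := by
          gcongr
          exact hB _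
      _ = _ := by field_simp

/-- Jensen's inequality for the fourth power. -/
theorem ofReal_integral_pow_four_le {κ f : E3 → ℝ} (hκ : ∀ x, 0 ≤ κ x) (hκi : Integrable κ)
    (hκ1 : ∫ x, κ x = 1) (hf : AEStronglyMeasurable f) (hfκ : Integrable fun x => f x * κ x) :
    ENNReal.ofReal ((∫ x, f x * κ x) ^ 4) ≤
      ∫⁻ x, ENNReal.ofReal (κ x) * ENNReal.ofReal (f x ^ 4) := by
  have h0 : ∀ x, ENNReal.ofReal (κ x) * ENNReal.ofReal (f x ^ 4) =
      ENNReal.ofReal (κ x * f x ^ 4) := fun x => (ENNReal.ofReal_mul (hκ x)).symm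
  simp only [h0]
  have hnn : ∀ x, 0 ≤ κ x * f x ^ 4 := fun x => mul_nonneg (hκ x) (by positivity)
  by_cases hfin : ∫⁻ x, ENNReal.ofReal (κ x * f x ^ 4) = ⊤
  · rw [hfin]
    exact le_top
  have hint : Integrable fun x => κ x * f x ^ 4 := by
    refine ⟨hκi.aestronglyMeasurable.mul (hf.pow 4), ?_⟩
    rw [hasFiniteIntegral_iff_ofReal (Eventually.of_forall hnn)]
    exact lt_top_iff_ne_top.2 hfin
  rw [← ofReal_integral_eq_lintegral_ofReal hint (Eventually.of_forall hnn)]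
  refine ENNReal.ofReal_le_ofReal ?_
  set c := ∫ x, f x * κ x
  have h1 : ∫ x, (4 * c ^ 3 * (f x * κ x) - 3 * c ^ 4 * κ x) ≤ ∫ x, κ x * f x ^ 4 := by
    refine integral_mono ((hfκ.const_mul _).sub (hκi.const_mul _)) hint fun x => ?_
    -- Convexity of the fourth power made explicit: `f⁴ - 4 c³ f + 3 c⁴ = (f - c)² ((f + c)² + 2
    -- c²)`, the tangent line being taken at the mean `c`.
    have h2 : 0 ≤ κ x * ((f x - c) ^ 2 * ((f x + c) ^ 2 + 2 * c ^ 2)) :=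
      mul_nonneg (hκ x) (by positivity)
    simp only
    nlinarith [h2]
  rw [integral_sub (hfκ.const_mul _) (hκi.const_mul _), integral_const_mul, integral_const_mul,
    hκ1] at h1
  calc c ^ 4 = 4 * c ^ 3 * c - 3 * c ^ 4 * 1 := by ring
    _ ≤ _ := h1

/-- The lower limit of the fourth powers of the regularizations, a measurable representative
of `u⁴` on each time slice. -/
noncomputable def lowerPowFour (ρ : E3 → ℝ) (u : ℝ → E3 → ℝ) (t : ℝ) (x : E3) : ℝ≥0∞ :=
  liminf (fun m : ℕ => ENNReal.ofReal (mollify ρ (m + 1) u t x ^ 4)) atTop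

theorem ofReal_mollify_pow_four_le (hρ : IsMollifier ρ) {n : ℕ} (hn : 1 ≤ n) {t : ℝ}
    (hu : LocallyIntegrable (u t) volume) (x : E3) :
    ENNReal.ofReal (mollify ρ n u t x ^ 4) ≤
      ∫⁻ z, ENNReal.ofReal (scaledMollifier ρ n z) * lowerPowFour ρ u t (x - z) := by
  have hc := (contDiff_scaledMollifier hρ n).continuous
  have hcs := hasCompactSupport_scaledMollifier hρ hn
  have hi : Integrable fun z => scaledMollifier ρ n (x - z) :=
    (hc.integrable_of_hasCompactSupport hcs).comp_sub_left x
  rw [← lintegral_sub_left_eq_self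
    (fun z => ENNReal.ofReal (scaledMollifier ρ n z) * lowerPowFour ρ u t (x - z)) x]
  simp only [sub_sub_cancel]
  refine (ofReal_integral_pow_four_le (f := u t) (fun z => scaledMollifier_nonneg hρ n (x - z)) hi
    (by rw [integral_sub_left_eq_self, integral_scaledMollifier hρ hn])
    hu.aestronglyMeasurable ?_).trans_eq ?_
  · exact hu.integrable_smul_right_of_hasCompactSupport (by fun_prop)
      (hasCompactSupport_comp_sub hcs x)
  · refine lintegral_congr_ae ?_
    filter_upwards [ae_tendsto_mollify hρ hu] with z hz
    congr 1
    exact (((ENNReal.continuous_ofReal.tendsto _).comp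
      ((hz.pow 4).comp (tendsto_add_atTop_nat 1))).liminf_eq).symm

/-- The index from which the hypothesis holds may depend on the vertex, while the conclusion is for
all `n ≥ 1`. A cone is a null set in space-time, so `u⁴` cannot be used on it directly;
`lowerPowFour` is defined at every point and is measurable along cones. -/
theorem conePotential_mollify_le (hρ : IsMollifier ρ)
    (hu : WeaklyContinuous fun t : Ici (0 : ℝ) => u t) {t R : ℝ} (ht : 0 ≤ t) {c : ℝ≥0∞}
    (hc : ∀ z, ∀ᶠ m : ℕ in atTop, conePotential (fun t x => mollify ρ m u t x ^ 4) t z R ≤ c)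
    {n : ℕ} (hn : 1 ≤ n) (x : E3) :
    conePotential (fun t x => mollify ρ n u t x ^ 4) t x R ≤ c := by
  have hcont : ∀ m : ℕ, Continuous fun q : (ℝ × S2) × E3 =>
      mollify ρ (m + 1) u (max (t + q.1.1) 0) (q.2 + q.1.1 • (q.1.2 : E3)) := fun m =>
    (jointSmooth_mollify hρ (Nat.le_add_left 1 m) hu).clamp.continuous.comp
      (f := fun q : (ℝ × S2) × E3 => (t + q.1.1, q.2 + q.1.1 • (q.1.2 : E3))) (by fun_prop)
  let L : (ℝ × S2) → E3 → ℝ≥0∞ := fun p z =>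
    ENNReal.ofReal p.1 * lowerPowFour ρ u (max (t + p.1) 0) (z + p.1 • (p.2 : E3))
  let G : ℕ → (ℝ × S2) → E3 → ℝ≥0∞ := fun m p z => ENNReal.ofReal p.1 *
    ENNReal.ofReal (mollify ρ (m + 1) u (max (t + p.1) 0) (z + p.1 • (p.2 : E3)) ^ 4)
  have hGm : ∀ m, Measurable fun q : (ℝ × S2) × E3 => G m q.1 q.2 := fun m =>
    (measurable_fst.fst.ennreal_ofReal).mul ((hcont m).measurable.pow_const 4).ennreal_ofReal
  have hGL : ∀ p z, L p z = liminf (fun m => G m p z) atTop := fun p z =>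
    (ENNReal.liminf_const_mul_of_ne_top ENNReal.ofReal_ne_top).symm
  have hLm : Measurable fun q : (ℝ × S2) × E3 => L q.1 q.2 := by
    simp only [hGL]
    exact Measurable.liminf hGm
  let ν := ((volume : Measure ℝ).restrict (Ioo 0 R)).prod sphereMeasure
  have hGz : ∀ m z, Measurable fun p => G m p z := fun m z =>
    (hGm m).comp (measurable_id.prodMk measurable_const)
  have hcone : ∀ m z, conePotential (fun t x => mollify ρ (m + 1) u t x ^ 4) t z R =
      ∫⁻ p, G m p z ∂ν := by
    intro m z
    rw [lintegral_prod (fun p => G m p z) (hGz m z).aemeasurable]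
    refine setLIntegral_congr_fun measurableSet_Ioo fun s hs => lintegral_congr fun w => ?_
    simp only [G]
    rw [max_eq_left (by linarith [hs.1]), ← ENNReal.ofReal_mul hs.1.le]
  -- Fatou's lemma uses only large `m`, so no uniformity in the vertex `z` is required.
  have hL : ∀ z, ∫⁻ p, L p z ∂ν ≤ c := by
    intro z
    simp only [hGL]
    refine (lintegral_liminf_le (f := fun m p => G m p z) fun m => hGz m z).trans ?_
    rw [show (fun m => ∫⁻ p, G m p z ∂ν) = fun m : ℕ =>
      conePotential (fun t x => mollify ρ (m + 1) u t x ^ 4) t z R from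
        funext fun m => (hcone m z).symm]
    refine (liminf_le_liminf ?_).trans_eq (liminf_const c)
    exact (tendsto_add_atTop_nat 1).eventually (hc z)
  obtain ⟨k, rfl⟩ := Nat.exists_eq_add_of_le' hn
  have hρm : Measurable fun z => ENNReal.ofReal (scaledMollifier ρ (k + 1) z) :=
    (contDiff_scaledMollifier hρ (k + 1)).continuous.measurable.ennreal_ofReal
  have hLx : Measurable fun q : (ℝ × S2) × E3 => L q.1 (x - q.2) :=
    hLm.comp (measurable_fst.prodMk (measurable_const.sub measurable_snd))
  calc conePotential (fun t x => mollify ρ (k + 1) u t x ^ 4) t x R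
      = ∫⁻ p, G k p x ∂ν := hcone k x
    _ ≤ ∫⁻ p, (∫⁻ z, ENNReal.ofReal (scaledMollifier ρ (k + 1) z) * L p (x - z)) ∂ν := by
        refine lintegral_mono fun p => ?_
        have h1 := ofReal_mollify_pow_four_le hρ hn (u := u) (t := max (t + p.1) 0)
          (hu.locallyIntegrable ⟨_, mem_Ici.2 (le_max_right _ _)⟩) (x + p.1 • (p.2 : E3))
        calc G k p x ≤ ENNReal.ofReal p.1 * ∫⁻ z, ENNReal.ofReal (scaledMollifier ρ (k + 1) z) *
              lowerPowFour ρ u (max (t + p.1) 0) (x + p.1 • (p.2 : E3) - z) :=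
              mul_le_mul' le_rfl h1
          _ = _ := by
              rw [← lintegral_const_mul' _ _ ENNReal.ofReal_ne_top]
              refine lintegral_congr fun z => ?_
              simp only [L]
              rw [mul_left_comm, sub_add_eq_add_sub]
    -- After Tonelli the inner integral is over the cone translated to the vertex `x - z`, where the
    -- Fatou bound applies.
    _ = ∫⁻ z, (∫⁻ p, ENNReal.ofReal (scaledMollifier ρ (k + 1) z) * L p (x - z) ∂ν) :=
        lintegral_lintegral_swap ((hρm.comp measurable_snd).mul hLx).aemeasurable
    _ = ∫⁻ z, ENNReal.ofReal (scaledMollifier ρ (k + 1) z) * ∫⁻ p, L p (x - z) ∂ν :=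
        lintegral_congr fun z => lintegral_const_mul' _ _ ENNReal.ofReal_ne_top
    _ ≤ ∫⁻ z, ENNReal.ofReal (scaledMollifier ρ (k + 1) z) * c := by
        gcongr with z
        exact hL _
    _ = c := by rw [lintegral_mul_const _ hρm, lintegral_scaledMollifier hρ hn, one_mul]

end Regularization

/-! ### Smallness of the energy and conclusion -/

section SmallEnergy

/-- Uniqueness of the weak gradient: the initial energy density of any solution is that of the data,
so the radius of smallness can be fixed before the solution is given. -/
theorem HasWeakGradient.ae_eq {f f' : E3 → ℝ} {g g' : E3 → E3} (h : HasWeakGradient f g)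
    (h' : HasWeakGradient f' g') (hf : f =ᵐ[volume] f') (hg : LocallyIntegrable g volume)
    (hg' : LocallyIntegrable g' volume) : g =ᵐ[volume] g' := by
  refine ae_eq_of_integral_contDiff_smul_eq hg hg' fun ψ hψ hψc => ?_
  have key : ∀ {f : E3 → ℝ} {g : E3 → E3}, HasWeakGradient f g → LocallyIntegrable g volume →
      ∀ e : E3, inner ℝ e (∫ x, ψ x • g x) = - ∫ x, f x * fderiv ℝ ψ x e := by
    intro f g h hg e
    rw [← integral_inner (hg.integrable_smul_left_of_hasCompactSupport hψ.continuous hψc),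
      h ψ ⟨hψ, hψc⟩ e, neg_neg]
    refine integral_congr_ae (Eventually.of_forall fun x => ?_)
    simp only [inner_smul_right, real_inner_comm e, mul_comm]
  refine ext_inner_left ℝ fun e => ?_
  rw [key h hg, key h' hg']
  congr 1
  refine integral_congr_ae ?_
  filter_upwards [hf] with x hx
  rw [hx]

/-- The energy of a function of finite energy is uniformly small on small balls. -/
theorem exists_radius_setLIntegral_lt {e : E3 → ℝ≥0∞} (he : ∫⁻ x, e x ≠ ⊤) {ε : ℝ≥0∞}
    (hε : ε ≠ 0) : ∃ r : ℝ, 0 < r ∧ ∀ x, ∫⁻ y in Metric.ball x r, e y < ε := by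
  obtain ⟨δ, hδ, hδe⟩ := exists_pos_setLIntegral_lt_of_measure_lt he hε
  have h1 : Tendsto (fun r : ℝ => ENNReal.ofReal (r ^ 3) * volume (Metric.ball (0 : E3) 1))
      (nhds 0) (nhds 0) := by
    have h2 : Tendsto (fun r : ℝ => ENNReal.ofReal (r ^ 3)) (nhds 0) (nhds 0) := by
      have : Continuous fun r : ℝ => ENNReal.ofReal (r ^ 3) :=
        ENNReal.continuous_ofReal.comp (continuous_pow 3)
      simpa using this.tendsto 0
    have h3 := ENNReal.Tendsto.mul_const h2
      (Or.inr (measure_ball_lt_top (μ := (volume : Measure E3)) (x := 0) (r := 1)).ne)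
    rwa [zero_mul] at h3
  obtain ⟨r, hr, hr0⟩ := (((h1.eventually_lt_const hδ).filter_mono
    (nhdsWithin_le_nhds (s := Ioi 0))).and self_mem_nhdsWithin).exists
  refine ⟨r, hr0, fun x => hδe _ ?_⟩
  rw [Measure.addHaar_ball _ _ (le_of_lt hr0), finrank_euclideanSpace, Fintype.card_fin]
  exact hr

variable {ρ : E3 → ℝ} {u : ℝ → E3 → ℝ} {Du : ℝ → E3 → E3} {ut : ℝ → E3 → ℝ} {C α : ℝ}

/-- The forward inequality takes the flux to energy at time `2T - t`, possibly later than `T`, and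
the backward one returns to time zero. Each costs a factor `C` and enlarges the radius by `α`. -/
theorem coneFlux_limsup_le (hL : LocalEnergyConditions C α ρ u Du ut) (hα : 0 ≤ α) {t T r : ℝ}
    (ht : t ∈ Icc 0 T) (hr : α * (2 * T + α * (2 * T)) ≤ r) (x : E3) :
    limsup (fun n : ℕ => coneFlux (mollify ρ n u) t x (t + 2 * (T - t))) atTop ≤
      ENNReal.ofReal C * (ENNReal.ofReal C * localEnergy u Du ut 0 x r) := by
  have ht0 := ht.1
  have htT := ht.2
  have h1 := hL.forward x t (t + 2 * (T - t)) ht0 (by linarith)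
  rw [add_sub_cancel_left] at h1
  have hα1 : 0 ≤ α * (2 * (T - t)) := mul_nonneg hα (by linarith)
  have h2 := hL.backward x 0 (t + 2 * (T - t)) (t + 2 * (T - t) + α * (2 * (T - t))) le_rfl
    (by linarith) (by linarith)
  rw [add_sub_cancel_left, sub_zero] at h2
  refine h1.trans (mul_le_mul' le_rfl (h2.trans (mul_le_mul' le_rfl ?_)))
  refine lintegral_mono_set (Metric.ball_subset_ball (le_trans ?_ hr))
  have h3 : α * (2 * (T - t)) ≤ α * (2 * T) := by gcongr; linarith
  gcongr
  linarith

/-- The constants fit because `42 / 200 + 4π / 75 ≤ π / 8`, already a consequence of `π > 3`. -/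
theorem conePotential_mollify_le_of_small (hρ : IsMollifier ρ) (hE : IsEnergyClass u Du ut)
    (hL : LocalEnergyConditions C α ρ u Du ut) (hα : 0 ≤ α) {T r : ℝ}
    (hr : α * (2 * T + α * (2 * T)) ≤ r)
    (hsmall : ∀ x, ENNReal.ofReal C * (ENNReal.ofReal C * localEnergy u Du ut 0 x r) <
      ENNReal.ofReal (1 / 200)) {n : ℕ} (hn : 1 ≤ n) {t : ℝ} (ht : t ∈ Icc 0 T) (x : E3) :
    conePotential (fun t x => mollify ρ n u t x ^ 4) t x (T - t) ≤
      ENNReal.ofReal (Real.pi / 8) := by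
  rcases ht.2.eq_or_lt with rfl | htT
  · simp [conePotential]
  have hu := weaklyContinuous_u hE hL.backward
  refine conePotential_mollify_le hρ hu ht.1 (fun z => ?_) hn x
  filter_upwards [eventually_lt_of_limsup_lt
    ((coneFlux_limsup_le hL hα ht hr z).trans_lt (hsmall z)), eventually_ge_atTop 1] with m hm hm1
  refine (conePotential_pow_four_le (jointSmooth_mollify hρ hm1 hu)
    (jointSmooth_mollify hρ hm1 (weaklyContinuous_ut hE))
    (fun t ht x => hasDerivWithinAt_mollify hρ hm1 hE ht x) ht.1 (sub_pos.2 htT) z).trans ?_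
  calc _ ≤ 42 * ENNReal.ofReal (1 / 200) + ENNReal.ofReal (4 * Real.pi / 75) := by gcongr
    _ = ENNReal.ofReal (42 * (1 / 200) + 4 * Real.pi / 75) := by
        rw [ENNReal.ofReal_add (by norm_num) (by positivity), ENNReal.ofReal_mul (by norm_num)]
        simp
    _ ≤ _ := by
        refine ENNReal.ofReal_le_ofReal ?_
        linarith [Real.pi_gt_three]

theorem conePotential_mono {f g : ℝ → E3 → ℝ} {t r : ℝ} (x : E3)
    (h : ∀ s ∈ Icc t (t + r), ∀ y, f s y ≤ g s y) : conePotential f t x r ≤ conePotential g t x r := by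
  refine setLIntegral_mono' measurableSet_Ioo fun s hs => lintegral_mono fun w => ?_
  refine ENNReal.ofReal_le_ofReal (mul_le_mul_of_nonneg_left (h _ ⟨?_, ?_⟩ _) hs.1.le)
  · linarith [hs.1]
  · linarith [hs.2]

theorem conePotential_add_le {f g : ℝ → E3 → ℝ} (hf : Continuous fun z : ℝ × E3 => f z.1 z.2)
    (hf0 : ∀ t x, 0 ≤ f t x) (hg0 : ∀ t x, 0 ≤ g t x) {c : ℝ} (hc : 0 ≤ c) (t : ℝ) (x : E3)
    (r : ℝ) : conePotential (fun t x => c * (f t x + g t x)) t x r ≤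
      ENNReal.ofReal c * (conePotential f t x r + conePotential g t x r) := by
  have hz : Continuous fun z : ℝ × S2 => z.1 * f (t + z.1) (x + z.1 • (z.2 : E3)) :=
    continuous_fst.mul (hf.comp (f := fun z : ℝ × S2 => (t + z.1, x + z.1 • (z.2 : E3)))
      (by fun_prop))
  have hm := hz.measurable.ennreal_ofReal
  have hm' : Measurable fun s => ∫⁻ w : S2,
      ENNReal.ofReal (s * f (t + s) (x + s • (w : E3))) ∂sphereMeasure :=
    hm.lintegral_prod_right'
  simp only [conePotential]
  rw [← lintegral_add_left hm',
    ← lintegral_const_mul' _ _ ENNReal.ofReal_ne_top]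
  refine setLIntegral_mono' measurableSet_Ioo fun s hs => ?_
  have hs' : Measurable fun w : S2 => ENNReal.ofReal (s * f (t + s) (x + s • (w : E3))) :=
    hm.comp measurable_prodMk_left
  rw [← lintegral_add_left hs', ← lintegral_const_mul' _ _ ENNReal.ofReal_ne_top]
  refine lintegral_mono fun w => ?_
  have h1 := mul_nonneg hs.1.le (hf0 (t + s) (x + s • (w : E3)))
  have h2 := mul_nonneg hs.1.le (hg0 (t + s) (x + s • (w : E3)))
  rw [← ENNReal.ofReal_add h1 h2, ← ENNReal.ofReal_mul hc]
  exact ENNReal.ofReal_le_ofReal (by linarith)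

end SmallEnergy

/-! ### The potential as a fourth power. -/

section Potential

variable {ρ : E3 → ℝ} {u v : ℝ → E3 → ℝ}

theorem potential_eq (ρ : E3 → ℝ) (n : ℕ) (u v : ℝ → E3 → ℝ) (t : ℝ) (x : E3) :
    potential ρ n u v t x = (mollify ρ n u t x + mollify ρ n v t x) ^ 4 := by
  rw [potential]
  ring

theorem potential_nonneg (ρ : E3 → ℝ) (n : ℕ) (u v : ℝ → E3 → ℝ) (t : ℝ) (x : E3) :
    0 ≤ potential ρ n u v t x := by
  rw [potential_eq]
  positivity

theorem potential_le (ρ : E3 → ℝ) (n : ℕ) (u v : ℝ → E3 → ℝ) (t : ℝ) (x : E3) :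
    potential ρ n u v t x ≤ 8 * (mollify ρ n u t x ^ 4 + mollify ρ n v t x ^ 4) := by
  rw [potential_eq]
  nlinarith [sq_nonneg (mollify ρ n u t x - mollify ρ n v t x),
    sq_nonneg (mollify ρ n u t x ^ 2 - mollify ρ n v t x ^ 2),
    sq_nonneg (mollify ρ n u t x + mollify ρ n v t x)]

theorem TimeSmooth.potential {n : ℕ} {T : ℝ} {k : ℕ} (hu : TimeSmooth T k (mollify ρ n u))
    (hv : TimeSmooth T k (mollify ρ n v)) : TimeSmooth T k (potential ρ n u v) := by
  have h := hu.add hv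
  have h2 := h.mul h
  refine (h2.mul h2).congr fun t _ => funext fun x => ?_
  rw [potential_eq]
  ring

end Potential

/-! ### Support of the source and conclusion. -/

theorem IsSource.exists_vanishesOutside {T : ℝ} (hT : 0 < T) {F : ℝ → E3 → ℝ} (hF : IsSource T F) :
    ∃ b R : ℝ, 0 ≤ b ∧ b < T ∧ VanishesOutside b R F := by
  obtain ⟨-, hc, hsub⟩ := hF
  have hc' : IsCompact (tsupport fun z : ℝ × E3 => F z.1 z.2) := hc
  -- Inserting zero makes the set nonempty and its supremum nonnegative, even if `F` is zero.
  let S : Set ℝ := insert 0 (Prod.fst '' tsupport fun z : ℝ × E3 => F z.1 z.2)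
  have hS : IsCompact S := (hc'.image continuous_fst).insert 0
  have hST : ∀ s ∈ S, s < T := by
    rintro s (rfl | ⟨z, hz, rfl⟩)
    · exact hT
    · exact (hsub hz).1.2
  have hmax := hST _ (hS.sSup_mem ⟨0, mem_insert _ _⟩)
  have h0 : 0 ≤ sSup S := le_csSup hS.bddAbove (mem_insert _ _)
  obtain ⟨R, hR⟩ := hc'.isBounded.subset_closedBall 0
  -- The midpoint lies strictly after the support and before `T`. Adding `T` to the radius lets the
  -- shrinking cone contain the support at all times up to `T`.
  refine ⟨(sSup S + T) / 2, R + T, by linarith, by linarith, fun s x h => ?_⟩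
  by_contra hne
  have hz : (s, x) ∈ tsupport fun z : ℝ × E3 => F z.1 z.2 :=
    subset_tsupport _ (Function.mem_support.2 hne)
  have h1 : s ≤ sSup S := le_csSup hS.bddAbove (mem_insert_of_mem _ ⟨_, hz, rfl⟩)
  have h2 := hR hz
  rw [mem_closedBall_zero_iff, Prod.norm_mk, max_le_iff] at h2
  rcases h with h | h <;> linarith [h2.2]

/-- The order of quantifiers is the content: `K` and `M` depend on `T` and `F` only and serve all
admissible potentials at once, which yields uniformity in `n`. -/
theorem exists_bounded_dual_solution {T : ℝ} (hT : 0 < T) {F : ℝ → E3 → ℝ} (hF : IsSource T F) :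
    ∃ (K : Set (ℝ × E3)) (M : ℝ), IsCompact K ∧ K ⊆ Ico 0 T ×ˢ univ ∧
      ∀ V : ℝ → E3 → ℝ, TimeSmooth T 1 V → (∀ t x, 0 ≤ V t x) →
        (∀ t ∈ Icc 0 T, ∀ x, conePotential V t x (T - t) ≤ ENNReal.ofReal (2 * Real.pi)) →
        ∃ φ : ℝ → E3 → ℝ, SolvesDual T V F φ ∧ IsSmoothTimeOrder 3 T φ ∧
          (∀ k : ℕ, IsSmoothTimeOrder k T V → IsSmoothTimeOrder (k + 2) T φ) ∧
          (∀ t ∈ Icc 0 T, ∀ x, (t, x) ∉ K → φ t x = 0) ∧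
          (∀ t ∈ Icc 0 T, ∀ x, |φ t x| ≤ M) := by
  obtain ⟨b, R, hb0, hbT, hFv⟩ := hF.exists_vanishesOutside hT
  obtain ⟨B, hB⟩ := hF.2.1.exists_bound_of_continuous hF.1.continuous
  refine ⟨Icc 0 b ×ˢ Metric.closedBall 0 R, 2 * (T ^ 2 * B),
    isCompact_Icc.prod (isCompact_closedBall _ _),
    fun z hz => ⟨⟨hz.1.1, hz.1.2.trans_lt hbT⟩, mem_univ _⟩, fun V hV hV0 hcone => ?_⟩
  obtain ⟨φ, hsol, hφ, hreg, hφv, hφeq⟩ :=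
    exists_dual_solution hT hbT.le (hV.of_le zero_le_one) hF.1 hFv
  have hproj : ∀ t ∈ Icc 0 T, (projIcc 0 T hT.le t : ℝ) = t := fun t ht => by
    rw [projIcc_of_mem hT.le ht]
  refine ⟨φ, hsol, (isSmoothTimeOrder_iff hT).2 (hreg 1 hV), fun k hk =>
    (isSmoothTimeOrder_iff hT).2 (hreg k ((isSmoothTimeOrder_iff hT).1 hk)), fun t ht x hx => ?_,
    abs_dual_solution_le hT.le hbT.le (V := fun t => V (projIcc 0 T hT.le t))
      (hV.jointSmooth.comp_param continuous_projIcc).continuous hF.1.continuous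
      (fun t x => hB (t, x)) (fun t x => hV0 _ x) hφ hφv hφeq fun t ht x => ?_⟩
  · by_contra hne
    refine hx ⟨⟨ht.1, ?_⟩, ?_⟩
    · by_contra h
      exact hne (hφv t x (Or.inl (not_le.1 h).le))
    · rw [mem_closedBall_zero_iff]
      by_contra h
      exact hne (hφv t x (Or.inr (by linarith [ht.1, not_le.1 h])))
  · refine (conePotential_mono x fun s hs y => ?_).trans (hcone t ht x)
    rw [hproj s ⟨ht.1.trans hs.1, by linarith [hs.2]⟩]

theorem mainTheorem2
    (φ₀ φ₁ : E3 → ℝ) (hφ₀ : MemHomSobolev φ₀) (hφ₁ : MemLp φ₁ 2 volume)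
    (C α : ℝ) (hC : 1 ≤ C) (hα : 1 ≤ α) :
    ∃ T₀ : ℝ, 0 < T₀ ∧
      ∀ (ρ : E3 → ℝ), IsMollifier ρ →
      ∀ (u : ℝ → E3 → ℝ) (Du : ℝ → E3 → E3) (ut : ℝ → E3 → ℝ)
        (v : ℝ → E3 → ℝ) (Dv : ℝ → E3 → E3) (vt : ℝ → E3 → ℝ),
        IsWeakSolution φ₀ φ₁ u Du ut → LocalEnergyConditions C α ρ u Du ut →
        IsWeakSolution φ₀ φ₁ v Dv vt → LocalEnergyConditions C α ρ v Dv vt →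
      ∀ T : ℝ, 0 < T → T ≤ T₀ →
      ∀ F : ℝ → E3 → ℝ, IsSource T F →
      ∃ (K : Set (ℝ × E3)) (M : ℝ), IsCompact K ∧ K ⊆ Ico 0 T ×ˢ univ ∧
        ∀ n : ℕ, 1 ≤ n →
          ∃ φ : ℝ → E3 → ℝ,
            SolvesDual T (potential ρ n u v) F φ ∧
            IsSmoothTimeOrder 3 T φ ∧
            (∀ k : ℕ, IsSmoothTimeOrder k T (potential ρ n u v) →
              IsSmoothTimeOrder (k + 2) T φ) ∧
            (∀ t ∈ Icc 0 T, ∀ x, (t, x) ∉ K → φ t x = 0) ∧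
            (∀ t ∈ Icc 0 T, ∀ x, |φ t x| ≤ M) := by
  obtain ⟨hφ₀6, g, hg, hg2⟩ := hφ₀
  have hC0 : 0 < C := one_pos.trans_le hC
  have hα0 : 0 < α := one_pos.trans_le hα
  have he := lintegral_energy_lt_top (u := fun _ => φ₀) (Du := fun _ => g) (ut := fun _ => φ₁)
    (t := 0) hφ₀6 hg2 hφ₁
  -- The two energy inequalities multiply this threshold by `C²`, giving `1 / 400`, strictly below
  -- the required `1 / 200`.
  obtain ⟨r, hr0, hr⟩ := exists_radius_setLIntegral_lt he.ne
    (ε := ENNReal.ofReal (1 / (400 * C ^ 2))) (ENNReal.ofReal_pos.2 (by positivity)).ne'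
  -- The largest `T` for which the radius `α (2T + α 2T)` reached at time zero is at most `r`.
  refine ⟨r / (2 * α * (1 + α)), by positivity, fun ρ hρ u Du ut v Dv vt hu huL hv hvL T hT hTT₀ F
    hF => ?_⟩
  have hTr : α * (2 * T + α * (2 * T)) ≤ r := by
    rw [le_div_iff₀ (by positivity)] at hTT₀
    linarith
  have hsmall : ∀ {u : ℝ → E3 → ℝ} {Du : ℝ → E3 → E3} {ut : ℝ → E3 → ℝ},
      IsWeakSolution φ₀ φ₁ u Du ut → ∀ x,
        ENNReal.ofReal C * (ENNReal.ofReal C * localEnergy u Du ut 0 x r) <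
          ENNReal.ofReal (1 / 200) := by
    intro u Du ut hu x
    have hDu : Du 0 =ᵐ[volume] g := (hu.energyClass.weakGradient 0 le_rfl).ae_eq hg hu.initial_u
      ((hu.energyClass.memLp_Du 0 le_rfl).locallyIntegrable (by norm_num))
      (hg2.locallyIntegrable (by norm_num))
    have hE : localEnergy u Du ut 0 x r ≤ ENNReal.ofReal (1 / (400 * C ^ 2)) := by
      refine le_trans (le_of_eq ?_) (hr x).le
      refine lintegral_congr_ae (ae_restrict_of_ae ?_)
      filter_upwards [hDu, hu.initial_u, hu.initial_ut] with y h1 h2 h3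
      rw [h1, h2, h3]
    calc ENNReal.ofReal C * (ENNReal.ofReal C * localEnergy u Du ut 0 x r)
        ≤ ENNReal.ofReal C * (ENNReal.ofReal C * ENNReal.ofReal (1 / (400 * C ^ 2))) := by gcongr
      _ = ENNReal.ofReal (1 / 400) := by
          rw [← ENNReal.ofReal_mul hC0.le, ← ENNReal.ofReal_mul hC0.le]
          congr 1
          field_simp
      _ < ENNReal.ofReal (1 / 200) := (ENNReal.ofReal_lt_ofReal_iff (by norm_num)).2 (by norm_num)
  obtain ⟨K, M, hK, hKT, hex⟩ := exists_bounded_dual_solution hT hF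
  refine ⟨K, M, hK, hKT, fun n hn => hex _ ?_ (potential_nonneg ρ n u v) fun t ht x => ?_⟩
  · exact (timeSmooth_mollify hρ hn hu.energyClass
      (weaklyContinuous_u hu.energyClass huL.backward) T).potential
        (timeSmooth_mollify hρ hn hv.energyClass
          (weaklyContinuous_u hv.energyClass hvL.backward) T)
  · have hcont := ((jointSmooth_mollify hρ hn
      (weaklyContinuous_u hu.energyClass huL.backward)).clamp.continuous).pow 4
    have h1 := conePotential_mollify_le_of_small hρ hu.energyClass huL hα0.le hTr (hsmall hu) hn
      ht x
    have h2 := conePotential_mollify_le_of_small hρ hv.energyClass hvL hα0.le hTr (hsmall hv) hn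
      ht x
    have hmax : ∀ s ∈ Icc t (t + (T - t)), max s 0 = s := fun s hs =>
      max_eq_left (ht.1.trans hs.1)
    -- Time is clamped in `u_n` only to have a function continuous on all of `ℝ × E3`, for
    -- measurability; on the cone nothing changes. The constants combine to `8 (π / 8 + π / 8) =
    -- 2π`.
    calc conePotential (potential ρ n u v) t x (T - t)
        ≤ conePotential (fun t x => 8 * (mollify ρ n u (max t 0) x ^ 4 + mollify ρ n v t x ^ 4))
            t x (T - t) := conePotential_mono x fun s hs y => by
              rw [hmax s hs]
              exact potential_le ρ n u v s y
      _ ≤ ENNReal.ofReal 8 * (conePotential (fun t x => mollify ρ n u (max t 0) x ^ 4) t x (T - t)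
            + conePotential (fun t x => mollify ρ n v t x ^ 4) t x (T - t)) :=
          conePotential_add_le hcont (fun _ _ => by positivity) (fun _ _ => by positivity)
            (by norm_num) t x _
      _ ≤ ENNReal.ofReal 8 * (ENNReal.ofReal (Real.pi / 8) + ENNReal.ofReal (Real.pi / 8)) := by
          refine mul_le_mul' le_rfl (add_le_add (le_trans ?_ h1) h2)
          exact conePotential_mono x fun s hs y => by rw [hmax s hs]
      _ = ENNReal.ofReal (2 * Real.pi) := by
          rw [← ENNReal.ofReal_add (by positivity) (by positivity),
            ← ENNReal.ofReal_mul (by norm_num)]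
          congr 1
          ring
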